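/- **Setting.** Let $H$ be a separable real Hilbert space and $X$ a separable reflexive real Banach space that is continuously, densely and compactly embedded in $H$; with $H$ identified with its dual this gives $X\hookrightarrow H\hookrightarrow X'$, where $\langle h,v\rangle_{X'\times X}=(h,v)_H$ for $h\in H$, $v\in X$. Let $T>0$, $\alpha\in(0,1)$, $p>1$, $\frac1p+\frac1{p'}=1$, $u_0\in X$, and let $\mathcal E\in C^1(X;\mathbb R)$ with Gâteaux derivative $\delta\mathcal E$ and gradient $\operatorname{grad}_H\mathcal E:X\to X'$, $\langle\operatorname{grad}_H\mathcal E(u),v\rangle_{X'\times X}=\delta\mathcal E(u,v)$. Assume that for some constants $C_0,C_1,C_2>0$ and all $u\in X$ $$\|\operatorname{grad}_H\mathcal E(u)\|_{X'}\le C_0\|u\|_X^{p-1}+C_0,\qquad \delta\mathcal E(u,u)\ge C_1\|u\|_X^p-C_2\|u\|_H^2,$$ and that the realization of $\operatorname{grad}_H\mathcal E$ as an operator from $L^p(0,T;X)$ to $L^{p'}(0,T;X')$ is weak-to-weak (sequentially) continuous. **Notation.** Let $g_\beta(t)=t^{\beta-1}/\Gamma(\beta)$, $(g_\beta*f)(t)=\int_0^tg_\beta(t-s)f(s)\,ds$,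 and let $\partial_t^\alpha u:=\partial_t\big(g_{1-\alpha}*(u-u_0)\big)$ (distributional derivative) be the Caputo derivative of $u$ with initial value $u_0$; $W^{\alpha,r}(0,T;Y)$ consists of the $u\in L^r(0,T;Y)$ with $\partial_t^\alpha u\in L^r(0,T;Y)$, and $H^\alpha=W^{\alpha,2}$. For $\theta\in(0,1)$ put $$w_\alpha(\theta)=g_{1-\alpha}(\theta)\,g_\alpha(1-\theta),\quad w_{\alpha,0}(\theta)=(1-\theta)\,w_\alpha(\theta),\quad c_0(\theta)=\frac1{1-\theta},\quad c_1(\theta)=\frac\theta{1-\theta},$$ let $L^2_\alpha(0,1;Y)$ and $L^2_{\alpha,0}(0,1;Y)$ be the $Y$-valued $L^2$ spaces on $(0,1)$ with weights $w_\alpha$ and $w_{\alpha,0}$, and let $\widetilde X=L^2_\alpha(0,1;X)$, $\widetilde H=L^2_{\alpha,0}(0,1;H)$. For $\tilde v\in\widetilde X$ let $$\mathcal C\tilde v=u_0+\int_0^1w_\alpha(\theta)\tilde v(\theta)\,d\theta,\qquad \mathcal H(\tilde v)=\frac12\int_0^1\theta\,w_\alpha(\theta)\|\tilde v(\theta)\|_H^2\,d\theta,\qquad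 \widetilde{\mathcal E}=\mathcal E\circ\mathcal C+\mathcal H:\widetilde X\to\mathbb R.$$ **Solutions.** A (variational) solution of the fractional gradient flow $$\partial_t^\alpha u=-\operatorname{grad}_H\mathcal E(u),\quad u(0)=u_0,\tag{F}$$ is a $u\in L^p(0,T;X)\cap L^\infty(0,T;H)\cap W^{\alpha,p'}(0,T;X')$ such that $g_{1-\alpha}*(u-u_0)\in C([0,T];H)$ vanishes at $t=0$ and, for a.e. $t$, $\langle\partial_t^\alpha u(t),v\rangle_{X'\times X}+\delta\mathcal E(u(t),v)=0$ for all $v\in X$. A (variational) solution of the augmented gradient flow $$\partial_t\tilde u=-\operatorname{grad}_{\widetilde H}\widetilde{\mathcal E}(\tilde u),\quad\tilde u(0)=0,\tag{A}$$ is a $\tilde u\in L^p(0,T;\widetilde X)\cap L^\infty(0,T;\widetilde H)\cap W^{1,p'}(0,T;\widetilde X')$ with a representative in $C([0,T];\widetilde H)$ that vanishes at $t=0$ and such that, for a.e. $t$, $\langle\partial_t\tilde u(t),\tilde v\rangle_{\widetilde X'\times\widetilde X}+\delta\widetilde{\mathcal E}(\tilde u(t),\tilde v)=0$ for all $\tilde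 v\in\widetilde X$. Functions of $t$ that agree almost everywhere are identified. **Theorem.** For every solution $u$ of (F) there is a solution $\tilde u$ of (A), and for every solution $\tilde u$ of (A) there is a solution $u$ of (F), such that for a.e. $t\in(0,T)$ and a.e. $\theta\in(0,1)$ $$u(t)=\mathcal C\tilde u(t)=u_0+\int_0^1g_{1-\alpha}(\theta)g_\alpha(1-\theta)\,\tilde u(t,\theta)\,d\theta\quad\text{in }X,$$ $$\tilde u(t,\theta)=-c_0(\theta)\int_0^te^{-c_1(\theta)(t-s)}\operatorname{grad}_H\mathcal E(u(s))\,ds\quad\text{in }X'.$$ This correspondence between the solutions of (F) and those of (A) is one-to-one. Moreover, whenever $u$ and $\tilde u$ correspond to each other, $$u\in L^p(0,T;X)\cap L^\infty(0,T;H)\cap H^\alpha(0,T;H),$$ $$\tilde u\in L^\infty(0,T;L^2_\alpha(0,1;H))\cap H^1(0,T;L^2_{\alpha,0}(0,1;H))\cap L^\infty(0,1;L^{p'}(0,T;H)).$$ -/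

import Mathlib

open MeasureTheory Set Filter Topology
open scoped ENNReal ContDiff

noncomputable section

namespace FracGF

/-! ### Time intervals, weak derivatives, fractional kernels -/

/-- Lebesgue measure on the time interval `(0,T)`; `L^p(0,T;Y)` is `MemLp · p (timeMeasure T)`. -/
def timeMeasure (T : ℝ) : Measure ℝ := volume.restrict (Ioo 0 T)

/-- `d` is the distributional derivative of `f` on `(0,T)`:
`∫ φ' f = - ∫ φ d` for all real test functions `φ ∈ C_c^∞(0,T)`. It is only used for
(Bochner) integrable `f` and `d`. -/
def HasWeakDeriv {Y : Type*} [NormedAddCommGroup Y] [NormedSpace ℝ Y]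
    (T : ℝ) (f d : ℝ → Y) : Prop :=
  ∀ φ : ℝ → ℝ, ContDiff ℝ ∞ φ → HasCompactSupport φ → tsupport φ ⊆ Ioo 0 T →
    ∫ t, deriv φ t • f t ∂(timeMeasure T) = - ∫ t, φ t • d t ∂(timeMeasure T)

/-- The Sobolev-Bochner space `W^{1,p}(0,T;Y)`. -/
def MemSobolev {Y : Type*} [NormedAddCommGroup Y] [NormedSpace ℝ Y]
    (p : ℝ≥0∞) (T : ℝ) (f : ℝ → Y) : Prop :=
  MemLp f p (timeMeasure T) ∧ ∃ d : ℝ → Y, MemLp d p (timeMeasure T) ∧ HasWeakDeriv T f d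

/-- The kernel `g_β(t) = t^{β-1} / Γ(β)`, `t > 0`. -/
def gker (β t : ℝ) : ℝ := t ^ (β - 1) / Real.Gamma β

/-- The Riemann-Liouville integral `(g_β * f)(t) = ∫_0^t g_β(t-s) f(s) ds`. -/
def rlIntegral {Y : Type*} [NormedAddCommGroup Y] [NormedSpace ℝ Y]
    (β : ℝ) (f : ℝ → Y) (t : ℝ) : Y :=
  ∫ s in (0 : ℝ)..t, gker β (t - s) • f s

/-- `d` is the Caputo derivative `∂_t^α f` of a function `f` with initial value `f₀`, in the
generalised sense `∂_t^α f = ∂_t (g_{1-α} * (f - f₀))` (distributional derivative), which is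
`g_{1-α} * ∂_t f` for absolutely continuous `f` with `f(0) = f₀`. -/
def HasCaputoDeriv {Y : Type*} [NormedAddCommGroup Y] [NormedSpace ℝ Y]
    (α T : ℝ) (f : ℝ → Y) (f₀ : Y) (d : ℝ → Y) : Prop :=
  HasWeakDeriv T (rlIntegral (1 - α) (fun s => f s - f₀)) d

/-- The fractional Sobolev-Bochner space `W^{α,p}(0,T;Y)`, for functions with initial
value `f₀`. -/
def MemFracSobolev {Y : Type*} [NormedAddCommGroup Y] [NormedSpace ℝ Y]
    (α : ℝ) (p : ℝ≥0∞) (T : ℝ) (f : ℝ → Y) (f₀ : Y) : Prop :=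
  MemLp f p (timeMeasure T) ∧
    ∃ d : ℝ → Y, MemLp d p (timeMeasure T) ∧ HasCaputoDeriv α T f f₀ d

/-! ### Gelfand triples, gradients and gradient flows -/

/-- The embedding `K → V'` of a Gelfand triple `V → K → V'` with first embedding `j`:
`⟨k, v⟩ = (k, j v)_K`. -/
def toDual {V K : Type*} [NormedAddCommGroup V] [NormedSpace ℝ V]
    [NormedAddCommGroup K] [InnerProductSpace ℝ K] (j : V →L[ℝ] K) (k : K) :
    StrongDual ℝ V :=
  (innerSL ℝ k).comp j

/-- Reflexivity of a real normed space. -/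
def IsReflexive (V : Type*) [NormedAddCommGroup V] [NormedSpace ℝ V] : Prop :=
  Function.Surjective (NormedSpace.inclusionInDoubleDual ℝ V)

/-- The gradient `grad_H E : X → X'`, `⟨grad_H E (u), v⟩ = δE(u,v)`, of a functional `E` of
class `C^1` on `X`. (The dual `X'` contains `H`; for `E` of class `C^1` the Gateaux derivative
`δE(u,·)` is the Fréchet derivative.) -/
def gradH {X : Type*} [NormedAddCommGroup X] [NormedSpace ℝ X] (E : X → ℝ) (u : X) :
    StrongDual ℝ X :=
  fderiv ℝ E u

/-- The realization `u ↦ F ∘ u` of `F : X → X'` as an operator from `L^p(0,T;X)` to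
`L^q(0,T;X')` is weak-to-weak continuous: `u_k ⇀ u` in `L^p(0,T;X)` implies `F(u_k) ⇀ F(u)` in
`L^q(0,T;X')`. -/
def WeakToWeakContinuous {X : Type*} [NormedAddCommGroup X] [NormedSpace ℝ X]
    (F : X → StrongDual ℝ X) (T p q : ℝ) (hpq : p.HolderConjugate q) : Prop :=
  haveI : Fact (1 ≤ ENNReal.ofReal p) := ⟨ENNReal.one_le_ofReal.2 hpq.lt.le⟩
  haveI : Fact (1 ≤ ENNReal.ofReal q) := ⟨ENNReal.one_le_ofReal.2 hpq.symm.lt.le⟩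
  ∀ (u : ℕ → Lp X (ENNReal.ofReal p) (timeMeasure T))
    (u' : Lp X (ENNReal.ofReal p) (timeMeasure T))
    (y : ℕ → Lp (StrongDual ℝ X) (ENNReal.ofReal q) (timeMeasure T))
    (y' : Lp (StrongDual ℝ X) (ENNReal.ofReal q) (timeMeasure T)),
    (∀ k, ∀ᵐ t ∂(timeMeasure T), y k t = F (u k t)) →
    (∀ᵐ t ∂(timeMeasure T), y' t = F (u' t)) →
    (∀ L : StrongDual ℝ (Lp X (ENNReal.ofReal p) (timeMeasure T)),
      Tendsto (fun k => L (u k)) atTop (𝓝 (L u'))) →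
    ∀ L : StrongDual ℝ (Lp (StrongDual ℝ X) (ENNReal.ofReal q) (timeMeasure T)),
      Tendsto (fun k => L (y k)) atTop (𝓝 (L y'))

/-- `u` is a variational solution on `(0,T)` of the time-fractional gradient flow
`∂_t^α u = - grad_H E(u)`, `u(0) = u₀`, `0 < α < 1`, in the Gelfand triple `X → H → X'`:
`u ∈ L^p(0,T;X) ∩ L^∞(0,T;H) ∩ W^{α,q}(0,T;X')`, `g_{1-α} * (u - u₀) ∈ C([0,T];H)` vanishes
at `0`, and `⟨∂_t^α u(t), v⟩ + δE(u(t), v) = 0` for all `v ∈ X` and a.e. `t`. -/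
structure IsFractionalSolution {X H : Type*} [NormedAddCommGroup X] [NormedSpace ℝ X]
    [NormedAddCommGroup H] [InnerProductSpace ℝ H] (i : X →L[ℝ] H) (E : X → ℝ)
    (α p q T : ℝ) (u₀ : H) (u : ℝ → X) : Prop where
  memLp : MemLp u (ENNReal.ofReal p) (timeMeasure T)
  memLp_top : MemLp (fun t => i (u t)) ∞ (timeMeasure T)
  memLp_dual : MemLp (fun t => toDual i (i (u t))) (ENNReal.ofReal q) (timeMeasure T)
  equation : ∃ d : ℝ → StrongDual ℝ X, MemLp d (ENNReal.ofReal q) (timeMeasure T) ∧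
    HasCaputoDeriv α T (fun t => toDual i (i (u t))) (toDual i u₀) d ∧
    ∀ᵐ t ∂(timeMeasure T), ∀ v : X, HasLineDerivAt ℝ E (-(d t v)) (u t) v
  continuousOn : ContinuousOn (rlIntegral (1 - α) (fun s => i (u s) - u₀)) (Icc 0 T)
  initial : Tendsto (rlIntegral (1 - α) (fun s => i (u s) - u₀)) (𝓝[>] 0) (𝓝 0)

/-- `u` is a variational solution on `(0,T)` of the (integer-order) gradient flow
`∂_t u = - grad_K Φ(u)`, `u(0) = u₀`, in the triple `V → K → V'`:
`u ∈ L^p(0,T;V) ∩ L^∞(0,T;K) ∩ W^{1,q}(0,T;V') ∩ C([0,T];K)`, `u(0) = u₀`, and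
`⟨∂_t u(t), v⟩ + δΦ(u(t), v) = 0` for all `v ∈ V` and a.e. `t`. -/
structure IsGradientFlowSolution {V K : Type*} [NormedAddCommGroup V] [NormedSpace ℝ V]
    [NormedAddCommGroup K] [InnerProductSpace ℝ K] (j : V →L[ℝ] K) (Φ : V → ℝ)
    (p q T : ℝ) (u₀ : K) (u : ℝ → V) : Prop where
  memLp : MemLp u (ENNReal.ofReal p) (timeMeasure T)
  memLp_top : MemLp (fun t => j (u t)) ∞ (timeMeasure T)
  memLp_dual : MemLp (fun t => toDual j (j (u t))) (ENNReal.ofReal q) (timeMeasure T)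
  equation : ∃ d : ℝ → StrongDual ℝ V, MemLp d (ENNReal.ofReal q) (timeMeasure T) ∧
    HasWeakDeriv T (fun t => toDual j (j (u t))) d ∧
    ∀ᵐ t ∂(timeMeasure T), ∀ v : V, HasLineDerivAt ℝ Φ (-(d t v)) (u t) v
  initial : ∃ w : ℝ → K, ContinuousOn w (Icc 0 T) ∧
    (∀ᵐ t ∂(timeMeasure T), w t = j (u t)) ∧ w 0 = u₀

/-! ### The augmented problem -/

/-- The weight `w_α(θ) = g_{1-α}(θ) g_α(1-θ)`. -/
def weight (α θ : ℝ) : ℝ := gker (1 - α) θ * gker α (1 - θ)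

/-- The measure `w_α(θ) dθ` on `(0,1)`. -/
def wMeasure (α : ℝ) : Measure ℝ :=
  (volume.restrict (Ioo 0 1)).withDensity (fun θ => ENNReal.ofReal (weight α θ))

/-- The measure `w_{α,0}(θ) dθ = (1-θ) w_α(θ) dθ` on `(0,1)`. -/
def wMeasure₀ (α : ℝ) : Measure ℝ :=
  (volume.restrict (Ioo 0 1)).withDensity (fun θ => ENNReal.ofReal (weight α θ * (1 - θ)))

/-- `L²_α(0,1;Y)`. -/
abbrev L2w (α : ℝ) (Y : Type*) [NormedAddCommGroup Y] := Lp Y 2 (wMeasure α)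

/-- `L²_{α,0}(0,1;Y)`. -/
abbrev L2w₀ (α : ℝ) (Y : Type*) [NormedAddCommGroup Y] := Lp Y 2 (wMeasure₀ α)

theorem wMeasure₀_le (α : ℝ) : wMeasure₀ α ≤ (1 : ℝ≥0∞) • wMeasure α := by
  rw [one_smul]
  refine withDensity_mono ?_
  filter_upwards [ae_restrict_mem measurableSet_Ioo] with θ hθ
  rcases le_total 0 (weight α θ) with h | h
  · refine ENNReal.ofReal_le_ofReal ?_
    nlinarith [hθ.1, hθ.2]
  · rw [ENNReal.ofReal_of_nonpos (mul_nonpos_of_nonpos_of_nonneg h (by linarith [hθ.2]))]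
    exact bot_le

/-- The inclusion `L²_α(0,1;Y) → L²_{α,0}(0,1;Y)`. -/
def inclL2w (α : ℝ) (Y : Type*) [NormedAddCommGroup Y] [NormedSpace ℝ Y] :
    L2w α Y →L[ℝ] L2w₀ α Y :=
  Lp.LpToLpOfMeasureLeSMul ENNReal.one_ne_top (wMeasure₀_le α)

section Augmented

variable {X H : Type*} [NormedAddCommGroup X] [NormedSpace ℝ X]
  [NormedAddCommGroup H] [InnerProductSpace ℝ H]

/-- The inclusion `L²_α(0,1;X) → L²_α(0,1;H)` induced by `i : X → H`. -/
def liftL2w (i : X →L[ℝ] H) (α : ℝ) : L2w α X →L[ℝ] L2w α H :=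
  i.compLpL 2 (wMeasure α)

/-- The embedding of `X̃ = L²_α(0,1;X)` into `H̃ = L²_{α,0}(0,1;H)`. -/
def augEmb (i : X →L[ℝ] H) (α : ℝ) : L2w α X →L[ℝ] L2w₀ α H :=
  (inclL2w α H).comp (liftL2w i α)

/-- `C ṽ = u₀ + ∫_0^1 g_{1-α}(θ) g_α(1-θ) ṽ(θ) dθ`. -/
def opC (α : ℝ) (u₀ : X) (v : L2w α X) : X :=
  u₀ + ∫ θ in Ioo (0 : ℝ) 1, (gker (1 - α) θ * gker α (1 - θ)) • v θ

/-- The history energy `½ ∫_0^1 θ g_{1-α}(θ) g_α(1-θ) ‖ṽ(θ)‖_H² dθ`. -/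
def historyEnergy (i : X →L[ℝ] H) (α : ℝ) (v : L2w α X) : ℝ :=
  (1 / 2) * ∫ θ in Ioo (0 : ℝ) 1, θ * gker (1 - α) θ * gker α (1 - θ) * ‖i (v θ)‖ ^ 2

/-- The augmented energy `Ẽ = E ∘ C + history energy` on `X̃ = L²_α(0,1;X)`. -/
def augEnergy (i : X →L[ℝ] H) (E : X → ℝ) (α : ℝ) (u₀ : X) (v : L2w α X) : ℝ :=
  E (opC α u₀ v) + historyEnergy i α v

/-- `c₀(θ) = 1 / (1-θ)`. -/
def c₀ (θ : ℝ) : ℝ := 1 / (1 - θ)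

/-- `c₁(θ) = θ / (1-θ)`. -/
def c₁ (θ : ℝ) : ℝ := θ / (1 - θ)

/-- `G u (t,θ) = - c₀(θ) ∫_0^t e^{-c₁(θ)(t-s)} grad_H E(u(s)) ds`, an element of `X'`. -/
def opG (E : X → ℝ) (u : ℝ → X) (t θ : ℝ) : StrongDual ℝ X :=
  -(c₀ θ • ∫ s in (0 : ℝ)..t, Real.exp (-(c₁ θ) * (t - s)) • gradH E (u s))

/-- The relations `u = C ũ` (in `X`, a.e. in time) and `ũ = G u` (in `X'`, a.e. in time and
in `θ`). -/
def Corresponds (i : X →L[ℝ] H) (E : X → ℝ) (α T : ℝ) (u₀ : X)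
    (u : ℝ → X) (v : ℝ → L2w α X) : Prop :=
  (∀ᵐ t ∂(timeMeasure T), u t = opC α u₀ (v t)) ∧
  (∀ᵐ t ∂(timeMeasure T), ∀ᵐ θ ∂(volume.restrict (Ioo (0 : ℝ) 1)),
    toDual i (i (v t θ)) = opG E u t θ)

/-- `ũ ∈ L^∞(0,1; L^q(0,T;H))`: `ũ` has a jointly measurable version `U(t,θ)` whose
`L^q(0,T;H)`-norm is essentially bounded in `θ`. -/
def MemLinftyLq (i : X →L[ℝ] H) (α q T : ℝ) (v : ℝ → L2w α X) : Prop :=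
  ∃ U : ℝ × ℝ → H,
    AEStronglyMeasurable U ((timeMeasure T).prod (volume.restrict (Ioo (0 : ℝ) 1))) ∧
    (∀ᵐ t ∂(timeMeasure T), ∀ᵐ θ ∂(volume.restrict (Ioo (0 : ℝ) 1)), U (t, θ) = i (v t θ)) ∧
    ∃ M : ℝ, ∀ᵐ θ ∂(volume.restrict (Ioo (0 : ℝ) 1)),
      eLpNorm (fun t => U (t, θ)) (ENNReal.ofReal q) (timeMeasure T) ≤ ENNReal.ofReal M

end Augmented

end FracGF

end

/-!
The hypothesis of weak-to-weak continuity is much stronger than it looks: weak convergence in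
`L^p(0,T;X)` does not control oscillations in time. Functions that jump between two values `a`, `b`
with the signs of the Rademacher functions converge weakly to the midpoint, and their images under
`F = grad E` converge weakly to the midpoint of `F a` and `F b`. Hence `F` is midpoint-affine
(`WeakToWeakContinuous.map_midpoint`), and as it is continuous, `F u = F 0 + A u` with a symmetric
bounded operator `A : X → X'` (`exists_continuousLinearMap_of_midpoint`). Comparing growth and
coercivity along rays then leaves only `p = 2`, or a trivial space `X`
(`exponent_eq_two_or_subsingleton`).

So `A + C₂` is a coercive symmetric operator on a compact Gelfand triple, and `H` has a Hilbert basis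
of eigenvectors of `A` (`exists_eigenBasis`). Both flows decouple into scalar problems. The force
`f = - grad E (u)` of a mode with eigenvalue `lam` solves `f = c - lam (g_α * f)`, and the augmented
state is the memory variable `v(t,θ) = c₀ ∫_0^t e^{-c₁ (t-s)} f(s) ds`. The two are linked by the
representation of `g_α` as the average of the kernels `c₀ e^{-c₁ t}` with the weight `w_α`
(`integral_weight_mul_expKer`), by which the average of `v` over `θ` is `g_α * f`.

The memory variable satisfies `(1 - θ) ∂_t v + θ v = f`. Testing with `v` and with `∂_t v` gives two
energy identities (`energy_memory`, `energy_memoryRate`), and from them bounds on the modes whose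
dependence on the eigenvalue is explicit (`exists_modeBounds`). The bounds are just what is needed to
sum the modes when the initial force belongs to `X'`: the series solve the two flows, correspond to
each other, and have the asserted regularity (`isFractionalSolution_stateSeries`,
`isGradientFlowSolution_memorySeries`, `corresponds_memorySeries`, `memLinftyLq_memorySeries`).

Each flow has no other solution. A mode of the difference of two solutions of the fractional flow
solves a homogeneous Volterra equation with kernel `g_α`, which is a contraction in an
exponentially weighted norm (`IsFractionalSolution.ae_eq`). A mode of the difference of two solutions
of the augmented flow solves a linear evolution equation that is degenerate, as the weight `1 - θ` of
`∂_t v` is not bounded below; an energy estimate for the twice integrated equation still applies,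
because the indefinite part of the energy, a multiple of the squared mean over `θ`, is dominated by
the forms with densities `θ` and `1 - θ` (`ae_eq_zero_of_degenerate`, `exists_mean_sq_le`,
`IsGradientFlowSolution.ae_eq`). Thus both flows have exactly one solution up to equality almost
everywhere (`exists_isCanonicalPair`), and all claims transfer from the series along that equality.
-/

noncomputable section

namespace FracGF

/-! ### Volterra convolutions -/

theorem integrable_indicator_Ioo {Y : Type*} [NormedAddCommGroup Y]
    {h : ℝ → Y} {T : ℝ} (hh : Integrable h (timeMeasure T)) :
    Integrable ((Ioo 0 T).indicator h) :=
  IntegrableOn.integrable_indicator hh measurableSet_Ioo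

section Volterra

variable {Y : Type*} [NormedAddCommGroup Y] [NormedSpace ℝ Y]

/-- The Volterra convolution `(k * h)(t) = ∫_0^t k(t-s) h(s) ds` of a scalar kernel `k` and a
vector-valued function `h`; for `k = g_β` it is the Riemann-Liouville integral. -/
def volterra (k : ℝ → ℝ) (h : ℝ → Y) (t : ℝ) : Y :=
  ∫ s in (0 : ℝ)..t, k (t - s) • h s

theorem rlIntegral_eq_volterra (β : ℝ) (h : ℝ → Y) : rlIntegral β h = volterra (gker β) h := rfl

theorem volterra_eq_setIntegral (k : ℝ → ℝ) (h : ℝ → Y) {t : ℝ} (ht : 0 ≤ t) :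
    volterra k h t = ∫ s in Ioo 0 t, k (t - s) • h s := by
  rw [volterra, intervalIntegral.integral_of_le ht, integral_Ioc_eq_integral_Ioo]

open scoped Convolution in
/-- On `[0,T]` the Volterra convolution is the convolution on `ℝ` of the two functions cut off
outside `(0,T)`. -/
theorem volterra_eq_convolution (k : ℝ → ℝ) (h : ℝ → Y) {t T : ℝ} (ht : t ∈ Icc 0 T) :
    volterra k h t =
      ((Ioo 0 T).indicator k ⋆[ContinuousLinearMap.lsmul ℝ ℝ, volume] (Ioo 0 T).indicator h) t := by
  rw [convolution_eq_swap, volterra_eq_setIntegral k h ht.1, ← integral_indicator measurableSet_Ioo]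
  congr 1
  ext s
  by_cases hs : s ∈ Ioo 0 t
  · have h1 : s ∈ Ioo 0 T := ⟨hs.1, hs.2.trans_le ht.2⟩
    have h2 : t - s ∈ Ioo 0 T := ⟨by linarith [hs.2], by linarith [hs.1, ht.2]⟩
    simp [hs, h1, h2]
  · rw [indicator_of_notMem hs]
    by_cases h1 : s ∈ Ioo 0 T
    · have h2 : t - s ∉ Ioo 0 T := fun h2 => hs ⟨h1.1, by linarith [h2.1]⟩
      simp [h2]
    · simp [h1]

theorem volterra_congr {k k' : ℝ → ℝ} {h h' : ℝ → Y} {t T : ℝ} (ht : t ∈ Icc 0 T)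
    (hk : ∀ s ∈ Ioo 0 T, k s = k' s) (hh : ∀ᵐ s ∂(timeMeasure T), h s = h' s) :
    volterra k h t = volterra k' h' t := by
  rw [volterra_eq_setIntegral _ _ ht.1, volterra_eq_setIntegral _ _ ht.1]
  refine setIntegral_congr_ae measurableSet_Ioo ?_
  rw [timeMeasure, ae_restrict_iff' measurableSet_Ioo] at hh
  filter_upwards [hh] with s hs hst
  rw [hs ⟨hst.1, hst.2.trans_le ht.2⟩, hk _ ⟨by linarith [hst.2], by linarith [hst.1, ht.2]⟩]

theorem integrable_volterra {k : ℝ → ℝ} {h : ℝ → Y} {T : ℝ} (hk : Integrable k (timeMeasure T))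
    (hh : Integrable h (timeMeasure T)) : Integrable (volterra k h) (timeMeasure T) := by
  have h1 : Integrable ((Ioo 0 T).indicator k) := integrable_indicator_Ioo hk
  have h2 : Integrable ((Ioo 0 T).indicator h) := integrable_indicator_Ioo hh
  have h3 := (h1.integrable_convolution (ContinuousLinearMap.lsmul ℝ ℝ) h2).integrableOn
    (s := Ioo 0 T)
  refine Integrable.congr h3 ?_
  filter_upwards [ae_restrict_mem measurableSet_Ioo] with t ht
  exact (volterra_eq_convolution k h (Ioo_subset_Icc_self ht)).symm

theorem volterra_nonneg {k h : ℝ → ℝ} {t : ℝ} (ht : 0 ≤ t) (hk : ∀ s ∈ Ioo 0 t, 0 ≤ k s)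
    (hh : ∀ s ∈ Ioo 0 t, 0 ≤ h s) : 0 ≤ volterra k h t := by
  rw [volterra_eq_setIntegral k h ht]
  refine setIntegral_nonneg measurableSet_Ioo fun s hs => ?_
  exact mul_nonneg (hk _ ⟨by linarith [hs.2], by linarith [hs.1]⟩) (hh _ hs)

theorem volterra_comm (k h : ℝ → ℝ) (t : ℝ) : volterra k h t = volterra h k t := by
  have := intervalIntegral.integral_comp_sub_left (a := 0) (b := t) (fun s => k (t - s) • h s) t
  simp only [sub_sub_cancel, sub_self, sub_zero, smul_eq_mul] at this
  rw [volterra, volterra]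
  simp only [smul_eq_mul]
  rw [← this]
  simp only [mul_comm]

/-- Almost every `t` is a point where the integrand of the Volterra convolution is integrable. -/
theorem ae_integrableOn_volterra {k : ℝ → ℝ} {h : ℝ → Y} {T : ℝ}
    (hk : Integrable k (timeMeasure T)) (hh : Integrable h (timeMeasure T)) :
    ∀ᵐ t ∂(timeMeasure T), IntegrableOn (fun s => k (t - s) • h s) (Ioo 0 t) := by
  have h1 : Integrable ((Ioo 0 T).indicator k) := integrable_indicator_Ioo hk
  have h2 : Integrable ((Ioo 0 T).indicator h) := integrable_indicator_Ioo hh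
  filter_upwards [ae_restrict_mem measurableSet_Ioo,
    ae_restrict_of_ae (h1.ae_convolution_exists (ContinuousLinearMap.lsmul ℝ ℝ) h2)] with t ht h3
  have h4 := h3.integrable_swap.integrableOn (s := Ioo 0 t)
  refine h4.congr_fun (fun s hs => ?_) measurableSet_Ioo
  have h1 : s ∈ Ioo 0 T := ⟨hs.1, hs.2.trans ht.2⟩
  have h2 : t - s ∈ Ioo 0 T := ⟨by linarith [hs.2], by linarith [hs.1, ht.2]⟩
  simp [h1, h2]

theorem norm_volterra_le (k : ℝ → ℝ) (h : ℝ → Y) {t : ℝ} (ht : 0 ≤ t) :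
    ‖volterra k h t‖ ≤ volterra (fun s => |k s|) (fun s => ‖h s‖) t := by
  rw [volterra_eq_setIntegral k h ht, volterra_eq_setIntegral _ _ ht]
  refine (norm_integral_le_integral_norm _).trans_eq ?_
  simp [norm_smul]

/-- Young's inequality in `L^1` for nonnegative functions. -/
theorem integral_volterra_le {k h : ℝ → ℝ} {T : ℝ} (hk : Integrable k (timeMeasure T))
    (hh : Integrable h (timeMeasure T)) (hk0 : ∀ s ∈ Ioo 0 T, 0 ≤ k s)
    (hh0 : ∀ s ∈ Ioo 0 T, 0 ≤ h s) :
    ∫ t, volterra k h t ∂(timeMeasure T) ≤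
      (∫ t, k t ∂(timeMeasure T)) * ∫ t, h t ∂(timeMeasure T) := by
  have h1 : Integrable ((Ioo 0 T).indicator k) := integrable_indicator_Ioo hk
  have h2 : Integrable ((Ioo 0 T).indicator h) := integrable_indicator_Ioo hh
  have h3 := integral_convolution (ContinuousLinearMap.lsmul ℝ ℝ) h1 h2
  have h4 := h1.integrable_convolution (ContinuousLinearMap.lsmul ℝ ℝ) h2
  rw [integral_indicator measurableSet_Ioo, integral_indicator measurableSet_Ioo] at h3
  simp only [ContinuousLinearMap.lsmul_apply, smul_eq_mul] at h3
  refine le_trans ?_ h3.le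
  refine le_trans (le_of_eq ?_) (setIntegral_le_integral (s := Ioo 0 T) h4 ?_)
  · refine setIntegral_congr_fun measurableSet_Ioo fun t ht => ?_
    exact volterra_eq_convolution k h (Ioo_subset_Icc_self ht)
  · refine Eventually.of_forall fun t => ?_
    refine integral_nonneg fun s => ?_
    exact mul_nonneg (indicator_nonneg hk0 _) (indicator_nonneg hh0 _)

/-- Exponential weights distribute over the convolution; this is what makes the Laplace-weighted
estimates below work. -/
theorem exp_mul_volterra (γ : ℝ) (k h : ℝ → ℝ) (t : ℝ) :
    Real.exp (-γ * t) * volterra k h t =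
      volterra (fun s => Real.exp (-γ * s) * k s) (fun s => Real.exp (-γ * s) * h s) t := by
  rw [volterra, volterra, ← intervalIntegral.integral_const_mul]
  congr 1
  ext s
  have : Real.exp (-γ * t) = Real.exp (-γ * (t - s)) * Real.exp (-γ * s) := by
    rw [← Real.exp_add]; ring_nf
  simp only [smul_eq_mul]
  rw [this]; ring

open scoped Convolution in
/-- Associativity of the Volterra convolution, at every point of `[0,T]`, when `|k₁| * |k₂|` is
bounded. -/
theorem volterra_assoc [CompleteSpace Y] {k₁ k₂ : ℝ → ℝ} {h : ℝ → Y} {t T B : ℝ}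
    (ht : t ∈ Icc 0 T)
    (hk₁ : Integrable k₁ (timeMeasure T)) (hk₂ : Integrable k₂ (timeMeasure T))
    (hh : Integrable h (timeMeasure T))
    (hB : ∀ s ∈ Ioo 0 T, volterra (fun s => |k₁ s|) (fun s => |k₂ s|) s ≤ B) :
    volterra k₁ (volterra k₂ h) t = volterra (volterra k₁ k₂) h t := by
  have h1 : Integrable ((Ioo 0 T).indicator k₁) := integrable_indicator_Ioo hk₁
  have h2 : Integrable ((Ioo 0 T).indicator k₂) := integrable_indicator_Ioo hk₂
  have h3 : Integrable ((Ioo 0 T).indicator h) := integrable_indicator_Ioo hh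
  set f₁ := (Ioo 0 T).indicator k₁ with hf₁
  set f₂ := (Ioo 0 T).indicator k₂ with hf₂
  set f₃ := (Ioo 0 T).indicator h with hf₃
  -- both inner convolutions are supported in `[0,∞)`
  have hsupp : ∀ x ≤ 0, ∀ y, f₁ y * f₂ (x - y) = 0 := by
    intro x hx y
    by_cases hy : y ∈ Ioo 0 T
    · have : x - y ∉ Ioo 0 T := fun h => by linarith [h.1, hy.1]
      rw [hf₂, indicator_of_notMem this, mul_zero]
    · rw [hf₁, indicator_of_notMem hy, zero_mul]
  have hsupp' : ∀ x ≤ 0, ∀ y, f₂ y • f₃ (x - y) = 0 := by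
    intro x hx y
    by_cases hy : y ∈ Ioo 0 T
    · have : x - y ∉ Ioo 0 T := fun h => by linarith [h.1, hy.1]
      rw [hf₃, indicator_of_notMem this, smul_zero]
    · rw [hf₂, indicator_of_notMem hy, zero_smul]
  -- associativity of the convolution on `ℝ` for the functions cut off to `(0,T)`; what has to be
  -- checked is that the triple integrand is integrable
  have key := convolution_assoc' (ContinuousLinearMap.lsmul ℝ ℝ)
    (ContinuousLinearMap.lsmul ℝ ℝ : ℝ →L[ℝ] Y →L[ℝ] Y) (ContinuousLinearMap.lsmul ℝ ℝ)
    (ContinuousLinearMap.lsmul ℝ ℝ) (f := f₁) (g := f₂) (k := f₃) (μ := volume) (ν := volume)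
    (x₀ := t) (fun x y z => mul_smul x y z) (h1.ae_convolution_exists _ h2)
    (h2.ae_convolution_exists _ h3) ?_
  -- for arguments in `(0,T)` the cut-offs do not change the inner convolutions
  · have hl : volterra (volterra k₁ k₂) h t =
        ((f₁ ⋆[ContinuousLinearMap.lsmul ℝ ℝ, volume] f₂) ⋆[ContinuousLinearMap.lsmul ℝ ℝ, volume]
          f₃) t := by
      rw [volterra_eq_convolution _ _ ht, convolution_eq_swap, convolution_eq_swap]
      refine integral_congr_ae ?_
      filter_upwards with s
      simp only [ContinuousLinearMap.lsmul_apply]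
      by_cases hs : s ∈ Ioo 0 T
      · rcases le_or_gt (t - s) 0 with h0 | h0
        · rw [indicator_of_notMem (fun h => by linarith [h.1]), convolution]
          simp only [ContinuousLinearMap.lsmul_apply, smul_eq_mul, hsupp _ h0, integral_zero,
            zero_smul]
        · have hm : t - s ∈ Ioo 0 T := ⟨h0, by linarith [hs.1, ht.2]⟩
          rw [indicator_of_mem hm, volterra_eq_convolution _ _ (Ioo_subset_Icc_self hm)]
      · rw [hf₃, indicator_of_notMem hs, smul_zero, smul_zero]
    rw [hl, key, volterra_eq_convolution _ _ ht, convolution_eq_swap, convolution_eq_swap]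
    refine integral_congr_ae ?_
    filter_upwards with s
    simp only [ContinuousLinearMap.lsmul_apply]
    by_cases hs : t - s ∈ Ioo 0 T
    · congr 1
      rcases le_or_gt s 0 with h0 | h0
      · rw [indicator_of_notMem (fun h => by linarith [h.1]), convolution]
        simp only [ContinuousLinearMap.lsmul_apply, hsupp' _ h0, integral_zero]
      · have hm : s ∈ Ioo 0 T := ⟨h0, by linarith [hs.1, ht.2]⟩
        rw [indicator_of_mem hm, volterra_eq_convolution _ _ (Ioo_subset_Icc_self hm)]
    · rw [hf₁, indicator_of_notMem hs, zero_smul, zero_smul]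
  · have hmeas : AEStronglyMeasurable (Function.uncurry fun x y => ((ContinuousLinearMap.lsmul ℝ ℝ
        : ℝ →L[ℝ] Y →L[ℝ] Y) (f₁ y)) (((ContinuousLinearMap.lsmul ℝ ℝ : ℝ →L[ℝ] Y →L[ℝ] Y)
          (f₂ (x - y))) (f₃ (t - x)))) (volume.prod volume) := by
      have m3 : AEStronglyMeasurable (fun x => f₃ (t - x)) volume :=
        h3.aestronglyMeasurable.comp_quasiMeasurePreserving
          (quasiMeasurePreserving_sub_left_of_right_invariant volume t)
      have m12 := h1.aestronglyMeasurable.convolution_integrand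
        (ContinuousLinearMap.lsmul ℝ ℝ : ℝ →L[ℝ] ℝ →L[ℝ] ℝ) h2.aestronglyMeasurable
          (μ := volume) (ν := volume)
      refine (m12.smul m3.comp_fst).congr (Eventually.of_forall fun z => ?_)
      exact mul_smul (f₁ z.2) (f₂ (z.1 - z.2)) (f₃ (t - z.1))
    rw [integrable_prod_iff hmeas]
    constructor
    · filter_upwards [h1.ae_convolution_exists (ContinuousLinearMap.lsmul ℝ ℝ) h2] with x hx
      refine (Integrable.smul_const hx.integrable (f₃ (t - x))).congr
        (Eventually.of_forall fun z => ?_)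
      exact mul_smul (f₁ z) (f₂ (x - z)) (f₃ (t - x))
    -- integrate in the inner variable first: the bound `B` for `|k₁| * |k₂|` dominates
    · have hint : Integrable (fun x => B * ‖f₃ (t - x)‖) :=
        ((h3.comp_sub_left t).norm).const_mul B
      refine hint.mono' hmeas.norm.integral_prod_right' (ae_of_all _ fun x => ?_)
      rw [Real.norm_of_nonneg (integral_nonneg fun _ => norm_nonneg _)]
      simp only [Function.uncurry_apply_pair, ContinuousLinearMap.lsmul_apply, norm_smul,
        ← mul_assoc]
      rw [integral_mul_const]
      by_cases hx : t - x ∈ Ioo 0 T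
      · refine mul_le_mul_of_nonneg_right ?_ (norm_nonneg _)
        rcases le_or_gt x 0 with h0 | h0
        · have : ∀ y, ‖f₁ y‖ * ‖f₂ (x - y)‖ = 0 := fun y => by
            rw [← norm_mul, hsupp x h0, norm_zero]
          simp only [this, integral_zero]
          have hTpos : 0 < T := hx.1.trans hx.2
          refine le_trans ?_ (hB (T / 2) ⟨by linarith, by linarith⟩)
          exact volterra_nonneg (by linarith) (fun _ _ => abs_nonneg _) fun _ _ => abs_nonneg _
        · have hm : x ∈ Ioo 0 T := ⟨h0, by linarith [hx.1, ht.2]⟩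
          refine le_trans (le_of_eq ?_) (hB x hm)
          rw [volterra_eq_convolution _ _ (Ioo_subset_Icc_self hm), convolution]
          refine integral_congr_ae (Eventually.of_forall fun y => ?_)
          simp [hf₁, hf₂, indicator_comp_of_zero, Real.norm_eq_abs, ← Function.comp_def, abs_zero]
      · rw [hf₃, indicator_of_notMem hx, norm_zero, mul_zero, mul_zero]

end Volterra

/-! ### Fractional kernels and exponential kernels -/

theorem gker_pos {β t : ℝ} (hβ : 0 < β) (ht : 0 < t) : 0 < gker β t :=
  div_pos (Real.rpow_pos_of_pos ht _) (Real.Gamma_pos_of_pos hβ)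

theorem gker_one (t : ℝ) : gker 1 t = 1 := by simp [gker]

theorem measurable_gker (β : ℝ) : Measurable (gker β) := by
  unfold gker; fun_prop

theorem integrable_gker {β : ℝ} (hβ : 0 < β) (T : ℝ) : Integrable (gker β) (timeMeasure T) := by
  rcases le_or_gt T 0 with hT | hT
  · simp [timeMeasure, Ioo_eq_empty_of_le hT]
  have h : IntervalIntegrable (fun x : ℝ => x ^ (β - 1)) volume 0 T :=
    intervalIntegral.intervalIntegrable_rpow' (by linarith)
  rw [intervalIntegrable_iff_integrableOn_Ioo_of_le hT.le] at h
  exact h.div_const _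

/-- The semigroup property `g_a * g_b = g_{a+b}`, by the Beta integral. -/
theorem volterra_gker_gker {a b t : ℝ} (ha : 0 < a) (hb : 0 < b) (ht : 0 < t) :
    volterra (gker a) (gker b) t = gker (a + b) t := by
  have h1 := Complex.betaIntegral_scaled (b : ℂ) (a : ℂ) ht
  have h2 := Complex.betaIntegral_eq_Gamma_mul_div (b : ℂ) (a : ℂ) (by simpa) (by simpa)
  have h3 : (∫ x in (0 : ℝ)..t, (x : ℂ) ^ ((b : ℂ) - 1) * ((t : ℂ) - x) ^ ((a : ℂ) - 1)) =
      ((∫ x in (0 : ℝ)..t, x ^ (b - 1) * (t - x) ^ (a - 1) : ℝ) : ℂ) := by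
    rw [← intervalIntegral.integral_ofReal]
    refine intervalIntegral.integral_congr fun x hx => ?_
    rw [uIcc_of_le ht.le] at hx
    push_cast
    rw [Complex.ofReal_cpow hx.1, Complex.ofReal_cpow (by linarith [hx.2])]
    push_cast
    rfl
  rw [h3, h2] at h1
  have h4 : (∫ x in (0 : ℝ)..t, x ^ (b - 1) * (t - x) ^ (a - 1)) =
      t ^ (b + a - 1) * (Real.Gamma b * Real.Gamma a / Real.Gamma (b + a)) := by
    have : ((∫ x in (0 : ℝ)..t, x ^ (b - 1) * (t - x) ^ (a - 1) : ℝ) : ℂ) =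
        ((t ^ (b + a - 1) * (Real.Gamma b * Real.Gamma a / Real.Gamma (b + a)) : ℝ) : ℂ) := by
      rw [h1]
      push_cast
      rw [Complex.ofReal_cpow ht.le, ← Complex.Gamma_ofReal, ← Complex.Gamma_ofReal,
        ← Complex.Gamma_ofReal]
      push_cast
      rfl
    exact_mod_cast this
  have hGa := (Real.Gamma_pos_of_pos ha).ne'
  have hGb := (Real.Gamma_pos_of_pos hb).ne'
  have h5 : volterra (gker a) (gker b) t =
      (Real.Gamma a * Real.Gamma b)⁻¹ * ∫ x in (0 : ℝ)..t, x ^ (b - 1) * (t - x) ^ (a - 1) := by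
    rw [volterra, ← intervalIntegral.integral_const_mul]
    congr 1
    ext s
    simp only [gker, smul_eq_mul]
    field_simp
  rw [h5, h4, gker, add_comm b a]
  field_simp

/-- The Laplace transform of `g_β`. -/
theorem integral_exp_mul_gker {β γ : ℝ} (hβ : 0 < β) (hγ : 0 < γ) :
    ∫ t in Ioi 0, Real.exp (-γ * t) * gker β t = γ ^ (-β) := by
  have h := Real.integral_rpow_mul_exp_neg_mul_Ioi hβ hγ
  have hG := (Real.Gamma_pos_of_pos hβ).ne'
  calc ∫ t in Ioi 0, Real.exp (-γ * t) * gker β t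
      = ∫ t in Ioi 0, (Real.Gamma β)⁻¹ * (t ^ (β - 1) * Real.exp (-(γ * t))) := by
        congr 1; ext t; simp only [gker, neg_mul]; ring
    _ = γ ^ (-β) := by
        rw [integral_const_mul, h, one_div, Real.inv_rpow hγ.le, Real.rpow_neg hγ.le]
        field_simp

theorem integrableOn_exp_mul_gker {β γ : ℝ} (hβ : 0 < β) (hγ : 0 < γ) :
    IntegrableOn (fun t => Real.exp (-γ * t) * gker β t) (Ioi 0) := by
  by_contra h
  have := integral_undef h
  rw [integral_exp_mul_gker hβ hγ] at this
  exact (Real.rpow_pos_of_pos hγ _).ne' this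

theorem setIntegral_exp_mul_gker_le {β γ : ℝ} (hβ : 0 < β) (hγ : 0 < γ) (T : ℝ) :
    ∫ t, Real.exp (-γ * t) * gker β t ∂(timeMeasure T) ≤ γ ^ (-β) := by
  rw [← integral_exp_mul_gker hβ hγ]
  refine setIntegral_mono_set (integrableOn_exp_mul_gker hβ hγ) ?_
    (Ioo_subset_Ioi_self).eventuallyLE
  filter_upwards [ae_restrict_mem measurableSet_Ioi] with t ht
  exact mul_nonneg (Real.exp_pos _).le (gker_pos hβ ht).le

section Weight

variable {α : ℝ}

theorem weight_pos (hα₀ : 0 < α) (hα₁ : α < 1) {θ : ℝ} (hθ : θ ∈ Ioo (0 : ℝ) 1) :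
    0 < weight α θ :=
  mul_pos (gker_pos (by linarith) hθ.1) (gker_pos hα₀ (by linarith [hθ.2]))

theorem measurable_weight (α : ℝ) : Measurable (weight α) :=
  (measurable_gker _).mul ((measurable_gker _).comp (measurable_const.sub measurable_id))

theorem integral_weight (hα₀ : 0 < α) (hα₁ : α < 1) : ∫ θ in Ioo (0 : ℝ) 1, weight α θ = 1 := by
  have h := volterra_gker_gker hα₀ (show (0 : ℝ) < 1 - α by linarith) one_pos
  rw [volterra_eq_setIntegral _ _ zero_le_one, add_sub_cancel, gker_one] at h
  refine Eq.trans ?_ h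
  simp only [weight, smul_eq_mul, mul_comm]

theorem integrable_weight (hα₀ : 0 < α) (hα₁ : α < 1) : IntegrableOn (weight α) (Ioo 0 1) := by
  by_contra h
  have := integral_undef h
  rw [integral_weight hα₀ hα₁] at this
  exact one_ne_zero this

/-- The exponential kernel `c₀(θ) e^{-c₁(θ) t}`. -/
def expKer (θ t : ℝ) : ℝ := c₀ θ * Real.exp (-(c₁ θ) * t)

theorem c₀_pos {θ : ℝ} (hθ : θ ∈ Ioo (0 : ℝ) 1) : 0 < c₀ θ :=
  one_div_pos.2 (by linarith [hθ.2])

theorem c₁_pos {θ : ℝ} (hθ : θ ∈ Ioo (0 : ℝ) 1) : 0 < c₁ θ :=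
  div_pos hθ.1 (by linarith [hθ.2])

theorem expKer_pos {θ : ℝ} (hθ : θ ∈ Ioo (0 : ℝ) 1) (t : ℝ) : 0 < expKer θ t :=
  mul_pos (c₀_pos hθ) (Real.exp_pos _)

theorem one_sub_mul_c₀ {θ : ℝ} (hθ : θ ∈ Ioo (0 : ℝ) 1) : (1 - θ) * c₀ θ = 1 := by
  have : 1 - θ ≠ 0 := by linarith [hθ.2]
  rw [c₀]; field_simp

theorem c₀_mul (θ : ℝ) : c₀ θ * θ = c₁ θ := by rw [c₀, c₁]; ring

theorem measurable_expKer : Measurable (fun z : ℝ × ℝ => expKer z.1 z.2) := by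
  unfold expKer c₀ c₁; fun_prop

theorem continuous_expKer (θ : ℝ) : Continuous (expKer θ) := by
  unfold expKer; fun_prop

theorem integrable_expKer (θ T : ℝ) : Integrable (expKer θ) (timeMeasure T) :=
  ((continuous_expKer θ).continuousOn.integrableOn_Icc (a := 0) (b := T)).mono_set Ioo_subset_Icc_self

/-- `∫_0^t c₀ e^{-c₁ s} ds = (1 - e^{-c₁ t}) / θ`. -/
theorem integral_expKer (θ t : ℝ) :
    θ * ∫ s in (0 : ℝ)..t, expKer θ s = 1 - Real.exp (-(c₁ θ) * t) := by
  have hd : ∀ s ∈ uIcc 0 t, HasDerivAt (fun s => -Real.exp (-(c₁ θ) * s)) (θ * expKer θ s) s := by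
    intro s _
    have h := (((hasDerivAt_id s).const_mul (-(c₁ θ))).exp).neg
    refine h.congr_deriv ?_
    simp only [expKer, ← c₀_mul, id]; ring
  rw [← intervalIntegral.integral_const_mul, intervalIntegral.integral_eq_sub_of_hasDerivAt hd
    ((continuous_const.mul (continuous_expKer θ)).intervalIntegrable _ _)]
  simp [sub_eq_add_neg, add_comm]

/-- A bound uniform in `θ`: for `θ ≥ 1/2` the integral is at most `1/θ`, for `θ < 1/2` the kernel is
at most `c₀ ≤ 2`. -/
theorem integral_expKer_le {θ t T : ℝ} (hθ : θ ∈ Ioo (0 : ℝ) 1) (ht : t ∈ Icc 0 T) :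
    ∫ s in (0 : ℝ)..t, expKer θ s ≤ 2 + 2 * T := by
  have hT : 0 ≤ T := ht.1.trans ht.2
  rcases le_or_gt (1 / 2) θ with h | h
  · have h1 := integral_expKer θ t
    have h2 : 0 < Real.exp (-(c₁ θ) * t) := Real.exp_pos _
    by_contra! hc
    nlinarith
  · have h1 : ∫ s in (0 : ℝ)..t, expKer θ s ≤ ∫ s in (0 : ℝ)..t, (2 : ℝ) := by
      refine intervalIntegral.integral_mono_on ht.1
        ((continuous_expKer θ).intervalIntegrable _ _) (by simp) fun s hs => ?_
      have h3 : c₀ θ ≤ 2 := by rw [c₀, div_le_iff₀ (by linarith)]; linarith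
      have h4 : Real.exp (-(c₁ θ) * s) ≤ 1 :=
        Real.exp_le_one_iff.2 (by nlinarith [c₁_pos hθ, hs.1, mul_nonneg (c₁_pos hθ).le hs.1])
      calc expKer θ s ≤ 2 * 1 := mul_le_mul h3 h4 (Real.exp_pos _).le (by norm_num)
        _ = 2 := by norm_num
    simp at h1
    nlinarith [ht.2]

/-- The kernel `g_α` is the mixture `∫ w_α(θ) c₀(θ) e^{-c₁(θ) t} dθ` of exponentials: substitute
`μ = θ / (1-θ)` in the Gamma integral. -/
theorem integral_weight_mul_expKer (hα₀ : 0 < α) (hα₁ : α < 1) {t : ℝ} (ht : 0 < t) :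
    ∫ θ in Ioo (0 : ℝ) 1, weight α θ * expKer θ t = gker α t := by
  have himg : (c₁ '' Ioo (0 : ℝ) 1) = Ioi 0 := by
    ext μ
    constructor
    · rintro ⟨θ, hθ, rfl⟩
      exact c₁_pos hθ
    · intro hμ
      have hμ' : 0 < μ := hμ
      refine ⟨μ / (1 + μ), ⟨by positivity, by rw [div_lt_one (by positivity)]; linarith⟩, ?_⟩
      rw [c₁]; field_simp; ring
  have hinj : InjOn c₁ (Ioo (0 : ℝ) 1) := by
    intro a ha b hb hab
    have h1 : 1 - a ≠ 0 := by linarith [ha.2]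
    have h2 : 1 - b ≠ 0 := by linarith [hb.2]
    simp only [c₁] at hab
    field_simp at hab
    linarith
  have hder : ∀ θ ∈ Ioo (0 : ℝ) 1, HasDerivWithinAt c₁ ((1 - θ) ^ 2)⁻¹ (Ioo 0 1) θ := by
    intro θ hθ
    have h1 : 1 - θ ≠ 0 := by linarith [hθ.2]
    have h := (hasDerivAt_id θ).div ((hasDerivAt_id θ).const_sub 1) h1
    refine (h.congr_deriv ?_).hasDerivWithinAt
    simp only [id]
    field_simp
    ring
  have hcv := integral_image_eq_integral_abs_deriv_smul measurableSet_Ioo hder hinj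
    (fun μ => (Real.Gamma (1 - α) * Real.Gamma α)⁻¹ * (μ ^ ((1 - α) - 1) * Real.exp (-(t * μ))))
  rw [himg, integral_const_mul, Real.integral_rpow_mul_exp_neg_mul_Ioi (by linarith) ht] at hcv
  have hG1 := (Real.Gamma_pos_of_pos (show (0 : ℝ) < 1 - α by linarith)).ne'
  have hG2 := (Real.Gamma_pos_of_pos hα₀).ne'
  have hl : (Real.Gamma (1 - α) * Real.Gamma α)⁻¹ * ((1 / t) ^ (1 - α) * Real.Gamma (1 - α)) =
      gker α t := by
    rw [gker, one_div, Real.inv_rpow ht.le, ← Real.rpow_neg ht.le, neg_sub]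
    field_simp
  rw [← hl, hcv]
  refine setIntegral_congr_fun measurableSet_Ioo fun θ hθ => ?_
  have h1 : 0 < 1 - θ := by linarith [hθ.2]
  simp only [weight, gker, expKer, smul_eq_mul, c₀, c₁]
  rw [abs_of_pos (by positivity), Real.div_rpow hθ.1.le h1.le,
    show (α - 1) = -((1 - α) - 1) + -1 by ring, Real.rpow_add h1, Real.rpow_neg h1.le,
    Real.rpow_neg_one, show -(t * (θ / (1 - θ))) = -(θ / (1 - θ)) * t by ring]
  have h2 := (Real.rpow_pos_of_pos h1 (1 - α - 1)).ne'
  field_simp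

theorem integrable_weight_mul_expKer (hα₀ : 0 < α) (hα₁ : α < 1) {t : ℝ} (ht : 0 < t) :
    IntegrableOn (fun θ => weight α θ * expKer θ t) (Ioo 0 1) := by
  by_contra h
  have := integral_undef h
  rw [integral_weight_mul_expKer hα₀ hα₁ ht] at this
  exact (gker_pos hα₀ ht).ne' this

end Weight

/-! ### Weak derivatives and primitives -/

theorem intervalIntegrable_of_timeMeasure {Y : Type*} [NormedAddCommGroup Y] {h : ℝ → Y}
    {t T : ℝ} (hh : Integrable h (timeMeasure T)) (ht : t ∈ Icc 0 T) :
    IntervalIntegrable h volume 0 t := by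
  rw [intervalIntegrable_iff_integrableOn_Ioo_of_le ht.1]
  exact IntegrableOn.mono_set hh (Ioo_subset_Ioo_right ht.2)

theorem integrable_const_timeMeasure {Y : Type*} [NormedAddCommGroup Y] (T : ℝ) (y : Y) :
    Integrable (fun _ : ℝ => y) (timeMeasure T) := by
  have : IsFiniteMeasure (timeMeasure T) := by rw [timeMeasure]; infer_instance
  exact integrable_const y

section WeakDeriv

variable {Y : Type*} [NormedAddCommGroup Y] [NormedSpace ℝ Y]

theorem volterra_one (h : ℝ → Y) (t : ℝ) :
    volterra (fun _ => 1) h t = ∫ s in (0 : ℝ)..t, h s := by simp [volterra]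

theorem integral_abs_le {k : ℝ → ℝ} {t T : ℝ} (hk : Integrable k (timeMeasure T))
    (ht : t ∈ Icc 0 T) : ∫ s in (0 : ℝ)..t, |k s| ≤ ∫ s, |k s| ∂(timeMeasure T) := by
  rw [intervalIntegral.integral_of_le ht.1, integral_Ioc_eq_integral_Ioo]
  exact setIntegral_mono_set hk.abs (Eventually.of_forall fun _ => abs_nonneg _)
    (Ioo_subset_Ioo_right ht.2).eventuallyLE

theorem volterra_integral_left [CompleteSpace Y] {k : ℝ → ℝ} {h : ℝ → Y} {t T : ℝ}
    (ht : t ∈ Icc 0 T) (hk : Integrable k (timeMeasure T)) (hh : Integrable h (timeMeasure T)) :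
    volterra (fun s => ∫ r in (0 : ℝ)..s, k r) h t = ∫ s in (0 : ℝ)..t, volterra k h s := by
  rw [← volterra_one, volterra_assoc ht (integrable_const_timeMeasure T 1) hk hh
    (B := ∫ s, |k s| ∂(timeMeasure T))]
  · simp only [← volterra_one]
  · intro s hs
    simp only [abs_one, volterra_one]
    exact integral_abs_le hk (Ioo_subset_Icc_self hs)

theorem volterra_integral_right [CompleteSpace Y] {k : ℝ → ℝ} {h : ℝ → Y} {t T : ℝ}
    (ht : t ∈ Icc 0 T) (hk : Integrable k (timeMeasure T)) (hh : Integrable h (timeMeasure T)) :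
    volterra k (fun s => ∫ r in (0 : ℝ)..s, h r) t = ∫ s in (0 : ℝ)..t, volterra k h s := by
  rw [← volterra_integral_left ht hk hh]
  simp only [← volterra_one (Y := Y)]
  rw [show (fun s => volterra (fun _ => 1) h s) = volterra (fun _ => 1) h from rfl,
    volterra_assoc ht hk (integrable_const_timeMeasure T 1) hh
      (B := ∫ s, |k s| ∂(timeMeasure T))]
  · congr 1
    ext s
    rw [volterra_comm, volterra_one]
  · intro s hs
    rw [volterra_comm]
    simp only [abs_one, volterra_one]
    exact integral_abs_le hk (Ioo_subset_Icc_self hs)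

/-- A primitive has the expected weak derivative. Integration by parts against the test function
`φ` is read as an identity between Volterra convolutions at time `T` with the kernel
`s ↦ φ' (T - s)`. -/
theorem hasWeakDeriv_of_eq_integral [CompleteSpace Y] {T : ℝ} {f d : ℝ → Y}
    (hd : Integrable d (timeMeasure T))
    (hf : ∀ᵐ t ∂(timeMeasure T), f t = ∫ s in (0 : ℝ)..t, d s) : HasWeakDeriv T f d := by
  intro φ hφ _ hsupp
  rcases le_or_gt T 0 with hT | hT
  · simp [timeMeasure, Ioo_eq_empty_of_le hT]
  have hφd : Continuous (deriv φ) := hφ.continuous_deriv (by simp)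
  have hφT : φ T = 0 := by
    by_contra h
    exact lt_irrefl _ (hsupp (subset_tsupport φ h)).2
  have hTT : T ∈ Icc 0 T := ⟨hT.le, le_rfl⟩
  have hk : Integrable (fun s => deriv φ (T - s)) (timeMeasure T) :=
    ((hφd.comp (continuous_const.sub continuous_id)).continuousOn.integrableOn_Icc
      (a := 0) (b := T)).mono_set Ioo_subset_Icc_self
  have h1 : ∫ t, deriv φ t • f t ∂(timeMeasure T) =
      volterra (fun s => deriv φ (T - s)) (fun t => ∫ s in (0 : ℝ)..t, d s) T := by
    rw [volterra_eq_setIntegral _ _ hT.le]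
    refine integral_congr_ae ?_
    filter_upwards [hf] with t ht
    simp only [ht, sub_sub_cancel]
  rw [h1, volterra_integral_right hTT hk hd, ← volterra_integral_left hTT hk hd,
    volterra_eq_setIntegral _ _ hT.le, ← integral_neg]
  refine integral_congr_ae (Eventually.of_forall fun s => ?_)
  have h2 : ∫ r in (0 : ℝ)..(T - s), deriv φ (T - r) = - φ s := by
    rw [intervalIntegral.integral_comp_sub_left (fun r => deriv φ r), sub_sub_cancel, sub_zero,
      intervalIntegral.integral_deriv_eq_sub (fun x _ => hφ.differentiable (by simp) x)
        (hφd.intervalIntegrable _ _), hφT, zero_sub]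
  simp only [h2, neg_smul]

/-- A smooth function with compact support in `(0,T)` and integral zero is the derivative of a
test function. -/
theorem exists_test_primitive {T : ℝ} {η : ℝ → ℝ} (hη : ContDiff ℝ ∞ η)
    (hc : HasCompactSupport η) (hs : tsupport η ⊆ Ioo 0 T) (h0 : ∫ t, η t = 0) :
    ∃ χ : ℝ → ℝ, ContDiff ℝ ∞ χ ∧ HasCompactSupport χ ∧ tsupport χ ⊆ Ioo 0 T ∧ deriv χ = η := by
  rcases (tsupport η).eq_empty_or_nonempty with he | hne
  · have hz : η = 0 := by rwa [tsupport_eq_empty_iff] at he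
    refine ⟨0, contDiff_const, HasCompactSupport.zero, by simp, ?_⟩
    rw [hz]; exact deriv_const' 0
  obtain ⟨a, ha, ha'⟩ := (show IsCompact (tsupport η) from hc).exists_isLeast hne
  obtain ⟨b, hb, hb'⟩ := (show IsCompact (tsupport η) from hc).exists_isGreatest hne
  -- `[a,b] ⊆ (0,T)` contains the support of `η`, hence also that of its primitive, because the
  -- total integral of `η` is zero
  have hout : ∀ t, t ∉ Icc a b → η t = 0 := fun t ht =>
    image_eq_zero_of_notMem_tsupport fun h => ht ⟨ha' h, hb' h⟩
  have hηc : Continuous η := hη.continuous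
  have hηi : Integrable η := hηc.integrable_of_hasCompactSupport hc
  set χ : ℝ → ℝ := fun t => ∫ s in (0 : ℝ)..t, η s with hχ
  have hder : ∀ t, HasDerivAt χ (η t) t := fun t =>
    intervalIntegral.integral_hasDerivAt_right (hηc.intervalIntegrable _ _)
      hηc.aestronglyMeasurable.stronglyMeasurableAtFilter hηc.continuousAt
  have hderiv : deriv χ = η := funext fun t => (hder t).deriv
  have hsub : Function.support χ ⊆ Icc a b := by
    intro t ht
    by_contra hn
    apply ht
    have ha0 : 0 < a := (hs ha).1
    rw [mem_Icc, not_and_or, not_le, not_le] at hn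
    rcases hn with hn | hn
    · refine intervalIntegral.integral_zero_ae (Eventually.of_forall fun s hs' => hout s ?_)
      intro hs2
      rcases le_total 0 t with h | h
      · rw [uIoc_of_le h] at hs'; linarith [hs'.2, hs2.1]
      · rw [uIoc_of_ge h] at hs'; linarith [hs'.2, hs2.1]
    · have h0t : 0 ≤ t := by linarith [ha' hb]
      rw [hχ]
      simp only
      rw [intervalIntegral.integral_of_le h0t, ← h0]
      refine setIntegral_eq_integral_of_forall_compl_eq_zero fun s hs' => hout s ?_
      intro hs2
      exact hs' ⟨by linarith [hs2.1], by linarith [hs2.2]⟩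
  have htsub : tsupport χ ⊆ Icc a b := closure_minimal hsub isClosed_Icc
  refine ⟨χ, ?_, ?_, htsub.trans fun t ht => ?_, hderiv⟩
  · rw [contDiff_infty_iff_deriv, hderiv]
    exact ⟨fun t => (hder t).differentiableAt, hη⟩
  · exact isCompact_Icc.of_isClosed_subset (isClosed_tsupport χ) htsub
  · exact ⟨(hs ha).1.trans_le ht.1, ht.2.trans_lt (hs hb).2⟩

/-- The lemma of du Bois-Reymond: a function with an integrable weak derivative is, up to a
constant, the primitive of that derivative. -/
theorem HasWeakDeriv.exists_eq_const_add_integral [CompleteSpace Y] {T : ℝ} (hT : 0 < T)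
    {f d : ℝ → Y} (hf : Integrable f (timeMeasure T)) (hd : Integrable d (timeMeasure T))
    (h : HasWeakDeriv T f d) :
    ∃ y : Y, ∀ᵐ t ∂(timeMeasure T), f t = y + ∫ s in (0 : ℝ)..t, d s := by
  have hDi : Integrable (fun t => ∫ s in (0 : ℝ)..t, d s) (timeMeasure T) := by
    have := integrable_volterra (integrable_const_timeMeasure T (1 : ℝ)) hd
    simpa only [← volterra_one] using this
  set g : ℝ → Y := fun t => f t - ∫ s in (0 : ℝ)..t, d s with hg
  have hgi : Integrable g (timeMeasure T) := hf.sub hDi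
  have hmul : ∀ (φ : ℝ → ℝ) (k : ℝ → Y), Continuous φ → HasCompactSupport φ →
      Integrable k (timeMeasure T) → Integrable (fun t => φ t • k t) (timeMeasure T) := by
    intro φ k hφ hφc hk
    obtain ⟨C, hC⟩ := hφ.bounded_above_of_compact_support hφc
    exact hk.bdd_smul C hφ.aestronglyMeasurable (Eventually.of_forall hC)
  -- the difference `g` of `f` and the primitive of `d` has weak derivative zero
  have hg0 : ∀ χ : ℝ → ℝ, ContDiff ℝ ∞ χ → HasCompactSupport χ → tsupport χ ⊆ Ioo 0 T →
      ∫ t, deriv χ t • g t ∂(timeMeasure T) = 0 := by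
    intro χ h1 h2 h3
    have hc : Continuous (deriv χ) := h1.continuous_deriv (by simp)
    have e1 := h χ h1 h2 h3
    have e2 := hasWeakDeriv_of_eq_integral hd
      (f := fun t => ∫ s in (0 : ℝ)..t, d s) (Eventually.of_forall fun _ => rfl) χ h1 h2 h3
    simp only [hg, smul_sub]
    rw [integral_sub (hmul _ _ hc h2.deriv hf) (hmul _ _ hc h2.deriv hDi), e1, e2, sub_self]
  -- a test function `ψ` of integral `1`; the constant is the mean of `g` against `ψ`
  let b : ContDiffBump (T / 2 : ℝ) := ⟨T / 8, T / 4, by positivity, by linarith⟩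
  set ψ : ℝ → ℝ := b.normed volume with hψ
  have hψ1 : ContDiff ℝ ∞ ψ := b.contDiff_normed
  have hψ2 : HasCompactSupport ψ := b.hasCompactSupport_normed
  have hψ3 : tsupport ψ ⊆ Ioo 0 T := by
    rw [hψ, b.tsupport_normed_eq, Real.closedBall_eq_Icc]
    intro t ht
    change t ∈ Icc (T / 2 - T / 4) (T / 2 + T / 4) at ht
    exact ⟨by linarith [ht.1], by linarith [ht.2]⟩
  have hψ4 : ∫ t, ψ t = 1 := b.integral_normed
  set y : Y := ∫ t, ψ t • g t ∂(timeMeasure T) with hy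
  refine ⟨y, ?_⟩
  have key : ∀ᵐ t, t ∈ Ioo 0 T → g t - y = 0 := by
    refine isOpen_Ioo.ae_eq_zero_of_integral_contDiff_smul_eq_zero (f := fun t => g t - y)
      ?_ fun φ h1 h2 h3 => ?_
    · refine IntegrableOn.locallyIntegrableOn ?_
      exact hgi.sub (integrable_const_timeMeasure T y)
    · have hout : ∀ t ∉ Ioo 0 T, φ t = 0 := fun t ht =>
        image_eq_zero_of_notMem_tsupport fun h => ht (h3 h)
      have hφi : Integrable φ := h1.continuous.integrable_of_hasCompactSupport h2
      have hψi : Integrable ψ := hψ1.continuous.integrable_of_hasCompactSupport hψ2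
      -- subtracting `m ψ` from `φ` makes its integral vanish, so that the difference is the
      -- derivative of a test function
      set m : ℝ := ∫ t, φ t with hm
      have hmψ : HasCompactSupport (fun t => m * ψ t) := hψ2.mul_left (f := fun _ => m)
      have hs' : tsupport (fun t => φ t - m * ψ t) ⊆ Ioo 0 T :=
        (tsupport_sub φ fun t => m * ψ t).trans (union_subset h3
          ((closure_mono (Function.support_mul_subset_right (fun _ => m) ψ)).trans hψ3))
      have h0' : ∫ t, (φ t - m * ψ t) = 0 := by
        rw [integral_sub hφi (hψi.const_mul m), integral_const_mul, hψ4, mul_one, sub_self]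
      obtain ⟨χ, c1, c2, c3, c4⟩ := exists_test_primitive (T := T) (η := fun t => φ t - m * ψ t)
        (h1.sub (contDiff_const.mul hψ1)) (h2.sub hmψ) hs' h0'
      · have e := hg0 χ c1 c2 c3
        rw [c4] at e
        simp only [sub_smul] at e
        rw [integral_sub (hmul _ _ h1.continuous h2 hgi)
          (hmul (fun t => m * ψ t) _ (continuous_const.mul hψ1.continuous) hmψ hgi)] at e
        simp only [mul_smul] at e
        rw [integral_smul, ← hy, sub_eq_zero] at e
        rw [← setIntegral_eq_integral_of_forall_compl_eq_zero (s := Ioo 0 T)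
          (fun t ht => by rw [hout t ht, zero_smul])]
        simp only [smul_sub]
        have hφi' : Integrable φ (timeMeasure T) := hφi.integrableOn
        change ∫ t, (φ t • g t - φ t • y) ∂(timeMeasure T) = 0
        rw [integral_sub (hmul _ _ h1.continuous h2 hgi) (hφi'.smul_const y), e,
          integral_smul_const, sub_eq_zero]
        congr 1
        rw [hm]
        exact (setIntegral_eq_integral_of_forall_compl_eq_zero hout).symm
  rw [timeMeasure, ae_restrict_iff' measurableSet_Ioo]
  filter_upwards [key] with t ht htT
  have := ht htT
  rw [sub_eq_zero, hg] at this
  simp only at this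
  rw [← this, sub_add_cancel]

end WeakDeriv

/-! ### Rademacher functions -/

section Rademacher

/-- The `1`-periodic function equal to `1` on `[0,1/2)` and to `-1` on `[1/2,1)`. -/
def squareWave (x : ℝ) : ℝ := if Int.fract x < 1 / 2 then 1 else -1

theorem measurable_squareWave : Measurable squareWave :=
  Measurable.ite (measurableSet_lt measurable_fract measurable_const) measurable_const
    measurable_const

theorem squareWave_periodic : Function.Periodic squareWave 1 := fun x => by
  simp [squareWave, Int.fract_add_one]

theorem squareWave_eq_or (x : ℝ) : squareWave x = 1 ∨ squareWave x = -1 := by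
  unfold squareWave; split_ifs <;> simp

theorem abs_squareWave (x : ℝ) : |squareWave x| = 1 := by
  rcases squareWave_eq_or x with h | h <;> simp [h]

theorem intervalIntegrable_of_bounded {f : ℝ → ℝ} (hf : Measurable f) {C : ℝ}
    (hC : ∀ x, |f x| ≤ C) (a b : ℝ) : IntervalIntegrable f volume a b :=
  (intervalIntegrable_const (c := C)).mono_fun hf.aestronglyMeasurable
    (Eventually.of_forall fun x => by
      simpa using (hC x).trans (le_abs_self C))

theorem squareWave_of_lt {x : ℝ} (h0 : 0 ≤ x) (h1 : x < 1 / 2) : squareWave x = 1 := by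
  rw [squareWave, Int.fract_eq_self.2 ⟨h0, by linarith⟩, if_pos h1]

theorem squareWave_of_ge {x : ℝ} (h0 : 1 / 2 ≤ x) (h1 : x < 1) : squareWave x = -1 := by
  rw [squareWave, Int.fract_eq_self.2 ⟨by linarith, h1⟩, if_neg (by linarith)]

/-- Splitting an integral against the square wave over one period. -/
theorem integral_squareWave_mul {f : ℝ → ℝ} (hf : Measurable f) {C : ℝ} (hC : ∀ x, |f x| ≤ C) :
    ∫ x in (0 : ℝ)..1, squareWave x * f x =
      (∫ x in (0 : ℝ)..(1 / 2), f x) - ∫ x in (1 / 2 : ℝ)..1, f x := by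
  have hm : Measurable fun x => squareWave x * f x := measurable_squareWave.mul hf
  have hb : ∀ x, |squareWave x * f x| ≤ C := fun x => by
    rw [abs_mul, abs_squareWave, one_mul]; exact hC x
  rw [← intervalIntegral.integral_add_adjacent_intervals
    (intervalIntegrable_of_bounded hm hb 0 (1 / 2)) (intervalIntegrable_of_bounded hm hb (1 / 2) 1),
    sub_eq_add_neg, ← intervalIntegral.integral_neg]
  congr 1
  · rw [intervalIntegral.integral_of_le (by norm_num), intervalIntegral.integral_of_le (by norm_num),
      integral_Ioc_eq_integral_Ioo, integral_Ioc_eq_integral_Ioo]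
    refine setIntegral_congr_fun measurableSet_Ioo fun x hx => ?_
    simp [squareWave_of_lt hx.1.le hx.2]
  · rw [intervalIntegral.integral_of_le (by norm_num), intervalIntegral.integral_of_le (by norm_num),
      integral_Ioc_eq_integral_Ioo, integral_Ioc_eq_integral_Ioo]
    refine setIntegral_congr_fun measurableSet_Ioo fun x hx => ?_
    simp [squareWave_of_ge hx.1.le hx.2]

theorem integral_periodic_nat {f : ℝ → ℝ} (hp : Function.Periodic f 1) (hf : Measurable f) {C : ℝ}
    (hC : ∀ x, |f x| ≤ C) (n : ℕ) (a : ℝ) :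
    ∫ x in a..(a + n), f x = n * ∫ x in (0 : ℝ)..1, f x := by
  have h := hp.intervalIntegral_add_zsmul_eq n a (intervalIntegrable_of_bounded hf hC)
  simp only [zsmul_eq_mul, Int.cast_natCast, mul_one] at h
  rw [h, hp.intervalIntegral_add_eq a 0, zero_add]

theorem integral_squareWave : ∫ x in (0 : ℝ)..1, squareWave x = 0 := by
  have h := integral_squareWave_mul (f := fun _ => 1) measurable_const (C := 1) (by simp)
  simp only [mul_one] at h
  rw [h]; norm_num

theorem integral_periodic_comp_mul {f : ℝ → ℝ} (hp : Function.Periodic f 1) (hf : Measurable f)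
    {C : ℝ} (hC : ∀ x, |f x| ≤ C) (k : ℕ) :
    ∫ x in (0 : ℝ)..1, f (2 ^ k * x) = ∫ x in (0 : ℝ)..1, f x := by
  have h2 : (2 : ℝ) ^ k ≠ 0 := by positivity
  have h := integral_periodic_nat hp hf hC (2 ^ k) 0
  push_cast at h
  rw [intervalIntegral.integral_comp_mul_left _ h2]
  simp only [mul_zero, mul_one, zero_add] at h ⊢
  rw [h, smul_eq_mul]
  field_simp

/-- Over each half period of the square wave, the faster wave runs through `2 ^ n` full periods, on
each of which its integral vanishes. -/
theorem integral_squareWave_mul_comp {m : ℕ} (hm : m ≠ 0) :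
    ∫ x in (0 : ℝ)..1, squareWave x * squareWave (2 ^ m * x) = 0 := by
  obtain ⟨n, rfl⟩ := Nat.exists_eq_succ_of_ne_zero hm
  have h2 : (2 : ℝ) ^ (n + 1) ≠ 0 := by positivity
  have hn := integral_periodic_nat squareWave_periodic measurable_squareWave
    (fun x => (abs_squareWave x).le) (2 ^ n)
  push_cast at hn
  rw [integral_squareWave_mul (f := fun x => squareWave (2 ^ (n + 1) * x))
    (measurable_squareWave.comp (measurable_const.mul measurable_id))
    (fun x => (abs_squareWave _).le)]
  rw [intervalIntegral.integral_comp_mul_left _ h2, intervalIntegral.integral_comp_mul_left _ h2]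
  have e1 : (2 : ℝ) ^ (n + 1) * (1 / 2) = 0 + 2 ^ n := by rw [pow_succ]; ring
  have e2 : (2 : ℝ) ^ (n + 1) * 1 = (0 + 2 ^ n) + 2 ^ n := by rw [pow_succ]; ring
  have h3 := hn 0
  have h4 := hn (0 + 2 ^ n)
  rw [mul_zero, e2, e1, h3, h4, integral_squareWave]
  simp

/-- The Rademacher functions of the interval `(0,T)`. -/
def rademacher (T : ℝ) (k : ℕ) (t : ℝ) : ℝ := squareWave (2 ^ k * (t / T))

theorem measurable_rademacher (T : ℝ) (k : ℕ) : Measurable (rademacher T k) :=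
  measurable_squareWave.comp (measurable_const.mul (measurable_id.div_const T))

theorem abs_rademacher (T : ℝ) (k : ℕ) (t : ℝ) : |rademacher T k t| = 1 := abs_squareWave _

theorem integral_timeMeasure_div {T : ℝ} (hT : 0 < T) (f : ℝ → ℝ) :
    ∫ t, f (t / T) ∂(timeMeasure T) = T * ∫ x in (0 : ℝ)..1, f x := by
  have h := intervalIntegral.integral_comp_div (a := 0) (b := T) f hT.ne'
  rw [intervalIntegral.integral_of_le hT.le, integral_Ioc_eq_integral_Ioo, zero_div,
    div_self hT.ne'] at h
  exact h

theorem integral_rademacher {T : ℝ} (hT : 0 < T) (k : ℕ) :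
    ∫ t, rademacher T k t ∂(timeMeasure T) = 0 := by
  have h := integral_timeMeasure_div hT (fun x => squareWave (2 ^ k * x))
  rw [integral_periodic_comp_mul squareWave_periodic measurable_squareWave
    (fun x => (abs_squareWave x).le), integral_squareWave, mul_zero] at h
  exact h

theorem integral_rademacher_mul_of_lt {T : ℝ} (hT : 0 < T) {k l : ℕ} (hkl : k < l) :
    ∫ t, rademacher T k t * rademacher T l t ∂(timeMeasure T) = 0 := by
  obtain ⟨m, rfl⟩ := Nat.exists_eq_add_of_lt hkl
  have h := integral_timeMeasure_div hT
    (fun x => squareWave (2 ^ k * x) * squareWave (2 ^ (k + m + 1) * x))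
  have h2 := integral_periodic_comp_mul
    (f := fun x => squareWave x * squareWave (2 ^ (m + 1) * x)) (C := 1) (fun x => ?_)
    (measurable_squareWave.mul (measurable_squareWave.comp (measurable_const.mul measurable_id)))
    (fun x => by rw [abs_mul, abs_squareWave, abs_squareWave, one_mul]) k
  · rw [integral_squareWave_mul_comp (by omega)] at h2
    have e : ∀ x : ℝ, (2 : ℝ) ^ (k + m + 1) * x = 2 ^ (m + 1) * (2 ^ k * x) := fun x => by ring
    simp only [e] at h
    rw [h2, mul_zero] at h
    simp only [rademacher, e]
    exact h
  · have e : (2 : ℝ) ^ (m + 1) * (x + 1) = 2 ^ (m + 1) * x + (2 ^ (m + 1) : ℕ) * 1 := by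
      push_cast; ring
    simp only
    rw [squareWave_periodic x, e, squareWave_periodic.nat_mul (2 ^ (m + 1)) (2 ^ (m + 1) * x)]

theorem integral_rademacher_mul {T : ℝ} (hT : 0 < T) (k l : ℕ) :
    ∫ t, rademacher T k t * rademacher T l t ∂(timeMeasure T) = if k = l then T else 0 := by
  rcases lt_trichotomy k l with h | rfl | h
  · rw [if_neg h.ne, integral_rademacher_mul_of_lt hT h]
  · have : ∀ t, rademacher T k t * rademacher T k t = 1 := fun t => by
      rw [← abs_mul_abs_self, abs_rademacher, one_mul]
    simp [this, timeMeasure, hT.le]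
  · rw [if_neg h.ne']
    simp only [mul_comm (rademacher T k _)]
    exact integral_rademacher_mul_of_lt hT h

end Rademacher

/-! ### Weak-to-weak continuity forces a gradient to be affine -/

section Affine

instance instIsFiniteMeasureTimeMeasure (T : ℝ) : IsFiniteMeasure (timeMeasure T) := by
  rw [timeMeasure]; infer_instance

theorem integral_sum_rademacher_sq {T : ℝ} (hT : 0 < T) (F : Finset ℕ) (σ : ℕ → ℝ) :
    ∫ t, (∑ k ∈ F, σ k * rademacher T k t) ^ 2 ∂(timeMeasure T) = T * ∑ k ∈ F, σ k ^ 2 := by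
  have hi : ∀ k l, Integrable (fun t => σ k * rademacher T k t * (σ l * rademacher T l t))
      (timeMeasure T) := fun k l => by
    refine Integrable.of_bound (C := |σ k| * |σ l|) ((((measurable_rademacher T k).const_mul _).mul
      ((measurable_rademacher T l).const_mul _)).aestronglyMeasurable)
      (Eventually.of_forall fun t => le_of_eq ?_)
    rw [Real.norm_eq_abs, abs_mul, abs_mul, abs_mul, abs_rademacher, abs_rademacher]
    ring
  simp only [sq, Finset.sum_mul_sum]
  rw [integral_finsetSum _ fun k _ => integrable_finsetSum _ fun l _ => hi k l, Finset.mul_sum]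
  refine Finset.sum_congr rfl fun k hk => ?_
  rw [integral_finsetSum _ fun l _ => hi k l]
  have : ∀ l, ∫ t, σ k * rademacher T k t * (σ l * rademacher T l t) ∂(timeMeasure T) =
      if k = l then σ k * σ l * T else 0 := fun l => by
    have h := integral_rademacher_mul hT k l
    calc _ = ∫ t, σ k * σ l * (rademacher T k t * rademacher T l t) ∂(timeMeasure T) := by
          congr 1; ext t; ring
      _ = _ := by rw [integral_const_mul, h, mul_ite, mul_zero]
  simp only [this, Finset.sum_ite_eq, if_pos hk]
  ring

theorem abs_sum_rademacher_le (T : ℝ) (F : Finset ℕ) {σ : ℕ → ℝ} (hσ : ∀ k, |σ k| ≤ 1) (t : ℝ) :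
    |∑ k ∈ F, σ k * rademacher T k t| ≤ F.card := by
  refine (Finset.abs_sum_le_sum_abs _ _).trans ?_
  rw [← nsmul_one]
  refine Finset.sum_le_card_nsmul _ _ _ fun k _ => ?_
  rw [abs_mul, abs_rademacher, mul_one]
  exact hσ k

/-- Signed sums of `n` Rademacher functions have `L^1` norm of order `√n`, by orthogonality. -/
theorem integral_abs_sum_rademacher_le {T : ℝ} (hT : 0 < T) (F : Finset ℕ) {σ : ℕ → ℝ}
    (hσ : ∀ k, |σ k| ≤ 1) (hF : F.Nonempty) :
    ∫ t, |∑ k ∈ F, σ k * rademacher T k t| ∂(timeMeasure T) ≤ T * √(F.card) := by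
  set s : ℝ → ℝ := fun t => ∑ k ∈ F, σ k * rademacher T k t with hs
  set c : ℝ := √(F.card) with hc
  have hcpos : 0 < c := Real.sqrt_pos.2 (by exact_mod_cast hF.card_pos)
  have hc2 : c ^ 2 = F.card := Real.sq_sqrt (by positivity)
  have hsm : Measurable s :=
    Finset.measurable_sum _ fun k _ => (measurable_rademacher T k).const_mul _
  have hsb : ∀ t, |s t| ≤ F.card := abs_sum_rademacher_le T F hσ
  have hi2 : Integrable (fun t => s t ^ 2) (timeMeasure T) :=
    Integrable.of_bound (C := (F.card : ℝ) ^ 2) (hsm.pow_const 2).aestronglyMeasurable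
      (Eventually.of_forall fun t => by
        rw [norm_pow, Real.norm_eq_abs]; exact pow_le_pow_left₀ (abs_nonneg _) (hsb t) 2)
  have hi : Integrable s (timeMeasure T) :=
    Integrable.of_bound (C := (F.card : ℝ)) hsm.aestronglyMeasurable (Eventually.of_forall hsb)
  -- Young's inequality `2 c |s| ≤ c ^ 2 + s ^ 2`; the choice `c = √n` balances the two terms
  have hle : ∀ t, |s t| ≤ c / 2 + (2 * c)⁻¹ * s t ^ 2 := fun t => by
    have h1 : 0 ≤ (|s t| - c) ^ 2 := sq_nonneg _
    have h2 : |s t| ^ 2 = s t ^ 2 := sq_abs _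
    have h3 : c / 2 + (2 * c)⁻¹ * s t ^ 2 - |s t| = (2 * c)⁻¹ * (|s t| - c) ^ 2 := by
      rw [← h2]; field_simp; ring
    have h4 : 0 ≤ (2 * c)⁻¹ * (|s t| - c) ^ 2 := by positivity
    linarith
  have hvol : ∫ _, c / 2 ∂(timeMeasure T) = T * (c / 2) := by
    simp [timeMeasure, hT.le]
  calc ∫ t, |s t| ∂(timeMeasure T)
      ≤ ∫ t, (c / 2 + (2 * c)⁻¹ * s t ^ 2) ∂(timeMeasure T) :=
        integral_mono hi.abs ((integrable_const _).add (hi2.const_mul _)) hle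
    _ = T * (c / 2) + (2 * c)⁻¹ * (T * ∑ k ∈ F, σ k ^ 2) := by
        rw [integral_add (integrable_const _) (hi2.const_mul _), integral_const_mul, hvol, hs,
          integral_sum_rademacher_sq hT]
    _ ≤ T * (c / 2) + (2 * c)⁻¹ * (T * c ^ 2) := by
        gcongr
        rw [hc2, ← nsmul_one]
        refine Finset.sum_le_card_nsmul _ _ _ fun k _ => ?_
        rw [← sq_abs]
        exact pow_le_one₀ (abs_nonneg _) (hσ k)
    _ = T * c := by field_simp; ring

variable {X : Type*} [NormedAddCommGroup X] [NormedSpace ℝ X]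

theorem memLp_smul_const_of_bounded {T : ℝ} {r : ℝ → ℝ} (hr : Measurable r) {C : ℝ}
    (hC : ∀ t, |r t| ≤ C) (x : X) (P : ℝ≥0∞) : MemLp (fun t => r t • x) P (timeMeasure T) :=
  MemLp.of_bound (hr.aestronglyMeasurable.smul_const x) (C * ‖x‖) (Eventually.of_forall fun t => by
    rw [norm_smul, Real.norm_eq_abs]; exact mul_le_mul_of_nonneg_right (hC t) (norm_nonneg _))

/-- Interpolation between the `L^1` bound and the trivial bound `n` in the supremum norm: the `L^P`
norm of a signed sum of `n` Rademacher functions is `o(n)` for `P < ∞`. -/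
theorem norm_toLp_sum_rademacher_le {T : ℝ} (hT : 0 < T) {P : ℝ≥0∞} (hP1 : 1 ≤ P) (hP : P ≠ ⊤)
    {F : Finset ℕ} {σ : ℕ → ℝ} (hσ : ∀ k, |σ k| ≤ 1) (hF : F.Nonempty) (x : X)
    (hm : MemLp (fun t => (∑ k ∈ F, σ k * rademacher T k t) • x) P (timeMeasure T)) :
    ‖hm.toLp‖ ≤ F.card * ((T / √(F.card)) ^ (P.toReal⁻¹) * ‖x‖) := by
  have hn : (0 : ℝ) < F.card := by exact_mod_cast hF.card_pos
  have hp1 : 1 ≤ P.toReal := by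
    rw [← ENNReal.toReal_one]; exact ENNReal.toReal_mono hP hP1
  have hp0 : 0 < P.toReal := by linarith
  set s : ℝ → ℝ := fun t => ∑ k ∈ F, σ k * rademacher T k t with hs
  have hsm : Measurable s :=
    Finset.measurable_sum _ fun k _ => (measurable_rademacher T k).const_mul _
  have hsb : ∀ t, |s t| ≤ F.card := abs_sum_rademacher_le T F hσ
  have hi : Integrable s (timeMeasure T) :=
    Integrable.of_bound (C := (F.card : ℝ)) hsm.aestronglyMeasurable (Eventually.of_forall hsb)
  rw [Lp.norm_toLp, hm.eLpNorm_eq_integral_rpow_norm (by positivity) hP,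
    ENNReal.toReal_ofReal (Real.rpow_nonneg (integral_nonneg fun _ => by positivity) _)]
  have key : ∫ t, ‖s t • x‖ ^ P.toReal ∂(timeMeasure T) ≤
      (F.card * ‖x‖) ^ P.toReal * (T / √(F.card)) := by
    have h1 : ∀ t, ‖s t • x‖ ^ P.toReal ≤ (F.card * ‖x‖) ^ P.toReal * (|s t| / F.card) := by
      intro t
      have h2 : |s t| / F.card ≤ 1 := (div_le_one hn).2 (hsb t)
      have h3 : (|s t| / F.card) ^ P.toReal ≤ |s t| / F.card := by
        have := Real.rpow_le_rpow_of_exponent_ge' (div_nonneg (abs_nonneg _) hn.le) h2 zero_le_one hp1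
        rwa [Real.rpow_one] at this
      have h4 : ‖s t • x‖ = (F.card * ‖x‖) * (|s t| / F.card) := by
        rw [norm_smul, Real.norm_eq_abs]; field_simp
      rw [h4, Real.mul_rpow (by positivity) (by positivity)]
      gcongr
    calc _ ≤ ∫ t, (F.card * ‖x‖) ^ P.toReal * (|s t| / F.card) ∂(timeMeasure T) := by
          refine integral_mono_of_nonneg (Eventually.of_forall fun t => by positivity)
            ((hi.abs.div_const _).const_mul _) (Eventually.of_forall h1)
      _ = (F.card * ‖x‖) ^ P.toReal * ((∫ t, |s t| ∂(timeMeasure T)) / F.card) := by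
          rw [integral_const_mul, integral_div]
      _ ≤ (F.card * ‖x‖) ^ P.toReal * (T * √(F.card) / F.card) := by
          gcongr
          exact integral_abs_sum_rademacher_le hT F hσ hF
      _ = _ := by
          congr 1
          have h5 : (F.card : ℝ) = √(F.card) * √(F.card) := (Real.mul_self_sqrt hn.le).symm
          have h6 : √(F.card : ℝ) ≠ 0 := (Real.sqrt_pos.2 hn).ne'
          nth_rewrite 2 [h5]
          field_simp
  calc (∫ t, ‖s t • x‖ ^ P.toReal ∂(timeMeasure T)) ^ P.toReal⁻¹
      ≤ ((F.card * ‖x‖) ^ P.toReal * (T / √(F.card))) ^ P.toReal⁻¹ :=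
        Real.rpow_le_rpow (integral_nonneg fun _ => by positivity) key (by positivity)
    _ = F.card * ((T / √(F.card)) ^ (P.toReal⁻¹) * ‖x‖) := by
        rw [Real.mul_rpow (by positivity) (by positivity),
          Real.rpow_rpow_inv (by positivity) hp0.ne']
        ring

theorem memLp_rademacher_smul (T : ℝ) (k : ℕ) (x : X) (P : ℝ≥0∞) :
    MemLp (fun t => rademacher T k t • x) P (timeMeasure T) :=
  memLp_smul_const_of_bounded (measurable_rademacher T k) (fun t => (abs_rademacher T k t).le) x P

theorem sum_smul_toLp_rademacher (T : ℝ) (P : ℝ≥0∞) (F : Finset ℕ) (σ : ℕ → ℝ) (x : X)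
    (hm : MemLp (fun t => (∑ k ∈ F, σ k * rademacher T k t) • x) P (timeMeasure T)) :
    ∑ k ∈ F, σ k • (memLp_rademacher_smul T k x P).toLp = hm.toLp := by
  induction F using Finset.induction_on with
  | empty =>
    rw [Finset.sum_empty, ← MemLp.toLp_zero (MemLp.zero (ε := X)), MemLp.toLp_eq_toLp_iff]
    exact Eventually.of_forall fun t => by simp
  | insert a s ha ih =>
    have hm' : MemLp (fun t => (∑ k ∈ s, σ k * rademacher T k t) • x) P (timeMeasure T) := by
      have h := hm.sub ((memLp_rademacher_smul T a x P).const_smul (σ a))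
      refine h.ae_eq (Eventually.of_forall fun t => ?_)
      simp only [Pi.sub_apply, Pi.smul_apply, Finset.sum_insert ha, add_smul, mul_smul,
        add_sub_cancel_left]
    rw [Finset.sum_insert ha, ih hm', ← MemLp.toLp_const_smul, ← MemLp.toLp_add]
    refine (MemLp.toLp_eq_toLp_iff _ _).2 (Eventually.of_forall fun t => ?_)
    simp only [Pi.add_apply, Pi.smul_apply, Finset.sum_insert ha, add_smul, mul_smul]

/-- The Rademacher functions converge weakly to zero in `L^P`, `1 ≤ P < ∞`: otherwise some
functional would be at least `ε n` on signed sums of `n` of them, whose norms are `o(n)`. -/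
theorem tendsto_rademacher_weakly {T : ℝ} (hT : 0 < T) {P : ℝ≥0∞} [Fact (1 ≤ P)] (hP : P ≠ ⊤)
    (x : X) (L : StrongDual ℝ (Lp X P (timeMeasure T))) :
    Tendsto (fun k => L (memLp_rademacher_smul T k x P).toLp) atTop (𝓝 0) := by
  set a : ℕ → ℝ := fun k => L (memLp_rademacher_smul T k x P).toLp with ha
  by_contra hcon
  rw [Metric.tendsto_atTop] at hcon
  push Not at hcon
  obtain ⟨ε, hε, hN⟩ := hcon
  have hinf : {k | ε ≤ |a k|}.Infinite := by
    refine Set.infinite_of_not_bddAbove fun ⟨N, hb⟩ => ?_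
    obtain ⟨n, hn, hn'⟩ := hN (N + 1)
    rw [dist_zero_right, Real.norm_eq_abs] at hn'
    have := hb hn'
    omega
  have hp0 : 0 < P.toReal := ENNReal.toReal_pos (zero_lt_one.trans_le Fact.out).ne' hP
  have hbound : ∀ n : ℕ, ε ≤ ‖L‖ * ((T / √((n + 1 : ℕ) : ℝ)) ^ (P.toReal⁻¹) * ‖x‖) := by
    intro n
    obtain ⟨F, hF, hcard⟩ := hinf.exists_subset_card_eq (n + 1)
    have hne : F.Nonempty := Finset.card_pos.1 (by omega)
    have hn : (0 : ℝ) < ((n + 1 : ℕ) : ℝ) := by positivity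
    -- signs that align all the values of `L`
    set σ : ℕ → ℝ := fun k => SignType.sign (a k)
    have hσ : ∀ k, |σ k| ≤ 1 := fun k => by
      rcases lt_trichotomy (a k) 0 with h | h | h <;> simp [σ, h]
    have hm : MemLp (fun t => (∑ k ∈ F, σ k * rademacher T k t) • x) P (timeMeasure T) :=
      memLp_smul_const_of_bounded
        (Finset.measurable_sum _ fun k _ => (measurable_rademacher T k).const_mul _)
        (abs_sum_rademacher_le T F hσ) x P
    have h1 := norm_toLp_sum_rademacher_le hT Fact.out hP hσ hne x hm
    have h2 : L hm.toLp = ∑ k ∈ F, |a k| := by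
      rw [← sum_smul_toLp_rademacher, map_sum]
      refine Finset.sum_congr rfl fun k _ => ?_
      rw [map_smul, smul_eq_mul]
      exact sign_mul_self (a k)
    have h3 : (F.card : ℝ) * ε ≤ ∑ k ∈ F, |a k| := by
      rw [← nsmul_eq_mul]
      exact Finset.card_nsmul_le_sum _ _ _ fun k hk => hF hk
    have h4 : L hm.toLp ≤ ‖L‖ * ‖hm.toLp‖ := (le_abs_self _).trans (L.le_opNorm _)
    rw [hcard] at h1 h3
    have h5 : ((n + 1 : ℕ) : ℝ) * ε ≤ ((n + 1 : ℕ) : ℝ) *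
        (‖L‖ * ((T / √((n + 1 : ℕ) : ℝ)) ^ (P.toReal⁻¹) * ‖x‖)) := by
      calc _ ≤ ‖L‖ * ‖hm.toLp‖ := by rw [← h2] at h3; exact h3.trans h4
        _ ≤ ‖L‖ * (((n + 1 : ℕ) : ℝ) * ((T / √((n + 1 : ℕ) : ℝ)) ^ (P.toReal⁻¹) * ‖x‖)) := by
          gcongr
        _ = _ := by ring
    exact le_of_mul_le_mul_left h5 hn
  have hlim : Tendsto (fun n : ℕ => ‖L‖ * ((T / √((n + 1 : ℕ) : ℝ)) ^ (P.toReal⁻¹) * ‖x‖)) atTop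
      (𝓝 (‖L‖ * (0 * ‖x‖))) := by
    refine Tendsto.const_mul _ (Tendsto.mul_const _ ?_)
    have h1 : Tendsto (fun n : ℕ => T / √((n + 1 : ℕ) : ℝ)) atTop (𝓝 0) :=
      Tendsto.div_atTop tendsto_const_nhds (Real.tendsto_sqrt_atTop.comp
        (tendsto_natCast_atTop_atTop.comp (tendsto_add_atTop_nat 1)))
    have h2 := h1.rpow_const (p := P.toReal⁻¹) (Or.inr (by positivity))
    rwa [Real.zero_rpow (by positivity)] at h2
  have := ge_of_tendsto' hlim hbound
  simp only [zero_mul, mul_zero] at this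
  linarith

/-- A map whose Nemytskii operator is weak-to-weak continuous on Lebesgue-Bochner spaces is
midpoint-affine: let a function oscillate faster and faster between two values `a` and `b`. -/
theorem WeakToWeakContinuous.map_midpoint {F : X → StrongDual ℝ X} {T p q : ℝ} (hT : 0 < T)
    {hpq : p.HolderConjugate q} (hF : WeakToWeakContinuous F T p q hpq) (a b : X) :
    F ((2 : ℝ)⁻¹ • (a + b)) = (2 : ℝ)⁻¹ • (F a + F b) := by
  have hP : Fact (1 ≤ ENNReal.ofReal p) := ⟨ENNReal.one_le_ofReal.2 hpq.lt.le⟩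
  have hQ : Fact (1 ≤ ENNReal.ofReal q) := ⟨ENNReal.one_le_ofReal.2 hpq.symm.lt.le⟩
  set m : X := (2 : ℝ)⁻¹ • (a + b)
  set e : X := (2 : ℝ)⁻¹ • (a - b)
  set M : StrongDual ℝ X := (2 : ℝ)⁻¹ • (F a + F b)
  set D : StrongDual ℝ X := (2 : ℝ)⁻¹ • (F a - F b)
  -- `F` is affine along the two points `a = m + e` and `b = m - e` that the function visits
  have hval : ∀ k t, F (m + rademacher T k t • e) = M + rademacher T k t • D := by
    intro k t
    have e1 : m + e = a := by simp only [m, e]; module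
    have e2 : m - e = b := by simp only [m, e]; module
    have e3 : M + D = F a := by simp only [M, D]; module
    have e4 : M - D = F b := by simp only [M, D]; module
    rcases squareWave_eq_or (2 ^ k * (t / T)) with h | h
    · simp only [rademacher, h, one_smul, e1, e3]
    · simp only [rademacher, h]
      have e5 : M + (-1 : ℝ) • D = F b := by rw [← e4]; ext x; simp [sub_eq_add_neg]
      rw [neg_one_smul, ← sub_eq_add_neg, e2, e5]
  have hm : MemLp (fun _ : ℝ => m) (ENNReal.ofReal p) (timeMeasure T) := memLp_const m
  have hFm : MemLp (fun _ : ℝ => F m) (ENNReal.ofReal q) (timeMeasure T) := memLp_const _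
  have hM : MemLp (fun _ : ℝ => M) (ENNReal.ofReal q) (timeMeasure T) := memLp_const M
  have hre := fun k => memLp_rademacher_smul T k e (ENNReal.ofReal p)
  have hrD := fun k => memLp_rademacher_smul T k D (ENNReal.ofReal q)
  have h := hF (fun k => hm.toLp + (hre k).toLp) hm.toLp (fun k => hM.toLp + (hrD k).toLp)
    hFm.toLp (fun k => ?_) ?_ (fun L => ?_)
  · ext x
    have : (ENNReal.ofReal q).HolderConjugate (ENNReal.ofReal p) := hpq.symm.ennrealOfReal
    have hx : MemLp (fun _ : ℝ => x) (ENNReal.ofReal p) (timeMeasure T) := memLp_const x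
    -- test the weak limit of the images with the constant function `x`
    set Λ : StrongDual ℝ (Lp (StrongDual ℝ X) (ENNReal.ofReal q) (timeMeasure T)) :=
      ((ContinuousLinearMap.id ℝ (StrongDual ℝ X)).lpPairing (timeMeasure T) (ENNReal.ofReal q)
        (ENNReal.ofReal p)).flip hx.toLp with hΛ
    have hΛv : ∀ y, Λ y = ∫ t, y t x ∂(timeMeasure T) := by
      intro y
      rw [hΛ, ContinuousLinearMap.flip_apply, ContinuousLinearMap.lpPairing_eq_integral]
      refine integral_congr_ae ?_
      filter_upwards [hx.coeFn_toLp] with t ht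
      rw [ht]; rfl
    have h1 : Λ hFm.toLp = T * F m x := by
      rw [hΛv, integral_congr_ae (g := fun _ => F m x)]
      · simp [timeMeasure, hT.le]
      · filter_upwards [hFm.coeFn_toLp] with t ht
        rw [ht]
    have h2 : ∀ k, Λ (hM.toLp + (hrD k).toLp) = T * M x := by
      intro k
      have i1 : ∫ t, hM.toLp _ t x ∂(timeMeasure T) = ∫ _, M x ∂(timeMeasure T) := by
        refine integral_congr_ae ?_
        filter_upwards [hM.coeFn_toLp] with t ht
        rw [ht]
      have i2 : ∫ t, (hrD k).toLp _ t x ∂(timeMeasure T) =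
          ∫ t, rademacher T k t * D x ∂(timeMeasure T) := by
        refine integral_congr_ae ?_
        filter_upwards [(hrD k).coeFn_toLp] with t ht
        rw [ht]; rfl
      rw [map_add, hΛv, hΛv, i1, i2, integral_mul_const, integral_rademacher hT]
      simp [timeMeasure, hT.le]
    have h3 := h Λ
    simp only [h1, h2] at h3
    have h4 := tendsto_nhds_unique h3 tendsto_const_nhds
    exact mul_left_cancel₀ hT.ne' h4
  · filter_upwards [Lp.coeFn_add (hm.toLp) ((hre k).toLp), Lp.coeFn_add (hM.toLp) ((hrD k).toLp),
      hm.coeFn_toLp, (hre k).coeFn_toLp, hM.coeFn_toLp, (hrD k).coeFn_toLp] with t e1 e2 e3 e4 e5 e6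
    rw [e1, e2, Pi.add_apply, Pi.add_apply, e3, e4, e5, e6, hval]
  · filter_upwards [hm.coeFn_toLp, hFm.coeFn_toLp] with t e1 e2
    rw [e1, e2]
  · have h0 := tendsto_rademacher_weakly hT ENNReal.ofReal_ne_top e L
    have h1 := h0.const_add (L hm.toLp)
    simpa only [map_add, add_zero] using h1

end Affine

/-! ### The exponent of an affine gradient -/

section AffineStructure

variable {X : Type*} [NormedAddCommGroup X] [NormedSpace ℝ X]

/-- A continuous midpoint-affine map is affine: `u ↦ F u - F 0` is additive, hence real-linear. -/
theorem exists_continuousLinearMap_of_midpoint {Z : Type*} [NormedAddCommGroup Z] [NormedSpace ℝ Z]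
    {F : X → Z} (hF : Continuous F)
    (hmid : ∀ a b, F ((2 : ℝ)⁻¹ • (a + b)) = (2 : ℝ)⁻¹ • (F a + F b)) :
    ∃ A : X →L[ℝ] Z, ∀ u, F u = F 0 + A u := by
  set G : X → Z := fun u => F u - F 0 with hG
  have hhalf : ∀ a, G ((2 : ℝ)⁻¹ • a) = (2 : ℝ)⁻¹ • G a := fun a => by
    have h := hmid a 0
    rw [add_zero] at h
    simp only [hG, h]; module
  have hadd : ∀ a b, G (a + b) = G a + G b := fun a b => by
    have h1 := hhalf (a + b)
    have h2 : G ((2 : ℝ)⁻¹ • (a + b)) = (2 : ℝ)⁻¹ • (G a + G b) := by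
      simp only [hG, hmid]; module
    rw [h2] at h1
    exact (smul_right_injective Z (by norm_num : (2 : ℝ)⁻¹ ≠ 0) h1).symm
  let G' : X →+ Z := AddMonoidHom.mk' G hadd
  refine ⟨G'.toRealLinearMap (hF.sub continuous_const), fun u => ?_⟩
  change F u = F 0 + G u
  simp only [hG]; abel

variable {H : Type*} [NormedAddCommGroup H] [InnerProductSpace ℝ H]

/-- An affine gradient that satisfies the growth condition and is coercive has exponent `p = 2`,
unless the space is trivial: compare the two sides along a ray, at infinity and at zero. -/
theorem exponent_eq_two_or_subsingleton {i : X →L[ℝ] H} {F : X → StrongDual ℝ X}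
    {A : X →L[ℝ] StrongDual ℝ X} (hA : ∀ u, F u = F 0 + A u) {p C₀ C₁ C₂ : ℝ} (hp : 1 < p)
    (hC₁ : 0 < C₁) (hbound : ∀ u : X, ‖F u‖ ≤ C₀ * ‖u‖ ^ (p - 1) + C₀)
    (hcoercive : ∀ u : X, C₁ * ‖u‖ ^ p - C₂ * ‖i u‖ ^ 2 ≤ F u u) :
    p = 2 ∨ Subsingleton X := by
  -- coercivity along the ray through `u`
  have hray : ∀ (u : X) (s : ℝ), 0 < s →
      C₁ * ‖u‖ ^ p * s ^ p ≤ s ^ 2 * (C₂ * ‖i u‖ ^ 2 + A u u) + s * F 0 u := by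
    intro u s hs
    have h := hcoercive (s • u)
    rw [hA, map_smul, map_smul, norm_smul, norm_smul, Real.norm_of_nonneg hs.le,
      Real.mul_rpow hs.le (norm_nonneg _)] at h
    simp only [add_apply, smul_apply, map_smul,
      smul_eq_mul] at h
    nlinarith
  rcases lt_trichotomy p 2 with hp2 | hp2 | hp2
  · right
    -- for `p < 2` the growth condition forces `A = 0`, and coercivity fails near the origin
    have hA0 : ∀ u, A u = 0 := by
      intro u
      have hb : ∀ s : ℝ, 0 < s → ‖A u‖ ≤ C₀ * ‖u‖ ^ (p - 1) * s ^ (p - 2) + (C₀ + ‖F 0‖) * s⁻¹ := by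
        intro s hs
        have h := hbound (s • u)
        have h1 : s * ‖A u‖ ≤ ‖F (s • u)‖ + ‖F 0‖ := by
          have : A (s • u) = F (s • u) - F 0 := by rw [hA (s • u)]; abel
          rw [← Real.norm_of_nonneg hs.le, ← norm_smul, ← map_smul, Real.norm_of_nonneg hs.le, this]
          exact norm_sub_le _ _
        rw [norm_smul, Real.norm_of_nonneg hs.le, Real.mul_rpow hs.le (norm_nonneg _)] at h
        have h2 : s ^ (p - 1) = s ^ (p - 2) * s := by
          rw [show p - 1 = (p - 2) + 1 by ring, Real.rpow_add hs, Real.rpow_one]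
        rw [h2] at h
        have h3 : s * ‖A u‖ ≤ s * (C₀ * ‖u‖ ^ (p - 1) * s ^ (p - 2) + (C₀ + ‖F 0‖) * s⁻¹) := by
          calc _ ≤ C₀ * (s ^ (p - 2) * s * ‖u‖ ^ (p - 1)) + C₀ + ‖F 0‖ := by linarith
            _ = _ := by field_simp; ring
        exact le_of_mul_le_mul_left h3 hs
      have hlim : Tendsto (fun s : ℝ => C₀ * ‖u‖ ^ (p - 1) * s ^ (p - 2) + (C₀ + ‖F 0‖) * s⁻¹)
          atTop (𝓝 (C₀ * ‖u‖ ^ (p - 1) * 0 + (C₀ + ‖F 0‖) * 0)) := by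
        refine Tendsto.add (Tendsto.const_mul _ ?_) (Tendsto.const_mul _ tendsto_inv_atTop_zero)
        have := tendsto_rpow_neg_atTop (show 0 < 2 - p by linarith)
        simpa only [neg_sub] using this
      have h0 := ge_of_tendsto hlim ((eventually_gt_atTop 0).mono hb)
      simp only [mul_zero, add_zero] at h0
      exact norm_le_zero_iff.1 h0
    refine ⟨fun u v => ?_⟩
    suffices hz : ∀ u : X, F 0 u ≤ 0 → u = 0 by
      have hz' : ∀ u : X, u = 0 := fun u => by
        rcases le_total (F 0 u) 0 with h | h
        · exact hz u h
        · exact neg_eq_zero.1 (hz (-u) (by rw [map_neg]; linarith))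
      rw [hz' u, hz' v]
    intro u hu
    have hb : ∀ s : ℝ, 0 < s → C₁ * ‖u‖ ^ p ≤ s ^ (2 - p) * (C₂ * ‖i u‖ ^ 2) := by
      intro s hs
      have h := hray u s hs
      rw [hA0 u, zero_apply, add_zero] at h
      have hsp : 0 < s ^ p := Real.rpow_pos_of_pos hs p
      have h2 : s ^ 2 = s ^ (2 - p) * s ^ p := by
        rw [← Real.rpow_add hs, sub_add_cancel, Real.rpow_two]
      rw [h2] at h
      have : C₁ * ‖u‖ ^ p * s ^ p ≤ (s ^ (2 - p) * (C₂ * ‖i u‖ ^ 2)) * s ^ p := by nlinarith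
      exact le_of_mul_le_mul_right this hsp
    have hlim : Tendsto (fun s : ℝ => s ^ (2 - p) * (C₂ * ‖i u‖ ^ 2)) (𝓝[>] 0)
        (𝓝 (0 * (C₂ * ‖i u‖ ^ 2))) := by
      refine Tendsto.mul_const _ ?_
      have h := (Real.continuousAt_rpow_const 0 (2 - p) (Or.inr (by linarith))).tendsto
      rw [Real.zero_rpow (by linarith)] at h
      exact h.mono_left nhdsWithin_le_nhds
    have h0 := ge_of_tendsto hlim (eventually_mem_nhdsWithin.mono hb)
    rw [zero_mul] at h0
    by_contra hne
    have : 0 < C₁ * ‖u‖ ^ p := mul_pos hC₁ (Real.rpow_pos_of_pos (norm_pos_iff.2 hne) p)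
    linarith
  · exact Or.inl hp2
  · right
    -- for `p > 2` coercivity contradicts the quadratic growth of `⟨F u, u⟩` at infinity
    have hz : ∀ u : X, u = 0 := by
      intro u
      have hb : ∀ s : ℝ, 0 < s →
          C₁ * ‖u‖ ^ p ≤ s ^ (2 - p) * (C₂ * ‖i u‖ ^ 2 + A u u) + s ^ (1 - p) * F 0 u := by
        intro s hs
        have h := hray u s hs
        have hsp : 0 < s ^ p := Real.rpow_pos_of_pos hs p
        have h2 : s ^ 2 = s ^ (2 - p) * s ^ p := by
          rw [← Real.rpow_add hs, sub_add_cancel, Real.rpow_two]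
        have h1 : s = s ^ (1 - p) * s ^ p := by
          rw [← Real.rpow_add hs, sub_add_cancel, Real.rpow_one]
        have : C₁ * ‖u‖ ^ p * s ^ p ≤
            (s ^ (2 - p) * (C₂ * ‖i u‖ ^ 2 + A u u) + s ^ (1 - p) * F 0 u) * s ^ p := by
          calc _ ≤ s ^ 2 * (C₂ * ‖i u‖ ^ 2 + A u u) + s * F 0 u := h
            _ = s ^ (2 - p) * s ^ p * (C₂ * ‖i u‖ ^ 2 + A u u) + s ^ (1 - p) * s ^ p * F 0 u := by
              rw [← h2, ← h1]
            _ = _ := by ring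
        exact le_of_mul_le_mul_right this hsp
      have hlim : Tendsto (fun s : ℝ => s ^ (2 - p) * (C₂ * ‖i u‖ ^ 2 + A u u) + s ^ (1 - p) * F 0 u)
          atTop (𝓝 (0 * (C₂ * ‖i u‖ ^ 2 + A u u) + 0 * F 0 u)) := by
        refine Tendsto.add (Tendsto.mul_const _ ?_) (Tendsto.mul_const _ ?_)
        · have := tendsto_rpow_neg_atTop (show 0 < p - 2 by linarith)
          simpa only [neg_sub] using this
        · have := tendsto_rpow_neg_atTop (show 0 < p - 1 by linarith)
          simpa only [neg_sub] using this
      have h0 := ge_of_tendsto hlim ((eventually_gt_atTop 0).mono hb)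
      simp only [zero_mul, add_zero] at h0
      by_contra hne
      have : 0 < C₁ * ‖u‖ ^ p := mul_pos hC₁ (Real.rpow_pos_of_pos (norm_pos_iff.2 hne) p)
      linarith
    exact ⟨fun u v => by rw [hz u, hz v]⟩

end AffineStructure

/-! ### The spectral theorem for a coercive form on a Gelfand triple -/

section EigenBasis

variable {X H : Type*} [NormedAddCommGroup X] [NormedSpace ℝ X]
  [NormedAddCommGroup H] [InnerProductSpace ℝ H]

@[simp]
theorem toDual_apply (j : X →L[ℝ] H) (k : H) (v : X) : toDual j k v = inner ℝ k (j v) := rfl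

theorem toDual_injective {j : X →L[ℝ] H} (hj : DenseRange j) : Function.Injective (toDual j) := by
  intro a b hab
  have h : ∀ v, inner ℝ (a - b) (j v) = 0 := fun v => by
    rw [inner_sub_left, sub_eq_zero]
    exact DFunLike.congr_fun hab v
  have h2 : (fun y => inner ℝ (a - b) y) = fun _ => (0 : ℝ) :=
    hj.equalizer (by fun_prop) continuous_const (funext h)
  have h3 := congr_fun h2 (a - b)
  exact sub_eq_zero.1 (inner_self_eq_zero.1 h3)

/-- The embedding `K → V'` as a continuous linear map. -/
def toDualL (j : X →L[ℝ] H) : H →L[ℝ] StrongDual ℝ X :=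
  (ContinuousLinearMap.precomp ℝ j).comp (innerSL ℝ)

theorem toDualL_apply (j : X →L[ℝ] H) (k : H) : toDualL j k = toDual j k := rfl

/-- A Hilbert basis `b` of `H` that consists of eigenvectors `b k = i (x k)` of the operator
`A : X → X'`, `A (x k) = lam k • b k` in `X'`, where `⟨A u, u⟩ + C₂ ‖i u‖²` is coercive on `X` and
`A + C₂` maps `X` onto `X'`. -/
structure EigenBasis (i : X →L[ℝ] H) (A : X →L[ℝ] StrongDual ℝ X) (C₁ C₂ : ℝ) (ι : Type*) where
  /-- the Hilbert basis of `H` -/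
  b : HilbertBasis ι ℝ H
  /-- the basis vectors as elements of `X` -/
  x : ι → X
  /-- the eigenvalues -/
  lam : ι → ℝ
  i_x : ∀ k, i (x k) = b k
  A_x : ∀ k y, A (x k) y = lam k * inner ℝ (b k) (i y)
  symm : ∀ u v, A u v = A v u
  pos : ∀ k, 0 < lam k + C₂
  C₁_pos : 0 < C₁
  coercive : ∀ u, C₁ * ‖u‖ ^ 2 ≤ A u u + C₂ * ‖i u‖ ^ 2
  riesz : ∀ f : StrongDual ℝ X, ∃ z, ∀ y, f y = A z y + C₂ * inner ℝ (i z) (i y)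

/-- The balls of radius `1/2` around orthonormal vectors are disjoint. -/
theorem countable_of_orthonormal [TopologicalSpace.SeparableSpace H] {ι : Type*} {v : ι → H}
    (hv : Orthonormal ℝ v) : Countable ι := by
  have hd : Pairwise (Function.onFun Disjoint fun k => Metric.ball (v k) (1 / 2)) := by
    intro k l hkl
    refine Metric.ball_disjoint_ball ?_
    have h1 : ‖v k - v l‖ ^ 2 = 2 := by
      rw [@norm_sub_sq_real, hv.1, hv.1, hv.2 hkl]; norm_num
    rw [dist_eq_norm]
    nlinarith [norm_nonneg (v k - v l)]
  have := Set.PairwiseDisjoint.countable_of_isOpen (s := fun k => Metric.ball (v k) (1 / 2))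
    (a := univ) (fun k _ l _ hkl => hd hkl) (fun k _ => Metric.isOpen_ball)
    (fun k _ => ⟨v k, Metric.mem_ball_self (by norm_num)⟩)
  exact Set.countable_univ_iff.1 this

/-- The Lax-Milgram lemma on a reflexive space. -/
theorem surjective_of_coercive [CompleteSpace X] (hX : IsReflexive X) {B : X →L[ℝ] StrongDual ℝ X}
    {C : ℝ} (hC : 0 < C) (hB : ∀ u, C * ‖u‖ ^ 2 ≤ B u u) : Function.Surjective B := by
  have hlow : ∀ u, ‖u‖ ≤ (C.toNNReal⁻¹ : NNReal) * ‖B u‖ := by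
    intro u
    rw [NNReal.coe_inv, Real.coe_toNNReal C hC.le, inv_mul_eq_div, le_div_iff₀ hC]
    rcases (norm_nonneg u).eq_or_lt with h | h
    · rw [← h, zero_mul]; exact norm_nonneg _
    · have h1 := (hB u).trans ((le_abs_self _).trans ((B u).le_opNorm u))
      rw [sq, ← mul_assoc] at h1
      rw [mul_comm]
      exact le_of_mul_le_mul_right h1 h
  have hanti := B.antilipschitz_of_bound hlow
  have hclosed : IsClosed (range B) := hanti.isClosed_range B.uniformContinuous
  intro f
  by_contra hf
  have hf' : f ∉ (LinearMap.range (B : X →ₗ[ℝ] StrongDual ℝ X) : Set (StrongDual ℝ X)) := hf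
  -- otherwise some `g = ⟨·, z⟩` in the bidual vanishes on the closed range of `B` but not at `f`;
  -- then `⟨B z, z⟩ = 0` and `z = 0`
  obtain ⟨g, u, hg1, hg2⟩ := geometric_hahn_banach_closed_point
    (LinearMap.range (B : X →ₗ[ℝ] StrongDual ℝ X)).convex (by exact hclosed) hf'
  have hu : 0 < u := by
    have := hg1 0 (Submodule.zero_mem _)
    rwa [map_zero] at this
  have hg0 : ∀ y, g (B y) = 0 := by
    intro y
    by_contra hne
    have := hg1 (B ((u / g (B y)) • y)) ⟨_, rfl⟩
    rw [map_smul, map_smul, smul_eq_mul, div_mul_cancel₀ _ hne] at this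
    exact lt_irrefl _ this
  obtain ⟨z, rfl⟩ := hX g
  have h1 : B z z = 0 := hg0 z
  have h2 := hB z
  rw [h1] at h2
  have h3 : z = 0 := by
    by_contra hne
    have : 0 < C * ‖z‖ ^ 2 := by have := norm_pos_iff.2 hne; positivity
    linarith
  rw [h3, map_zero] at hg2
  simp at hg2
  linarith

/-- The spectral theorem for a symmetric operator `A : X → X'` that is coercive up to a multiple
of the norm of `H`, when the embedding `i : X → H` is compact: diagonalize the compact operator
`(A + C₂)⁻¹` of `H`. -/
theorem exists_eigenBasis.{u, v} {X : Type u} {H : Type v} [NormedAddCommGroup X]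
    [NormedSpace ℝ X] [NormedAddCommGroup H] [InnerProductSpace ℝ H] [CompleteSpace X]
    [CompleteSpace H] [TopologicalSpace.SeparableSpace H]
    (hX : IsReflexive X) {i : X →L[ℝ] H} (hi_dense : DenseRange i) (hi_compact : IsCompactOperator i)
    {A : X →L[ℝ] StrongDual ℝ X} (hA : ∀ u v, A u v = A v u) {C₁ C₂ : ℝ} (hC₁ : 0 < C₁)
    (hcoer : ∀ u, C₁ * ‖u‖ ^ 2 ≤ A u u + C₂ * ‖i u‖ ^ 2) :
    ∃ (ι : Type v) (_ : Countable ι), Nonempty (EigenBasis i A C₁ C₂ ι) := by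
  set B : X →L[ℝ] StrongDual ℝ X := A + C₂ • (toDualL i).comp i with hBdef
  have hBv : ∀ u v, B u v = A u v + C₂ * inner ℝ (i u) (i v) := fun u v => by
    simp [hBdef, toDualL_apply]
  have hBsymm : ∀ u v, B u v = B v u := fun u v => by
    rw [hBv, hBv, hA u v, real_inner_comm]
  have hBc : ∀ u, C₁ * ‖u‖ ^ 2 ≤ B u u := fun u => by
    rw [hBv, real_inner_self_eq_norm_sq]; exact hcoer u
  have hBz : ∀ z, B z z = 0 → z = 0 := by
    intro z hz
    have h := hBc z
    by_contra hne
    have : 0 < C₁ * ‖z‖ ^ 2 := by have := norm_pos_iff.2 hne; positivity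
    linarith
  have hBinj : Function.Injective B := by
    rw [injective_iff_map_eq_zero]
    intro z hz
    exact hBz z (by rw [hz]; rfl)
  have hBsurj := surjective_of_coercive hX hC₁ hBc
  let e : X ≃L[ℝ] StrongDual ℝ X := ContinuousLinearEquiv.ofBijective B
    (LinearMap.ker_eq_bot.2 hBinj) (LinearMap.range_eq_top.2 hBsurj)
  have he : ∀ f, B (e.symm f) = f := fun f =>
    ContinuousLinearEquiv.ofBijective_apply_symm_apply B _ _ f
  -- `S = i (A + C₂)⁻¹ i†` is compact, symmetric and injective
  let R : H →L[ℝ] X := (e.symm : StrongDual ℝ X →L[ℝ] X).comp (toDualL i)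
  have hR : ∀ h v, B (R h) v = inner ℝ h (i v) := fun h v => by
    change B (e.symm (toDualL i h)) v = _
    rw [he]; rfl
  let S : H →L[ℝ] H := i.comp R
  have hScomp : IsCompactOperator S := hi_compact.comp_clm R
  have hSsymm : (S : H →ₗ[ℝ] H).IsSymmetric := by
    intro h k
    change inner ℝ (i (R h)) k = inner ℝ h (i (R k))
    rw [real_inner_comm, ← hR k, ← hR h, hBsymm]
  have hSpos : ∀ h, inner ℝ (S h) h = 0 → h = 0 := by
    intro h hh
    have h1 : B (R h) (R h) = 0 := by rw [hR, real_inner_comm]; exact hh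
    have h2 := hBz _ h1
    refine toDual_injective hi_dense ?_
    ext v
    rw [toDual_apply, ← hR, h2]
    simp
  -- Hilbert bases of the eigenspaces of `S` form a Hilbert basis of `H`
  have hbot := ContinuousLinearMap.orthogonalComplement_iSup_eigenspaces_eq_bot hScomp hSsymm
  have hof := hSsymm.orthogonalFamily_eigenspaces
  let V : ℝ → Submodule ℝ H := fun μ => Module.End.eigenspace (S : Module.End ℝ H) μ
  have hVc : ∀ μ, IsClosed (V μ : Set H) := fun μ => by
    have : (V μ : Set H) = {h | S h = μ • h} := by
      ext h; exact Module.End.mem_eigenspace_iff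
    rw [this]
    exact isClosed_eq S.continuous (continuous_const_smul μ)
  have hVcomp : ∀ μ, CompleteSpace (V μ) := fun μ => (hVc μ).completeSpace_coe
  choose w bw hbw using fun μ => exists_hilbertBasis ℝ (V μ)
  let v : (Σ μ : ℝ, w μ) → H := fun a => ((bw a.1 a.2 : V a.1) : H)
  have hon : Orthonormal ℝ v := hof.orthonormal_sigma_orthonormal fun μ => (bw μ).orthonormal
  have hspan : (Submodule.span ℝ (range v))ᗮ = ⊥ := by
    rw [eq_bot_iff, ← hbot]
    intro y hy
    rw [Submodule.mem_orthogonal] at hy ⊢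
    have hy' : ∀ μ, ∀ z : V μ, inner ℝ (z : H) y = 0 := by
      intro μ z
      have hcl : (Submodule.span ℝ (range (bw μ))).topologicalClosure = ⊤ := (bw μ).dense_span
      have hz : z ∈ closure (Submodule.span ℝ (range (bw μ)) : Set (V μ)) := by
        have : z ∈ (Submodule.span ℝ (range (bw μ))).topologicalClosure := hcl ▸ Submodule.mem_top
        exact this
      refine closure_minimal (t := {z : V μ | inner ℝ (z : H) y = 0}) ?_
        (isClosed_eq (by fun_prop) continuous_const) hz
      intro z hz
      refine Submodule.span_induction (p := fun z _ => inner ℝ ((z : V μ) : H) y = 0) ?_ ?_ ?_ ?_ hz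
      · rintro _ ⟨k, rfl⟩
        exact hy _ (Submodule.subset_span ⟨⟨μ, k⟩, rfl⟩)
      · simp
      · intro a b _ _ ha hb
        rw [Submodule.coe_add, inner_add_left, ha, hb, add_zero]
      · intro c a _ ha
        rw [Submodule.coe_smul, inner_smul_left, ha, mul_zero]
    intro z hz
    refine Submodule.iSup_induction V (motive := fun z => inner ℝ z y = 0) hz
      (fun μ z hz => hy' μ ⟨z, hz⟩) (by simp) fun a b ha hb => ?_
    rw [inner_add_left, ha, hb, add_zero]
  let bas : HilbertBasis (Σ μ : ℝ, w μ) ℝ H := HilbertBasis.mkOfOrthogonalEqBot hon hspan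
  have hbas : ∀ k, bas k = v k := fun k => by
    rw [show (bas : _ → H) = v from HilbertBasis.coe_mkOfOrthogonalEqBot hon hspan]
  have heig : ∀ k, S (v k) = k.1 • v k := fun k =>
    Module.End.mem_eigenspace_iff.1 (bw k.1 k.2 : V k.1).2
  have hinner : ∀ k, inner ℝ (S (v k)) (v k) = k.1 := fun k => by
    rw [heig, real_inner_smul_left, real_inner_self_eq_norm_sq, hon.1 k]; norm_num
  have hμpos : ∀ k : (Σ μ : ℝ, w μ), 0 < k.1 := fun k => by
    have hnn : 0 ≤ inner ℝ (S (v k)) (v k) := by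
      have : inner ℝ (S (v k)) (v k) = B (R (v k)) (R (v k)) := by
        rw [hR, real_inner_comm]; rfl
      rw [this]
      exact le_trans (by positivity) (hBc _)
    rcases hnn.eq_or_lt with h | h
    · have := hSpos _ h.symm
      have h1 := hon.1 k
      rw [this, norm_zero] at h1
      norm_num at h1
    · rwa [hinner] at h
  -- `S v = μ v` means `A x + C₂ i x = μ⁻¹ v` for `x = μ⁻¹ (A + C₂)⁻¹ v`, and `i x = v`: the
  -- eigenvalue of `A` is `μ⁻¹ - C₂`
  refine ⟨Σ μ : ℝ, w μ, countable_of_orthonormal hon, ⟨{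
    b := bas
    x := fun k => k.1⁻¹ • R (v k)
    lam := fun k => k.1⁻¹ - C₂
    i_x := fun k => ?_
    A_x := fun k y => ?_
    symm := hA
    pos := fun k => by rw [sub_add_cancel]; exact inv_pos.2 (hμpos k)
    C₁_pos := hC₁
    coercive := hcoer
    riesz := fun f => ?_ }⟩⟩
  · rw [map_smul, hbas]
    change k.1⁻¹ • S (v k) = v k
    rw [heig, inv_smul_smul₀ (hμpos k).ne']
  · have h1 := hR (v k) y
    rw [hBv] at h1
    have h2 : i (R (v k)) = k.1 • v k := heig k
    rw [h2, real_inner_smul_left] at h1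
    rw [map_smul, smul_apply, smul_eq_mul, hbas]
    have h3 : k.1 ≠ 0 := (hμpos k).ne'
    have h4 : A (R (v k)) y = (1 - C₂ * k.1) * inner ℝ (v k) (i y) := by linarith
    rw [h4]; field_simp
  · obtain ⟨z, hz⟩ := hBsurj f
    exact ⟨z, fun y => by rw [← hz, hBv]⟩

end EigenBasis

/-! ### Superposition of modes -/

section Assemble

/-- Cauchy's criterion for a series whose finite partial sums satisfy a Bessel-type inequality. -/
theorem summable_of_norm_sq_sum_le {ι Z : Type*} [NormedAddCommGroup Z] [CompleteSpace Z]
    {z : ι → Z} {g : ι → ℝ} {C : ℝ} (hC : 0 < C) (hg : Summable g)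
    (h : ∀ F : Finset ι, C * ‖∑ k ∈ F, z k‖ ^ 2 ≤ ∑ k ∈ F, g k) :
    Summable z ∧ C * ‖∑' k, z k‖ ^ 2 ≤ ∑' k, g k := by
  have hs : Summable z := by
    rw [summable_iff_vanishing_norm] at hg ⊢
    intro ε hε
    obtain ⟨s, hs⟩ := hg (C * ε ^ 2) (by positivity)
    refine ⟨s, fun t ht => ?_⟩
    have h1 := (h t).trans_lt ((le_abs_self _).trans_lt (hs t ht))
    have h2 := lt_of_mul_lt_mul_left h1 hC.le
    exact lt_of_pow_lt_pow_left₀ 2 hε.le h2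
  refine ⟨hs, ?_⟩
  have h1 : Tendsto (fun F : Finset ι => C * ‖∑ k ∈ F, z k‖ ^ 2) atTop
      (𝓝 (C * ‖∑' k, z k‖ ^ 2)) := (hs.hasSum.norm.pow 2).const_mul C
  exact le_of_tendsto_of_tendsto' h1 hg.hasSum h

/-- Superposition of countably many time-dependent modes `r k` by operators `S k` that are
orthogonal in a weighted sense: square summability of the modes gives a function in `L²(0,T)`. -/
theorem memLp_two_tsum {ι R Z : Type*} [Countable ι] [NormedAddCommGroup R] [NormedSpace ℝ R]
    [NormedAddCommGroup Z] [NormedSpace ℝ Z] [CompleteSpace Z] {S : ι → R →L[ℝ] Z} {M : ι → ℝ}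
    (hM : ∀ k, 0 ≤ M k) {C : ℝ} (hC : 0 < C)
    (hS : ∀ (F : Finset ι) (y : ι → R), C * ‖∑ k ∈ F, S k (y k)‖ ^ 2 ≤ ∑ k ∈ F, M k * ‖y k‖ ^ 2)
    {T : ℝ} {r : ι → ℝ → R} (hr : ∀ k, MemLp (r k) 2 (timeMeasure T))
    (hsum : Summable fun k => M k * ∫ t, ‖r k t‖ ^ 2 ∂(timeMeasure T)) :
    (∀ᵐ t ∂(timeMeasure T), Summable fun k => S k (r k t)) ∧
      MemLp (fun t => ∑' k, S k (r k t)) 2 (timeMeasure T) := by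
  have hi : ∀ k, Integrable (fun t => M k * ‖r k t‖ ^ 2) (timeMeasure T) := fun k =>
    ((hr k).integrable_norm_pow (by norm_num)).const_mul _
  have hnn : ∀ k t, 0 ≤ M k * ‖r k t‖ ^ 2 := fun k t => mul_nonneg (hM k) (by positivity)
  -- by monotone convergence the sum of the squares is integrable, hence finite almost everywhere
  have hfin : ∫⁻ t, ∑' k, ENNReal.ofReal (M k * ‖r k t‖ ^ 2) ∂(timeMeasure T) ≠ ⊤ := by
    rw [lintegral_tsum fun k => (hi k).aestronglyMeasurable.aemeasurable.ennreal_ofReal]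
    have h1 : ∀ k, ∫⁻ t, ENNReal.ofReal (M k * ‖r k t‖ ^ 2) ∂(timeMeasure T) =
        ENNReal.ofReal (M k * ∫ t, ‖r k t‖ ^ 2 ∂(timeMeasure T)) := fun k => by
      rw [← ofReal_integral_eq_lintegral_ofReal (hi k) (Eventually.of_forall (hnn k)),
        integral_const_mul]
    simp only [h1]
    rw [← ENNReal.ofReal_tsum_of_nonneg
      (fun k => mul_nonneg (hM k) (integral_nonneg fun _ => by positivity)) hsum]
    exact ENNReal.ofReal_ne_top
  have hae : ∀ᵐ t ∂(timeMeasure T), Summable fun k => M k * ‖r k t‖ ^ 2 := by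
    have := ae_lt_top' (AEMeasurable.tsum
      fun k => (hi k).aestronglyMeasurable.aemeasurable.ennreal_ofReal) hfin
    filter_upwards [this] with t ht
    have h2 := ENNReal.summable_toReal ht.ne
    refine h2.congr fun k => ?_
    rw [ENNReal.toReal_ofReal (hnn k t)]
  have hall : ∀ᵐ t ∂(timeMeasure T), Summable fun k => S k (r k t) := by
    filter_upwards [hae] with t ht
    exact (summable_of_norm_sq_sum_le hC ht fun F => hS F fun k => r k t).1
  refine ⟨hall, ?_⟩
  have hmeas : AEStronglyMeasurable (fun t => ∑' k, S k (r k t)) (timeMeasure T) := by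
    refine aestronglyMeasurable_of_tendsto_ae (atTop : Filter (Finset ι))
      (f := fun F t => ∑ k ∈ F, S k (r k t)) (fun F => ?_) ?_
    · exact Finset.aestronglyMeasurable_fun_sum _ fun k _ =>
        (S k).continuous.comp_aestronglyMeasurable (hr k).aestronglyMeasurable
    · filter_upwards [hall] with t ht using ht.hasSum
  rw [memLp_two_iff_integrable_sq_norm hmeas]
  refine ⟨(hmeas.norm.pow 2), ?_⟩
  rw [hasFiniteIntegral_iff_ofReal (Eventually.of_forall fun t => by positivity)]
  have hle : ∀ᵐ t ∂(timeMeasure T), ENNReal.ofReal (‖∑' k, S k (r k t)‖ ^ 2) ≤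
      ENNReal.ofReal C⁻¹ * ∑' k, ENNReal.ofReal (M k * ‖r k t‖ ^ 2) := by
    filter_upwards [hae] with t ht
    rw [← ENNReal.ofReal_tsum_of_nonneg (fun k => hnn k t) ht, ← ENNReal.ofReal_mul (by positivity)]
    refine ENNReal.ofReal_le_ofReal ?_
    have h3 := (summable_of_norm_sq_sum_le hC ht fun F => hS F fun k => r k t).2
    rw [inv_mul_eq_div, le_div_iff₀ hC, mul_comm]
    exact h3
  refine (lintegral_mono_ae hle).trans_lt ?_
  rw [lintegral_const_mul' _ _ ENNReal.ofReal_ne_top]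
  exact ENNReal.mul_lt_top ENNReal.ofReal_lt_top (lt_top_iff_ne_top.2 hfin)

end Assemble

namespace EigenBasis

variable {X H : Type*} [NormedAddCommGroup X] [NormedSpace ℝ X]
  [NormedAddCommGroup H] [InnerProductSpace ℝ H] {i : X →L[ℝ] H} {A : X →L[ℝ] StrongDual ℝ X}
  {C₁ C₂ : ℝ} {ι : Type*} (e : EigenBasis i A C₁ C₂ ι)

theorem inner_b_sum (F : Finset ι) (y : ι → ℝ) {k : ι} (hk : k ∈ F) :
    inner ℝ (e.b k) (i (∑ l ∈ F, y l • e.x l)) = y k := by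
  rw [map_sum]
  simp only [map_smul, e.i_x]
  exact e.b.orthonormal.inner_right_sum y hk

/-- The energy norm of a finite combination of the eigenvectors is computed by orthogonality. -/
theorem norm_sum_le (F : Finset ι) (y : ι → ℝ) :
    C₁ * ‖∑ k ∈ F, y k • e.x k‖ ^ 2 ≤ ∑ k ∈ F, (e.lam k + C₂) * y k ^ 2 := by
  refine (e.coercive _).trans (le_of_eq ?_)
  set u := ∑ k ∈ F, y k • e.x k with hu
  have hA : ∀ w, A u w = ∑ k ∈ F, y k * (e.lam k * inner ℝ (e.b k) (i w)) := fun w => by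
    rw [hu, map_sum, sum_apply]
    exact Finset.sum_congr rfl fun k _ => by rw [map_smul, smul_apply, e.A_x, smul_eq_mul]
  have hI : ∀ w : H, inner ℝ (i u) w = ∑ k ∈ F, y k * inner ℝ (e.b k) w := fun w => by
    rw [hu, map_sum, sum_inner]
    exact Finset.sum_congr rfl fun k _ => by rw [map_smul, e.i_x, real_inner_smul_left]
  have h1 : A u u = ∑ k ∈ F, e.lam k * y k ^ 2 := by
    rw [hA]
    refine Finset.sum_congr rfl fun k hk => ?_
    rw [e.inner_b_sum F y hk]
    ring
  have h2 : ‖i u‖ ^ 2 = ∑ k ∈ F, y k ^ 2 := by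
    rw [← real_inner_self_eq_norm_sq, hI]
    refine Finset.sum_congr rfl fun k hk => ?_
    rw [e.inner_b_sum F y hk]
    ring
  rw [h1, h2, Finset.mul_sum, ← Finset.sum_add_distrib]
  exact Finset.sum_congr rfl fun k _ => by ring

theorem A_apply_x (u : X) (k : ι) : A u (e.x k) = e.lam k * inner ℝ (e.b k) (i u) := by
  rw [e.symm, e.A_x]

theorem exists_riesz_coeff (f : StrongDual ℝ X) :
    ∃ z, (∀ y, f y = A z y + C₂ * inner ℝ (i z) (i y)) ∧
      ∀ k, f (e.x k) = (e.lam k + C₂) * inner ℝ (e.b k) (i z) := by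
  obtain ⟨z, hz⟩ := e.riesz f
  refine ⟨z, hz, fun k => ?_⟩
  rw [hz, e.A_apply_x, e.i_x, real_inner_comm (e.b k)]
  ring

/-- A functional on `X` is determined by its values at the eigenvectors, although these are not
assumed to span a dense subspace of `X`: represent the difference by `A + C₂`. -/
theorem dual_ext (hi : Function.Injective i) {f g : StrongDual ℝ X}
    (h : ∀ k, f (e.x k) = g (e.x k)) : f = g := by
  obtain ⟨z, hz, hzk⟩ := e.exists_riesz_coeff (f - g)
  have h0 : ∀ k, inner ℝ (e.b k) (i z) = 0 := fun k => by
    have h1 := hzk k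
    rw [sub_apply, h k, sub_self] at h1
    rcases mul_eq_zero.1 h1.symm with h2 | h2
    · exact absurd h2 (e.pos k).ne'
    · exact h2
  have h2 : i z = 0 := by
    refine e.b.repr.injective ?_
    ext k
    rw [e.b.repr_apply_apply, h0, map_zero]; rfl
  have h3 : z = 0 := hi (by rw [h2, map_zero])
  rw [← sub_eq_zero]
  ext y
  rw [hz, h3]
  simp

/-- Bessel's inequality in the energy norm: the coefficients of a functional are square summable
with weights `1 / (lam k + C₂)`. -/
theorem summable_sq_div (f : StrongDual ℝ X) :
    Summable fun k => f (e.x k) ^ 2 / (e.lam k + C₂) := by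
  obtain ⟨z, hz, hzk⟩ := e.exists_riesz_coeff f
  refine summable_of_sum_le (c := A z z + C₂ * ‖i z‖ ^ 2)
    (fun k => div_nonneg (sq_nonneg _) (e.pos k).le) fun F => ?_
  set y : ι → ℝ := fun k => inner ℝ (e.b k) (i z) with hy
  set u := ∑ k ∈ F, y k • e.x k with hu
  have h1 : ∀ w, A u w + C₂ * inner ℝ (i u) (i w) =
      ∑ k ∈ F, (e.lam k + C₂) * (y k * inner ℝ (e.b k) (i w)) := by
    intro w
    rw [hu, map_sum, map_sum, sum_apply, sum_inner, Finset.mul_sum, ← Finset.sum_add_distrib]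
    refine Finset.sum_congr rfl fun k _ => ?_
    rw [map_smul, map_smul, smul_apply, e.A_x, e.i_x, real_inner_smul_left, smul_eq_mul]
    ring
  have h2 : ∑ k ∈ F, f (e.x k) ^ 2 / (e.lam k + C₂) = ∑ k ∈ F, (e.lam k + C₂) * (y k * y k) :=
    Finset.sum_congr rfl fun k _ => by
      have := (e.pos k).ne'
      rw [hzk]; field_simp; rw [hy]
  -- the energy of `z - u` is nonnegative, where `u` is the energy projection of `z` onto the span
  -- of the eigenvectors in `F`
  have h3 := e.coercive (z - u)
  have h4 := mul_nonneg e.C₁_pos.le (sq_nonneg ‖z - u‖)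
  have h5 := h1 z
  have h6 : A u u + C₂ * inner ℝ (i u) (i u) = ∑ k ∈ F, (e.lam k + C₂) * (y k * y k) := by
    rw [h1]
    refine Finset.sum_congr rfl fun k hk => ?_
    rw [hu, e.inner_b_sum F y hk]
  rw [h2]
  rw [← real_inner_self_eq_norm_sq (i (z - u))] at h3
  rw [← real_inner_self_eq_norm_sq (i z)]
  simp only [map_sub, sub_apply, inner_sub_left, inner_sub_right] at h3
  rw [e.symm z u, real_inner_comm (i u) (i z)] at h3
  have h7 : A u z + C₂ * inner ℝ (i u) (i z) = ∑ k ∈ F, (e.lam k + C₂) * (y k * y k) := h1 z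
  nlinarith [real_inner_comm (i u) (i z)]

end EigenBasis

section LpModes

variable {Ω : Type*} [MeasurableSpace Ω] {μ : Measure Ω}

theorem norm_sq_eq_integral {Y : Type*} [NormedAddCommGroup Y] (f : Lp Y 2 μ) :
    ‖f‖ ^ 2 = ∫ a, ‖f a‖ ^ 2 ∂μ := by
  rw [Lp.norm_def, (Lp.memLp f).eLpNorm_eq_integral_rpow_norm (by norm_num) (by norm_num),
    ENNReal.toReal_ofReal (Real.rpow_nonneg (integral_nonneg fun _ => by positivity) _)]
  simp only [ENNReal.toReal_ofNat, Real.rpow_two]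
  rw [← Real.rpow_natCast, ← Real.rpow_mul (integral_nonneg fun _ => by positivity)]
  norm_num

theorem integrable_norm_sq {Y : Type*} [NormedAddCommGroup Y] (f : Lp Y 2 μ) :
    Integrable (fun a => ‖f a‖ ^ 2) μ :=
  (Lp.memLp f).integrable_norm_pow (by norm_num)

/-- Multiplication of scalar functions by a fixed vector. -/
def smulVec {Y : Type*} [NormedAddCommGroup Y] [NormedSpace ℝ Y] (μ : Measure Ω) (y : Y) :
    Lp ℝ 2 μ →L[ℝ] Lp Y 2 μ :=
  (ContinuousLinearMap.toSpanSingleton ℝ y).compLpL 2 μ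

theorem coeFn_smulVec {Y : Type*} [NormedAddCommGroup Y] [NormedSpace ℝ Y] (y : Y)
    (f : Lp ℝ 2 μ) : smulVec μ y f =ᵐ[μ] fun a => f a • y :=
  ContinuousLinearMap.coeFn_compLp _ f

theorem coeFn_sum_smulVec {ι Y : Type*} [NormedAddCommGroup Y] [NormedSpace ℝ Y] (z : ι → Y)
    (f : ι → Lp ℝ 2 μ) (F : Finset ι) :
    (∑ k ∈ F, smulVec μ (z k) (f k) : Lp Y 2 μ) =ᵐ[μ] fun a => ∑ k ∈ F, f k a • z k := by
  classical
  induction F using Finset.induction_on with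
  | empty =>
    simp only [Finset.sum_empty]
    exact Lp.coeFn_zero _ _ _
  | insert k s hk ih =>
    rw [Finset.sum_insert hk]
    filter_upwards [Lp.coeFn_add (smulVec μ (z k) (f k)) (∑ k ∈ s, smulVec μ (z k) (f k)), ih,
      coeFn_smulVec (z k) (f k)] with a h1 h2 h3
    rw [h1, Pi.add_apply, h2, h3, Finset.sum_insert hk]

/-- A weighted orthogonality inequality in `Y` carries over to `L²(μ;Y)`. -/
theorem norm_sum_smulVec_le {ι Y : Type*} [NormedAddCommGroup Y] [NormedSpace ℝ Y] {z : ι → Y}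
    {M : ι → ℝ} {C : ℝ}
    (h : ∀ (F : Finset ι) (y : ι → ℝ), C * ‖∑ k ∈ F, y k • z k‖ ^ 2 ≤ ∑ k ∈ F, M k * y k ^ 2)
    (F : Finset ι) (f : ι → Lp ℝ 2 μ) :
    C * ‖∑ k ∈ F, smulVec μ (z k) (f k)‖ ^ 2 ≤ ∑ k ∈ F, M k * ‖f k‖ ^ 2 := by
  simp only [norm_sq_eq_integral, ← integral_const_mul]
  rw [← integral_finsetSum _ fun k _ => (integrable_norm_sq (f k)).const_mul _]
  refine integral_mono_ae ((integrable_norm_sq _).const_mul _)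
    (integrable_finsetSum _ fun k _ => (integrable_norm_sq (f k)).const_mul _) ?_
  filter_upwards [coeFn_sum_smulVec z f F] with a ha
  simp only [ha, Real.norm_eq_abs, sq_abs]
  exact h F fun k => f k a

end LpModes

/-! ### Scalar Volterra equations -/

section ScalarEquation

variable {α : ℝ}

/-- The Laplace transform `γ ^ (-α)` of `g_α` is small for large `γ`, so that convolution with
`Λ g_α` is a contraction in norms weighted by `e^{-γ t}`. -/
theorem exists_laplace_small (hα : 0 < α) (Λ : ℝ) :
    ∃ γ : ℝ, 0 < γ ∧ |Λ| * γ ^ (-α) ≤ 1 / 2 := by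
  refine ⟨(2 * |Λ| + 1) ^ (1 / α), by positivity, ?_⟩
  have h0 : (0 : ℝ) < 2 * |Λ| + 1 := by positivity
  rw [← Real.rpow_mul h0.le, show 1 / α * (-α) = -1 by field_simp, Real.rpow_neg_one,
    ← div_eq_mul_inv, div_le_iff₀ h0]
  linarith

theorem volterra_sub {k h h' : ℝ → ℝ} {t : ℝ} (ht : 0 ≤ t)
    (h1 : IntegrableOn (fun s => k (t - s) • h s) (Ioo 0 t))
    (h2 : IntegrableOn (fun s => k (t - s) • h' s) (Ioo 0 t)) :
    volterra k (fun s => h s - h' s) t = volterra k h t - volterra k h' t := by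
  simp only [volterra_eq_setIntegral _ _ ht]
  rw [← integral_sub h1 h2]
  simp only [smul_sub]

theorem integrable_exp_mul {h : ℝ → ℝ} {T : ℝ} (γ : ℝ) (hh : Integrable h (timeMeasure T)) :
    Integrable (fun s => Real.exp (-γ * s) * h s) (timeMeasure T) := by
  refine hh.bdd_mul (c := Real.exp (|γ| * T)) (by fun_prop) ?_
  refine (ae_restrict_mem measurableSet_Ioo).mono fun s hs => ?_
  rw [Real.norm_eq_abs, Real.abs_exp]
  refine Real.exp_le_exp.2 ((mul_le_mul_of_nonneg_right (neg_le_abs γ) hs.1.le).trans ?_)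
  exact mul_le_mul_of_nonneg_left hs.2.le (abs_nonneg _)

/-- Young's inequality in the exponentially weighted `L¹` norm. -/
theorem integral_exp_mul_volterra_gker_le (hα : 0 < α) {γ : ℝ} (hγ : 0 < γ) {h : ℝ → ℝ} {T : ℝ}
    (hh : Integrable h (timeMeasure T)) :
    ∫ t, ‖volterra (fun s => Real.exp (-γ * s) * gker α s) h t‖ ∂(timeMeasure T) ≤
      γ ^ (-α) * ∫ t, ‖h t‖ ∂(timeMeasure T) := by
  have hk := integrable_exp_mul γ (integrable_gker hα T)
  have hk0 : ∀ s ∈ Ioo 0 T, 0 ≤ Real.exp (-γ * s) * gker α s := fun s hs =>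
    mul_nonneg (Real.exp_pos _).le (gker_pos hα hs.1).le
  have h1 : ∀ᵐ t ∂(timeMeasure T), ‖volterra (fun s => Real.exp (-γ * s) * gker α s) h t‖ ≤
      volterra (fun s => Real.exp (-γ * s) * gker α s) (fun s => ‖h s‖) t := by
    refine (ae_restrict_mem measurableSet_Ioo).mono fun t ht => ?_
    refine (norm_volterra_le _ _ ht.1.le).trans (le_of_eq ?_)
    exact volterra_congr (Ioo_subset_Icc_self ht) (fun s hs => abs_of_nonneg (hk0 s hs))
      (Eventually.of_forall fun _ => rfl)
  refine (integral_mono_ae (integrable_volterra hk hh).norm (integrable_volterra hk hh.norm)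
    h1).trans ((integral_volterra_le hk hh.norm hk0 fun _ _ => norm_nonneg _).trans ?_)
  exact mul_le_mul_of_nonneg_right (setIntegral_exp_mul_gker_le hα hγ T)
    (integral_nonneg fun _ => norm_nonneg _)

/-- Uniqueness for the linear Volterra equation with kernel `g_α`. -/
theorem ae_eq_zero_of_volterra (hα : 0 < α) {T lam : ℝ} {y : ℝ → ℝ}
    (hy : Integrable y (timeMeasure T))
    (h : ∀ᵐ t ∂(timeMeasure T), y t = -(lam * volterra (gker α) y t)) :
    ∀ᵐ t ∂(timeMeasure T), y t = 0 := by
  obtain ⟨γ, hγ, hs⟩ := exists_laplace_small hα lam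
  set z : ℝ → ℝ := fun s => Real.exp (-γ * s) * y s with hz
  have hzi : Integrable z (timeMeasure T) := integrable_exp_mul γ hy
  have h1 : ∀ᵐ t ∂(timeMeasure T), ‖z t‖ =
      |lam| * ‖volterra (fun s => Real.exp (-γ * s) * gker α s) z t‖ := by
    filter_upwards [h] with t ht
    rw [← Real.norm_eq_abs, ← norm_mul, ← exp_mul_volterra]
    simp only [hz]
    rw [ht, ← norm_neg]
    congr 1
    ring
  have h2 := integral_exp_mul_volterra_gker_le hα hγ hzi
  have h3 := integral_congr_ae h1
  rw [integral_const_mul] at h3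
  have h0 : 0 ≤ ∫ t, ‖z t‖ ∂(timeMeasure T) := integral_nonneg fun _ => norm_nonneg _
  have h4 : ∫ t, ‖z t‖ ∂(timeMeasure T) = 0 := by
    have := mul_le_mul_of_nonneg_left h2 (abs_nonneg lam)
    nlinarith
  rw [integral_eq_zero_iff_of_nonneg (fun _ => norm_nonneg _) hzi.norm] at h4
  filter_upwards [h4] with t ht
  have : Real.exp (-γ * t) * y t = 0 := norm_eq_zero.1 ht
  exact (mul_eq_zero.1 this).resolve_left (Real.exp_pos _).ne'

/-- Solvability in `L¹(0,T)` of the linear Volterra equation with kernel `gker α`, by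
contraction in an exponentially weighted norm. -/
theorem exists_volterra_solution (hα : 0 < α) {T : ℝ} (lam : ℝ) {g : ℝ → ℝ}
    (hg : Integrable g (timeMeasure T)) :
    ∃ ρ : ℝ → ℝ, Integrable ρ (timeMeasure T) ∧
      ∀ᵐ t ∂(timeMeasure T), ρ t = g t - lam * volterra (gker α) ρ t := by
  obtain ⟨γ, hγ, hs⟩ := exists_laplace_small hα lam
  set k : ℝ → ℝ := fun s => Real.exp (-γ * s) * gker α s with hkdef
  have hk : Integrable k (timeMeasure T) := integrable_exp_mul γ (integrable_gker hα T)
  have hΦ : ∀ z : ℝ →₁[timeMeasure T] ℝ,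
      Integrable (fun t => Real.exp (-γ * t) * g t - lam * volterra k z t) (timeMeasure T) :=
    fun z => (integrable_exp_mul γ hg).sub
      ((integrable_volterra hk (L1.integrable_coeFn z)).const_mul lam)
  set Φ : (ℝ →₁[timeMeasure T] ℝ) → (ℝ →₁[timeMeasure T] ℝ) := fun z => (hΦ z).toL1 _ with hΦdef
  have hdist : ∀ z z', dist (Φ z) (Φ z') ≤ 1 / 2 * dist z z' := by
    intro z z'
    rw [_root_.dist_eq_norm_sub, _root_.dist_eq_norm_sub, L1.norm_eq_integral_norm,
      L1.norm_eq_integral_norm]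
    have hint := L1.integrable_coeFn (z - z')
    have h1 : ∀ᵐ t ∂(timeMeasure T), ‖(Φ z - Φ z') t‖ = |lam| * ‖volterra k (z - z') t‖ := by
      filter_upwards [Lp.coeFn_sub (Φ z) (Φ z'), (hΦ z).coeFn_toL1, (hΦ z').coeFn_toL1,
        ae_integrableOn_volterra hk (L1.integrable_coeFn z),
        ae_integrableOn_volterra hk (L1.integrable_coeFn z'),
        ae_restrict_mem measurableSet_Ioo] with t h1 h2 h3 h4 h5 ht
      rw [h1, Pi.sub_apply, h2, h3, volterra_congr (Ioo_subset_Icc_self ht) (fun _ _ => rfl)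
        (Lp.coeFn_sub z z')]
      have := volterra_sub ht.1.le h4 h5
      rw [show ((z : ℝ → ℝ) - (z' : ℝ → ℝ)) = fun s => z s - z' s from rfl, this,
        ← Real.norm_eq_abs, ← norm_mul, ← norm_neg]
      congr 1
      ring
    rw [integral_congr_ae h1, integral_const_mul]
    have h2 := integral_exp_mul_volterra_gker_le hα hγ hint
    have h0 : 0 ≤ ∫ t, ‖(z - z') t‖ ∂(timeMeasure T) := integral_nonneg fun _ => norm_nonneg _
    have := mul_le_mul_of_nonneg_left h2 (abs_nonneg lam)
    nlinarith
  have hc : ContractingWith (1 / 2) Φ := by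
    refine ⟨by norm_num, LipschitzWith.of_dist_le_mul fun z z' => ?_⟩
    simpa using hdist z z'
  have hfix := hc.fixedPoint_isFixedPt
  set z := hc.fixedPoint with hz
  have hz2 : ∀ᵐ t ∂(timeMeasure T), z t = Real.exp (-γ * t) * g t - lam * volterra k z t := by
    have h1 := (hΦ z).coeFn_toL1
    have h2 : (hΦ z).toL1 _ = z := hfix
    rw [h2] at h1
    exact h1
  have hexp : ∀ t : ℝ, Real.exp (γ * t) * Real.exp (-γ * t) = 1 := fun t => by
    rw [← Real.exp_add]; simp
  refine ⟨fun t => Real.exp (γ * t) * z t, ?_, ?_⟩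
  · simpa using integrable_exp_mul (-γ) (L1.integrable_coeFn z)
  · filter_upwards [hz2] with t ht
    have h1 := exp_mul_volterra γ (gker α) (fun t => Real.exp (γ * t) * z t) t
    have h2 : (fun s => Real.exp (-γ * s) * (Real.exp (γ * s) * z s)) = z := by
      ext s
      rw [← mul_assoc, mul_comm (Real.exp (-γ * s)), hexp, one_mul]
    rw [h2] at h1
    rw [ht, ← h1, mul_sub, ← mul_assoc, hexp]
    linear_combination (-lam * volterra (gker α) (fun t => Real.exp (γ * t) * z t) t) * hexp t

theorem integrable_of_continuous {Y : Type*} [NormedAddCommGroup Y] {f : ℝ → Y}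
    (hf : Continuous f) (T : ℝ) : Integrable f (timeMeasure T) :=
  (hf.integrableOn_Icc (a := 0) (b := T)).mono_set Ioo_subset_Icc_self

/-- An a priori bound, uniform for bounded `lam`. -/
theorem abs_le_of_volterra (hα : 0 < α) {T L γ : ℝ} (hγ : 0 < γ) (hs : |L| * γ ^ (-α) ≤ 1 / 2)
    {lam c : ℝ} (hlam : |lam| ≤ L) {f : ℝ → ℝ} (hf : Continuous f)
    (h : ∀ t ∈ Icc 0 T, f t = c - lam * volterra (gker α) f t) {t : ℝ} (ht : t ∈ Icc 0 T) :
    |f t| ≤ 2 * Real.exp (γ * T) * |c| := by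
  -- estimate the equation at a maximum point of `|e^{-γ t} f t|`
  obtain ⟨t₀, ht₀, hmax⟩ := (isCompact_Icc (a := (0 : ℝ)) (b := T)).exists_isMaxOn
    ⟨t, ht⟩ (f := fun s => |Real.exp (-γ * s) * f s|) (by fun_prop)
  set m := |Real.exp (-γ * t₀) * f t₀| with hm
  have hm0 : 0 ≤ m := abs_nonneg _
  have hmax' : ∀ s ∈ Icc 0 T, |Real.exp (-γ * s) * f s| ≤ m := fun s hs => hmax hs
  have hkint : IntegrableOn (fun s => Real.exp (-γ * s) * gker α s) (Ioo 0 t₀) :=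
    integrable_exp_mul (T := t₀) γ (integrable_gker hα t₀)
  have h1 : |volterra (fun s => Real.exp (-γ * s) * gker α s)
      (fun s => Real.exp (-γ * s) * f s) t₀| ≤ γ ^ (-α) * m := by
    refine (norm_volterra_le (Y := ℝ) _ _ ht₀.1).trans ?_
    have h2 : volterra (fun s => |Real.exp (-γ * s) * gker α s|)
        (fun s => ‖Real.exp (-γ * s) * f s‖) t₀ ≤
        volterra (fun s => Real.exp (-γ * s) * gker α s) (fun _ => m) t₀ := by
      rw [volterra_comm, volterra_comm (fun s => Real.exp (-γ * s) * gker α s),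
        volterra_eq_setIntegral _ _ ht₀.1, volterra_eq_setIntegral _ _ ht₀.1]
      refine integral_mono_of_nonneg (Eventually.of_forall fun s => by positivity)
        (hkint.const_mul m) ?_
      filter_upwards [ae_restrict_mem measurableSet_Ioo] with s hs
      simp only [smul_eq_mul]
      rw [abs_of_nonneg (mul_nonneg (Real.exp_pos _).le (gker_pos hα hs.1).le)]
      refine mul_le_mul_of_nonneg_right (hmax' _ ⟨by linarith [hs.2], by linarith [hs.1, ht₀.2]⟩)
        (mul_nonneg (Real.exp_pos _).le (gker_pos hα hs.1).le)
    refine h2.trans ?_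
    rw [volterra_comm, volterra_eq_setIntegral _ _ ht₀.1]
    simp only [smul_eq_mul]
    rw [integral_const_mul, mul_comm]
    exact mul_le_mul_of_nonneg_right (setIntegral_exp_mul_gker_le hα hγ t₀) hm0
  have h2 : m ≤ |c| + |lam| * (γ ^ (-α) * m) := by
    have hm2 : m = |Real.exp (-γ * t₀) * c - lam * volterra (fun s => Real.exp (-γ * s) * gker α s)
        (fun s => Real.exp (-γ * s) * f s) t₀| := by
      rw [← exp_mul_volterra, hm, h t₀ ht₀]
      congr 1
      ring
    refine hm2.le.trans ?_
    refine (abs_sub _ _).trans (add_le_add ?_ ?_)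
    · rw [abs_mul, Real.abs_exp]
      refine mul_le_of_le_one_left (abs_nonneg _) (Real.exp_le_one_iff.2 ?_)
      nlinarith [ht₀.1]
    · rw [abs_mul]
      exact mul_le_mul_of_nonneg_left h1 (abs_nonneg _)
  have hγ0 : 0 ≤ γ ^ (-α) := Real.rpow_nonneg hγ.le _
  have h3 : |lam| * γ ^ (-α) ≤ 1 / 2 :=
    (mul_le_mul_of_nonneg_right (hlam.trans (le_abs_self L)) hγ0).trans hs
  have h4 : m ≤ 2 * |c| := by nlinarith [mul_le_mul_of_nonneg_right h3 hm0]
  have h5 := hmax' t ht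
  rw [abs_mul, Real.abs_exp] at h5
  have h6 : |f t| = Real.exp (γ * t) * (Real.exp (-γ * t) * |f t|) := by
    rw [← mul_assoc, ← Real.exp_add]; simp
  rw [h6]
  calc Real.exp (γ * t) * (Real.exp (-γ * t) * |f t|) ≤ Real.exp (γ * T) * (2 * |c|) := by
        refine mul_le_mul (Real.exp_le_exp.2 (by nlinarith [ht.2])) (h5.trans h4) (by positivity)
          (by positivity)
    _ = _ := by ring

end ScalarEquation

section Primitives

/-- Integration by parts for merely integrable functions, from the fact that a Volterra convolution
commutes with the formation of primitives. -/
theorem integral_mul_primitive {y r : ℝ → ℝ} {t T : ℝ} (hy : Integrable y (timeMeasure T))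
    (hr : Integrable r (timeMeasure T)) (ht : t ∈ Icc 0 T) :
    ∫ s in (0 : ℝ)..t, y s * ∫ σ in (0 : ℝ)..s, r σ =
      (∫ s in (0 : ℝ)..t, y s) * (∫ s in (0 : ℝ)..t, r s) -
        ∫ s in (0 : ℝ)..t, (∫ σ in (0 : ℝ)..s, y σ) * r s := by
  have ht0 : t ∈ Icc 0 t := ⟨ht.1, le_rfl⟩
  have hyt : IntervalIntegrable y volume 0 t := intervalIntegrable_of_timeMeasure hy ht
  have hrt : IntervalIntegrable r volume 0 t := intervalIntegrable_of_timeMeasure hr ht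
  have hk : Integrable (fun s => y (t - s)) (timeMeasure t) := by
    have := (hyt.comp_sub_left t).symm
    rw [sub_zero, sub_self, intervalIntegrable_iff_integrableOn_Ioo_of_le ht.1] at this
    exact this
  have hh : Integrable r (timeMeasure t) :=
    (intervalIntegrable_iff_integrableOn_Ioo_of_le ht.1).1 hrt
  have h1 := (volterra_integral_right ht0 hk hh).trans (volterra_integral_left ht0 hk hh).symm
  simp only [volterra, sub_sub_cancel, smul_eq_mul] at h1
  rw [h1]
  have h2 : ∀ s ∈ Set.uIcc 0 t, (∫ σ in (0 : ℝ)..(t - s), y (t - σ)) * r s =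
      (∫ σ in (0 : ℝ)..t, y σ) * r s - (∫ σ in (0 : ℝ)..s, y σ) * r s := by
    intro s hs
    rw [uIcc_of_le ht.1] at hs
    rw [intervalIntegral.integral_comp_sub_left (fun x => y x), sub_zero, sub_sub_cancel,
      ← sub_mul]
    congr 1
    rw [intervalIntegral.integral_interval_sub_left hyt
      (hyt.mono_set (by rw [uIcc_of_le ht.1, uIcc_of_le hs.1]; exact Icc_subset_Icc_right hs.2))]
  have hcont : ContinuousOn (fun s => ∫ σ in (0 : ℝ)..s, y σ) (uIcc 0 t) :=
    intervalIntegral.continuousOn_primitive_interval' hyt left_mem_uIcc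
  rw [intervalIntegral.integral_congr h2, intervalIntegral.integral_sub (hrt.const_mul _)
    (hrt.continuousOn_mul hcont), intervalIntegral.integral_const_mul]

theorem integral_self_mul_primitive {r : ℝ → ℝ} {t T : ℝ} (hr : Integrable r (timeMeasure T))
    (ht : t ∈ Icc 0 T) :
    ∫ s in (0 : ℝ)..t, r s * ∫ σ in (0 : ℝ)..s, r σ = (∫ s in (0 : ℝ)..t, r s) ^ 2 / 2 := by
  have h1 := integral_mul_primitive hr hr ht
  simp only [mul_comm (∫ σ in (0 : ℝ).._, r σ) (r _)] at h1
  linarith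

end Primitives

/-! ### The weighted measures and the memory variables -/

section WeightedMeasures

variable {α : ℝ}

theorem ae_wMeasure_mem (α : ℝ) : ∀ᵐ θ ∂(wMeasure α), θ ∈ Ioo (0 : ℝ) 1 :=
  (withDensity_absolutelyContinuous _ _).ae_le (ae_restrict_mem measurableSet_Ioo)

theorem measurable_one_sub : Measurable fun θ : ℝ => ENNReal.ofReal (1 - θ) := by fun_prop

theorem ae_wMeasure_iff (hα₀ : 0 < α) (hα₁ : α < 1) {P : ℝ → Prop} :
    (∀ᵐ θ ∂(wMeasure α), P θ) ↔ ∀ᵐ θ ∂(volume.restrict (Ioo (0 : ℝ) 1)), P θ := by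
  refine ⟨fun h => ?_, fun h => (withDensity_absolutelyContinuous _ _).ae_le h⟩
  rw [wMeasure, ae_withDensity_iff (measurable_weight α).ennreal_ofReal] at h
  filter_upwards [h, ae_restrict_mem measurableSet_Ioo] with θ h1 h2
  exact h1 (ENNReal.ofReal_pos.2 (weight_pos hα₀ hα₁ h2)).ne'

theorem ae_wMeasure₀_iff (hα₀ : 0 < α) (hα₁ : α < 1) {P : ℝ → Prop} :
    (∀ᵐ θ ∂(wMeasure₀ α), P θ) ↔ ∀ᵐ θ ∂(wMeasure α), P θ := by
  rw [ae_wMeasure_iff hα₀ hα₁]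
  refine ⟨fun h => ?_, fun h => (withDensity_absolutelyContinuous _ _).ae_le h⟩
  rw [wMeasure₀, ae_withDensity_iff (show Measurable fun θ =>
    ENNReal.ofReal (weight α θ * (1 - θ)) from
      ((measurable_weight α).mul (by fun_prop)).ennreal_ofReal)] at h
  filter_upwards [h, ae_restrict_mem measurableSet_Ioo] with θ h1 h2
  exact h1 (ENNReal.ofReal_pos.2 (mul_pos (weight_pos hα₀ hα₁ h2) (by simpa using h2.2))).ne'

variable {Y : Type*} [NormedAddCommGroup Y] [NormedSpace ℝ Y]

theorem integral_wMeasure (hα₀ : 0 < α) (hα₁ : α < 1) (g : ℝ → Y) :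
    ∫ θ, g θ ∂(wMeasure α) = ∫ θ in Ioo (0 : ℝ) 1, weight α θ • g θ := by
  rw [wMeasure, integral_withDensity_eq_integral_toReal_smul (measurable_weight α).ennreal_ofReal
    (Eventually.of_forall fun _ => ENNReal.ofReal_lt_top)]
  refine setIntegral_congr_fun measurableSet_Ioo fun θ hθ => ?_
  simp only [ENNReal.toReal_ofReal (weight_pos hα₀ hα₁ hθ).le]

theorem integrable_wMeasure_iff (hα₀ : 0 < α) (hα₁ : α < 1) (g : ℝ → Y) :
    Integrable g (wMeasure α) ↔ IntegrableOn (fun θ => weight α θ • g θ) (Ioo 0 1) := by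
  rw [wMeasure, integrable_withDensity_iff_integrable_smul' (measurable_weight α).ennreal_ofReal
    (Eventually.of_forall fun _ => ENNReal.ofReal_lt_top)]
  refine integrable_congr ((ae_restrict_mem measurableSet_Ioo).mono fun θ hθ => ?_)
  simp only [ENNReal.toReal_ofReal (weight_pos hα₀ hα₁ hθ).le]

theorem wMeasure₀_eq (hα₀ : 0 < α) (hα₁ : α < 1) :
    wMeasure₀ α = (wMeasure α).withDensity fun θ => ENNReal.ofReal (1 - θ) := by
  rw [wMeasure, ← withDensity_mul _ (measurable_weight α).ennreal_ofReal measurable_one_sub,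
    wMeasure₀]
  refine withDensity_congr_ae ((ae_restrict_mem measurableSet_Ioo).mono fun θ hθ => ?_)
  simp only [Pi.mul_apply]
  rw [ENNReal.ofReal_mul (weight_pos hα₀ hα₁ hθ).le]

theorem integral_wMeasure₀ (hα₀ : 0 < α) (hα₁ : α < 1) (g : ℝ → Y) :
    ∫ θ, g θ ∂(wMeasure₀ α) = ∫ θ, (1 - θ) • g θ ∂(wMeasure α) := by
  rw [wMeasure₀_eq hα₀ hα₁, integral_withDensity_eq_integral_toReal_smul
    measurable_one_sub
    (Eventually.of_forall fun _ => ENNReal.ofReal_lt_top)]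
  refine integral_congr_ae ((ae_wMeasure_mem α).mono fun θ hθ => ?_)
  simp only [ENNReal.toReal_ofReal (sub_pos.2 hθ.2).le]

theorem isProbabilityMeasure_wMeasure (hα₀ : 0 < α) (hα₁ : α < 1) :
    IsProbabilityMeasure (wMeasure α) := by
  refine ⟨?_⟩
  rw [wMeasure, withDensity_apply _ MeasurableSet.univ, Measure.restrict_univ,
    ← ofReal_integral_eq_lintegral_ofReal (integrable_weight hα₀ hα₁)
      ((ae_restrict_mem measurableSet_Ioo).mono fun θ hθ => (weight_pos hα₀ hα₁ hθ).le),
    integral_weight hα₀ hα₁, ENNReal.ofReal_one]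

theorem isFiniteMeasure_wMeasure₀ (hα₀ : 0 < α) (hα₁ : α < 1) : IsFiniteMeasure (wMeasure₀ α) := by
  have := isProbabilityMeasure_wMeasure hα₀ hα₁
  refine ⟨(wMeasure₀_le α univ).trans_lt ?_⟩
  simp

theorem integral_expKer_wMeasure (hα₀ : 0 < α) (hα₁ : α < 1) {t : ℝ} (ht : 0 < t) :
    ∫ θ, expKer θ t ∂(wMeasure α) = gker α t := by
  rw [integral_wMeasure hα₀ hα₁, ← integral_weight_mul_expKer hα₀ hα₁ ht]
  rfl

theorem integrable_expKer_wMeasure (hα₀ : 0 < α) (hα₁ : α < 1) {t : ℝ} (ht : 0 < t) :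
    Integrable (fun θ => expKer θ t) (wMeasure α) :=
  (integrable_wMeasure_iff hα₀ hα₁ _).2 (integrable_weight_mul_expKer hα₀ hα₁ ht)

end WeightedMeasures

section Memory

variable {Y : Type*} [NormedAddCommGroup Y] [NormedSpace ℝ Y]

/-- The memory variable `c₀(θ) ∫_0^t e^{-c₁(θ)(t-s)} f(s) ds` generated by the force `f`. -/
def memory (f : ℝ → Y) (t θ : ℝ) : Y := volterra (expKer θ) f t

/-- The time derivative `c₀(θ) f - c₁(θ) memory f` of the memory variable. -/
def memoryRate (f : ℝ → Y) (t θ : ℝ) : Y := c₀ θ • (f t - θ • memory f t θ)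

theorem expKer_sub (θ t s : ℝ) :
    expKer θ (t - s) = c₀ θ * Real.exp (-(c₁ θ) * t) * Real.exp (c₁ θ * s) := by
  rw [expKer, mul_assoc, ← Real.exp_add]
  congr 2
  ring

theorem memory_eq (f : ℝ → Y) (t θ : ℝ) :
    memory f t θ = (c₀ θ * Real.exp (-(c₁ θ) * t)) •
      ∫ s in (0 : ℝ)..t, Real.exp (c₁ θ * s) • f s := by
  rw [memory, volterra, ← intervalIntegral.integral_smul]
  simp only [expKer_sub, mul_smul]

theorem continuous_memory_of_intervalIntegrable [CompleteSpace Y] {f : ℝ → Y}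
    (hf : ∀ a b, IntervalIntegrable f volume a b) (θ : ℝ) : Continuous fun t => memory f t θ := by
  simp only [memory_eq]
  have h2 := intervalIntegral.continuous_primitive (μ := volume)
    (f := fun s => Real.exp (c₁ θ * s) • f s)
    (fun a b => (hf a b).continuousOn_smul (by fun_prop)) 0
  fun_prop

theorem continuous_memory [CompleteSpace Y] {f : ℝ → Y} (hf : Continuous f) (θ : ℝ) :
    Continuous fun t => memory f t θ :=
  continuous_memory_of_intervalIntegrable (fun a b => hf.intervalIntegrable a b) θ

theorem continuous_memoryRate [CompleteSpace Y] {f : ℝ → Y} (hf : Continuous f) (θ : ℝ) :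
    Continuous fun t => memoryRate f t θ := by
  have := continuous_memory hf θ
  unfold memoryRate
  fun_prop

/-- The memory variable is the primitive of its rate. -/
theorem memory_eq_integral [CompleteSpace Y] {f : ℝ → Y} {t T : ℝ}
    (hf : Integrable f (timeMeasure T)) (ht : t ∈ Icc 0 T) (θ : ℝ) :
    memory f t θ = ∫ s in (0 : ℝ)..t, memoryRate f s θ := by
  have hk := integrable_expKer θ T
  have h1 : IntervalIntegrable f volume 0 t := intervalIntegrable_of_timeMeasure hf ht
  have h2 : IntervalIntegrable (volterra (expKer θ) f) volume 0 t :=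
    intervalIntegrable_of_timeMeasure (integrable_volterra hk hf) ht
  have h3 := volterra_integral_left ht hk hf
  -- the kernel `k = c₀ e^{-c₁ t}` satisfies `k = c₀ - c₁ ∫ k`; convolve this identity with `f`
  have h4 : ∀ s, s ∈ Ioo 0 T → expKer θ s = c₀ θ - c₁ θ * ∫ r in (0 : ℝ)..s, expKer θ r := by
    intro s _
    rw [← c₀_mul, mul_assoc, integral_expKer, expKer]
    ring
  have h5 : IntervalIntegrable (fun s => (∫ r in (0 : ℝ)..(t - s), expKer θ r) • f s)
      volume 0 t := by
    refine h1.continuousOn_smul (Continuous.continuousOn ?_)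
    exact (intervalIntegral.continuous_primitive (μ := volume)
      (fun a b => (continuous_expKer θ).intervalIntegrable a b) 0).comp (by fun_prop)
  rw [memory, volterra_congr ht h4 (Eventually.of_forall fun _ => rfl)]
  simp only [volterra, sub_smul, mul_smul]
  have h6 : ∀ c : ℝ, IntervalIntegrable (fun s => c • f s) volume 0 t := fun c => h1.smul c
  have h8 : IntervalIntegrable (fun s => c₁ θ • (∫ r in (0 : ℝ)..(t - s), expKer θ r) • f s)
      volume 0 t := h5.smul _
  rw [intervalIntegral.integral_sub (h6 _) h8, intervalIntegral.integral_smul,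
    intervalIntegral.integral_smul]
  simp only [volterra] at h3
  rw [h3]
  simp only [memoryRate, smul_sub, smul_smul, c₀_mul]
  have h7 : IntervalIntegrable (fun s => c₁ θ • memory f s θ) volume 0 t := h2.smul _
  rw [intervalIntegral.integral_sub (h6 _) h7, intervalIntegral.integral_smul,
    intervalIntegral.integral_smul]
  rfl

theorem one_sub_smul_memoryRate (f : ℝ → Y) (t : ℝ) {θ : ℝ} (hθ : θ ∈ Ioo (0 : ℝ) 1) :
    (1 - θ) • memoryRate f t θ = f t - θ • memory f t θ := by
  rw [memoryRate, smul_smul, one_sub_mul_c₀ hθ, one_smul]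

theorem norm_memory_le {f : ℝ → Y} {t T B : ℝ} (ht : t ∈ Icc 0 T)
    (hB : ∀ s ∈ Icc 0 T, ‖f s‖ ≤ B) {θ : ℝ} (hθ : θ ∈ Ioo (0 : ℝ) 1) :
    ‖memory f t θ‖ ≤ (2 + 2 * T) * B := by
  have hB0 : 0 ≤ B := (norm_nonneg _).trans (hB t ht)
  have h0 : volterra (fun _ => B) (expKer θ) t = B * ∫ s in (0 : ℝ)..t, expKer θ s := by
    simp only [volterra, smul_eq_mul]
    rw [intervalIntegral.integral_const_mul]
  have h1 : ‖memory f t θ‖ ≤ volterra (fun _ => B) (expKer θ) t := by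
    rw [volterra_comm, memory, volterra_eq_setIntegral _ _ ht.1, volterra_eq_setIntegral _ _ ht.1]
    refine norm_integral_le_of_norm_le ?_ ?_
    · have := ((continuous_expKer θ).comp (continuous_const.sub continuous_id)).integrableOn_Icc
        (μ := volume) (a := 0) (b := t) (f := fun s => expKer θ (t - s))
      exact (this.mono_set Ioo_subset_Icc_self).mul_const B
    · filter_upwards [ae_restrict_mem measurableSet_Ioo] with s hs
      rw [norm_smul, Real.norm_eq_abs, abs_of_pos (expKer_pos hθ _), smul_eq_mul]
      exact mul_le_mul_of_nonneg_left (hB s ⟨hs.1.le, hs.2.le.trans ht.2⟩) (expKer_pos hθ _).le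
  rw [h0] at h1
  refine h1.trans ?_
  rw [mul_comm]
  exact mul_le_mul_of_nonneg_right (integral_expKer_le hθ ht) hB0

/-- Averaging the memory variable against the weight gives the Riemann-Liouville integral. -/
theorem integral_memory_wMeasure [CompleteSpace Y] {α : ℝ} (hα₀ : 0 < α) (hα₁ : α < 1) {f : ℝ → Y}
    {t : ℝ} (ht : 0 ≤ t) (hf : AEStronglyMeasurable f (volume.restrict (Ioo 0 t)))
    (h : IntegrableOn (fun s => gker α (t - s) • f s) (Ioo 0 t)) :
    ∫ θ, memory f t θ ∂(wMeasure α) = volterra (gker α) f t := by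
  simp only [memory, volterra_eq_setIntegral _ _ ht]
  have hm : Measurable fun z : ℝ × ℝ => expKer z.1 (t - z.2) :=
    measurable_expKer.comp (measurable_fst.prodMk (measurable_const.sub measurable_snd))
  have := isProbabilityMeasure_wMeasure hα₀ hα₁
  -- Fubini, as `g_α` is the `w_α`-average of the exponential kernels
  have hmeas : AEStronglyMeasurable (Function.uncurry fun θ s => expKer θ (t - s) • f s)
      ((wMeasure α).prod (volume.restrict (Ioo 0 t))) :=
    hm.aestronglyMeasurable.smul hf.comp_snd
  have hint : Integrable (Function.uncurry fun θ s => expKer θ (t - s) • f s)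
      ((wMeasure α).prod (volume.restrict (Ioo 0 t))) := by
    rw [integrable_prod_iff' hmeas]
    refine ⟨?_, ?_⟩
    · filter_upwards [ae_restrict_mem measurableSet_Ioo] with s hs
      have h1 : Integrable (fun θ => expKer θ (t - s) • f s) (wMeasure α) :=
        (integrable_expKer_wMeasure hα₀ hα₁ (sub_pos.2 hs.2)).smul_const _
      exact h1
    · have h2 : Integrable (fun s => ‖gker α (t - s) • f s‖) (volume.restrict (Ioo 0 t)) :=
        Integrable.norm h
      refine h2.congr ?_
      filter_upwards [ae_restrict_mem measurableSet_Ioo] with s hs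
      have h1 := integral_expKer_wMeasure hα₀ hα₁ (sub_pos.2 hs.2)
      rw [norm_smul, Real.norm_eq_abs, abs_of_pos (gker_pos hα₀ (sub_pos.2 hs.2)), ← h1,
        ← integral_mul_const]
      refine integral_congr_ae ((ae_wMeasure_mem α).mono fun θ hθ => ?_)
      simp only [Function.uncurry]
      rw [norm_smul, Real.norm_eq_abs, abs_of_pos (expKer_pos hθ _)]
  rw [integral_integral_swap hint]
  refine setIntegral_congr_fun measurableSet_Ioo fun s hs => ?_
  have h1 := integral_expKer_wMeasure hα₀ hα₁ (sub_pos.2 hs.2)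
  simp only [integral_smul_const, h1]

theorem stronglyMeasurable_memory_of_intervalIntegrable [CompleteSpace Y] {f : ℝ → Y}
    (hm : StronglyMeasurable f) (hf : ∀ a b, IntervalIntegrable f volume a b) :
    StronglyMeasurable (Function.uncurry (memory f)) := by
  refine stronglyMeasurable_uncurry_of_continuous_of_stronglyMeasurable
    (fun θ => continuous_memory_of_intervalIntegrable hf θ) fun t => ?_
  have hk : Measurable fun z : ℝ × ℝ => expKer z.1 (t - z.2) :=
    measurable_expKer.comp (measurable_fst.prodMk (measurable_const.sub measurable_snd))
  have h1 : StronglyMeasurable (Function.uncurry fun θ s : ℝ => expKer θ (t - s) • f s) :=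
    hk.stronglyMeasurable.smul (hm.comp_measurable measurable_snd)
  have h2 : memory f t = fun θ => (∫ s in Ioc 0 t, expKer θ (t - s) • f s) -
      ∫ s in Ioc t 0, expKer θ (t - s) • f s := rfl
  rw [h2]
  exact h1.integral_prod_right.sub h1.integral_prod_right

theorem stronglyMeasurable_memory [CompleteSpace Y] {f : ℝ → Y} (hf : Continuous f) :
    StronglyMeasurable (Function.uncurry (memory f)) :=
  stronglyMeasurable_memory_of_intervalIntegrable hf.stronglyMeasurable
    fun a b => hf.intervalIntegrable a b

theorem stronglyMeasurable_memoryRate [CompleteSpace Y] {f : ℝ → Y} (hf : Continuous f) :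
    StronglyMeasurable (Function.uncurry (memoryRate f)) := by
  have h1 : Measurable fun z : ℝ × ℝ => c₀ z.2 := by unfold c₀; fun_prop
  exact h1.stronglyMeasurable.smul ((hf.stronglyMeasurable.comp_measurable measurable_fst).sub
    (measurable_snd.stronglyMeasurable.smul (stronglyMeasurable_memory hf)))

end Memory

/-! ### Energy identities for the memory variables -/

section ScalarEnergy

variable {α : ℝ}

theorem intervalIntegral_eq_timeMeasure {Y : Type*} [NormedAddCommGroup Y] [NormedSpace ℝ Y]
    (g : ℝ → Y) {t : ℝ} (ht : 0 ≤ t) :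
    ∫ s in (0 : ℝ)..t, g s = ∫ s, g s ∂(timeMeasure t) := by
  rw [intervalIntegral.integral_of_le ht, integral_Ioc_eq_integral_Ioo, timeMeasure]

theorem ae_timeMeasure_mem (T : ℝ) : ∀ᵐ t ∂(timeMeasure T), t ∈ Ioo 0 T :=
  ae_restrict_mem measurableSet_Ioo

theorem ae_prod_mem (hα₀ : 0 < α) (hα₁ : α < 1) (T : ℝ) :
    ∀ᵐ z ∂((timeMeasure T).prod (wMeasure α)), z.1 ∈ Ioo 0 T ∧ z.2 ∈ Ioo (0 : ℝ) 1 := by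
  have := isProbabilityMeasure_wMeasure hα₀ hα₁
  exact (Measure.quasiMeasurePreserving_fst.ae (ae_timeMeasure_mem T)).and
    (Measure.quasiMeasurePreserving_snd.ae (ae_wMeasure_mem α))

theorem integrable_mul_of_bounded (hα₀ : 0 < α) (hα₁ : α < 1) {T K : ℝ} {h : ℝ → ℝ}
    (hh : Integrable h (timeMeasure T)) {G : ℝ → ℝ → ℝ}
    (hG : StronglyMeasurable (Function.uncurry G))
    (hK : ∀ t ∈ Icc 0 T, ∀ θ ∈ Ioo (0 : ℝ) 1, |G t θ| ≤ K) :
    Integrable (fun z : ℝ × ℝ => h z.1 * G z.1 z.2) ((timeMeasure T).prod (wMeasure α)) := by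
  have := isProbabilityMeasure_wMeasure hα₀ hα₁
  refine (hh.comp_fst (wMeasure α)).mul_bdd (c := K) hG.aestronglyMeasurable ?_
  filter_upwards [ae_prod_mem hα₀ hα₁ T] with z hz
  exact hK z.1 (Ioo_subset_Icc_self hz.1) z.2 hz.2

theorem integrable_of_bounded (hα₀ : 0 < α) (hα₁ : α < 1) {K : ℝ} {g : ℝ → ℝ}
    (hg : StronglyMeasurable g) (hK : ∀ θ ∈ Ioo (0 : ℝ) 1, |g θ| ≤ K) :
    Integrable g (wMeasure α) := by
  have := isProbabilityMeasure_wMeasure hα₀ hα₁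
  exact Integrable.of_bound hg.aestronglyMeasurable K ((ae_wMeasure_mem α).mono hK)

theorem stronglyMeasurable_section {G : ℝ → ℝ → ℝ} (hG : StronglyMeasurable (Function.uncurry G))
    (t : ℝ) : StronglyMeasurable (G t) :=
  hG.comp_measurable measurable_prodMk_left

variable {T lam c : ℝ} {ρ f : ℝ → ℝ}

/-- Testing the memory equation with the memory variable. -/
theorem integral_mul_memory (hf : Continuous f) {t : ℝ} (ht : t ∈ Icc 0 T) {θ : ℝ}
    (hθ : θ ∈ Ioo (0 : ℝ) 1) :
    ∫ s in (0 : ℝ)..t, f s * memory f s θ =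
      (1 - θ) * memory f t θ ^ 2 / 2 + θ * ∫ s in (0 : ℝ)..t, memory f s θ ^ 2 := by
  have hc := continuous_memory hf θ
  have hd := continuous_memoryRate hf θ
  have h1 := integral_self_mul_primitive (integrable_of_continuous hd T) ht
  rw [← memory_eq_integral (integrable_of_continuous hf T) ht] at h1
  have h2 : ∫ s in (0 : ℝ)..t, memoryRate f s θ * memory f s θ = memory f t θ ^ 2 / 2 := by
    rw [← h1]
    refine intervalIntegral.integral_congr fun s hs => ?_
    rw [uIcc_of_le ht.1] at hs
    rw [memory_eq_integral (integrable_of_continuous hf T) ⟨hs.1, hs.2.trans ht.2⟩]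
  have h3 : ∀ s, f s * memory f s θ =
      (1 - θ) * (memoryRate f s θ * memory f s θ) + θ * memory f s θ ^ 2 := fun s => by
    have := one_sub_smul_memoryRate f s hθ
    simp only [smul_eq_mul] at this
    rw [← mul_assoc, this]
    ring
  simp only [h3]
  rw [intervalIntegral.integral_add (Continuous.intervalIntegrable (by fun_prop) _ _)
    (Continuous.intervalIntegrable (by fun_prop) _ _), intervalIntegral.integral_const_mul,
    intervalIntegral.integral_const_mul, h2]
  ring

/-- Testing the memory equation with the rate of the memory variable. -/
theorem integral_memoryRate_sq (hf : Continuous f) (hρ : Integrable ρ (timeMeasure T))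
    (hfρ : ∀ s ∈ Icc 0 T, f s = c - lam * ∫ r in (0 : ℝ)..s, ρ r) {t : ℝ} (ht : t ∈ Icc 0 T)
    {θ : ℝ} (hθ : θ ∈ Ioo (0 : ℝ) 1) :
    (1 - θ) * ∫ s in (0 : ℝ)..t, memoryRate f s θ ^ 2 =
      f t * memory f t θ + lam * (∫ s in (0 : ℝ)..t, ρ s * memory f s θ) -
        θ * memory f t θ ^ 2 / 2 := by
  have hc := continuous_memory hf θ
  have hd := continuous_memoryRate hf θ
  have hm : ∀ s ∈ Icc 0 t, memory f s θ = ∫ σ in (0 : ℝ)..s, memoryRate f σ θ := fun s hs =>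
    memory_eq_integral (integrable_of_continuous hf T) ⟨hs.1, hs.2.trans ht.2⟩ θ
  have hcongr : ∀ g : ℝ → ℝ → ℝ, ∫ s in (0 : ℝ)..t, g s (∫ σ in (0 : ℝ)..s, memoryRate f σ θ) =
      ∫ s in (0 : ℝ)..t, g s (memory f s θ) := fun g => by
    refine intervalIntegral.integral_congr fun s hs => ?_
    rw [uIcc_of_le ht.1] at hs
    rw [hm s hs]
  have h1 := integral_self_mul_primitive (integrable_of_continuous hd T) ht
  rw [hcongr (fun s y => memoryRate f s θ * y), ← hm t ⟨ht.1, le_rfl⟩] at h1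
  have h2 := integral_mul_primitive (integrable_of_continuous hd T) hρ ht
  rw [hcongr (fun s y => y * ρ s), ← hm t ⟨ht.1, le_rfl⟩] at h2
  have hcR : ContinuousOn (fun s => ∫ σ in (0 : ℝ)..s, ρ σ) (uIcc 0 t) :=
    intervalIntegral.continuousOn_primitive_interval' (intervalIntegrable_of_timeMeasure hρ ht)
      left_mem_uIcc
  have hi : IntervalIntegrable (fun s => lam * (memoryRate f s θ * ∫ σ in (0 : ℝ)..s, ρ σ))
      volume 0 t :=
    ContinuousOn.intervalIntegrable (continuousOn_const.mul (hd.continuousOn.mul hcR))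
  have hi' : IntervalIntegrable (fun s => c * memoryRate f s θ) volume 0 t :=
    (continuous_const.mul hd).intervalIntegrable _ _
  have h3 : ∫ s in (0 : ℝ)..t, memoryRate f s θ * f s =
      c * memory f t θ - lam * ∫ s in (0 : ℝ)..t, memoryRate f s θ * ∫ σ in (0 : ℝ)..s, ρ σ := by
    rw [hm t ⟨ht.1, le_rfl⟩, ← intervalIntegral.integral_const_mul,
      ← intervalIntegral.integral_const_mul, ← intervalIntegral.integral_sub hi' hi]
    refine intervalIntegral.integral_congr fun s hs => ?_
    rw [uIcc_of_le ht.1] at hs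
    rw [hfρ s ⟨hs.1, hs.2.trans ht.2⟩]
    ring
  have h4 : ∀ s, (1 - θ) * memoryRate f s θ ^ 2 =
      memoryRate f s θ * f s - θ * (memoryRate f s θ * memory f s θ) := fun s => by
    have := one_sub_smul_memoryRate f s hθ
    simp only [smul_eq_mul] at this
    rw [sq, ← mul_assoc, this]
    ring
  rw [← intervalIntegral.integral_const_mul]
  simp only [h4]
  rw [intervalIntegral.integral_sub (Continuous.intervalIntegrable (by fun_prop) _ _)
    (Continuous.intervalIntegrable (by fun_prop) _ _), intervalIntegral.integral_const_mul, h1, h3,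
    h2, hfρ t ht]
  have h5 : ∫ s in (0 : ℝ)..t, ρ s * memory f s θ = ∫ s in (0 : ℝ)..t, memory f s θ * ρ s := by
    simp only [mul_comm]
  rw [h5]
  ring

theorem abs_memory_sq_le {B : ℝ} (hB : ∀ s ∈ Icc 0 T, |f s| ≤ B) {t : ℝ} (ht : t ∈ Icc 0 T)
    {θ : ℝ} (hθ : θ ∈ Ioo (0 : ℝ) 1) : |memory f t θ ^ 2| ≤ ((2 + 2 * T) * B) ^ 2 := by
  rw [abs_pow]
  exact pow_le_pow_left₀ (abs_nonneg _) (norm_memory_le (f := f) ht hB hθ) 2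

theorem exists_bound (hf : Continuous f) (T : ℝ) : ∃ B, ∀ s ∈ Icc 0 T, |f s| ≤ B :=
  isCompact_Icc.exists_bound_of_continuousOn hf.continuousOn

theorem stronglyMeasurable_memory_sq (hf : Continuous f) :
    StronglyMeasurable (Function.uncurry fun t θ => memory f t θ ^ 2) :=
  (stronglyMeasurable_memory hf).pow 2

theorem integrable_memory_sq (hα₀ : 0 < α) (hα₁ : α < 1) (hf : Continuous f) {t : ℝ} (ht : 0 ≤ t) :
    Integrable (fun θ => memory f t θ ^ 2) (wMeasure α) := by
  obtain ⟨B, hB⟩ := exists_bound hf t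
  exact integrable_of_bounded hα₀ hα₁ (stronglyMeasurable_section (stronglyMeasurable_memory_sq hf) t)
    fun θ hθ => abs_memory_sq_le hB ⟨ht, le_rfl⟩ hθ

theorem integrable_id_mul {g : ℝ → ℝ} (hg : Integrable g (wMeasure α)) :
    Integrable (fun θ => θ * g θ) (wMeasure α) := by
  refine hg.bdd_mul (c := 1) continuous_id.aestronglyMeasurable
    ((ae_wMeasure_mem α).mono fun θ hθ => ?_)
  rw [Real.norm_eq_abs, abs_of_pos hθ.1]
  exact hθ.2.le

theorem integrable_one_sub_mul {g : ℝ → ℝ} (hg : Integrable g (wMeasure α)) :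
    Integrable (fun θ => (1 - θ) * g θ) (wMeasure α) :=
  (hg.sub (integrable_id_mul hg)).congr (Eventually.of_forall fun θ => by
    simp only [Pi.sub_apply]; ring)

theorem integrable_memory_sq_prod (hα₀ : 0 < α) (hα₁ : α < 1) (hf : Continuous f) (T : ℝ) :
    Integrable (fun z : ℝ × ℝ => memory f z.1 z.2 ^ 2) ((timeMeasure T).prod (wMeasure α)) := by
  obtain ⟨B, hB⟩ := exists_bound hf T
  have := integrable_mul_of_bounded hα₀ hα₁ (integrable_const_timeMeasure T (1 : ℝ))
    (stronglyMeasurable_memory_sq hf) fun t ht θ hθ => abs_memory_sq_le hB ht hθ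
  simpa only [one_mul] using this

/-- Averaging a product with the memory variable. -/
theorem integral_integral_mul_memory (hα₀ : 0 < α) (hα₁ : α < 1) (hf : Continuous f) {h : ℝ → ℝ}
    {t : ℝ} (ht : 0 ≤ t) (hh : Integrable h (timeMeasure t)) :
    Integrable (fun θ => ∫ s in (0 : ℝ)..t, h s * memory f s θ) (wMeasure α) ∧
    ∫ θ, (∫ s in (0 : ℝ)..t, h s * memory f s θ) ∂(wMeasure α) =
      ∫ s in (0 : ℝ)..t, h s * ∫ θ, memory f s θ ∂(wMeasure α) := by
  have := isProbabilityMeasure_wMeasure hα₀ hα₁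
  obtain ⟨B, hB⟩ := exists_bound hf t
  have h1 := integrable_mul_of_bounded hα₀ hα₁ hh (stronglyMeasurable_memory hf)
    fun s hs θ hθ => norm_memory_le (f := f) hs hB hθ
  simp only [intervalIntegral_eq_timeMeasure _ ht]
  refine ⟨h1.integral_prod_right, ?_⟩
  rw [← integral_integral_swap h1]
  simp only [integral_const_mul]

theorem integrableOn_gker_mul (hα₀ : 0 < α) (hf : Continuous f) {t : ℝ} (ht : 0 ≤ t) :
    IntegrableOn (fun s => gker α (t - s) • f s) (Ioo 0 t) := by
  obtain ⟨B, hB⟩ := exists_bound hf t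
  have h1 : IntervalIntegrable (gker α) volume 0 t :=
    intervalIntegrable_of_timeMeasure (integrable_gker hα₀ t) ⟨ht, le_rfl⟩
  have h2 := (h1.comp_sub_left t).symm
  rw [sub_zero, sub_self, intervalIntegrable_iff_integrableOn_Ioo_of_le ht] at h2
  refine Integrable.mul_bdd (c := B) h2 hf.aestronglyMeasurable ?_
  exact (ae_restrict_mem measurableSet_Ioo).mono fun s hs => hB s (Ioo_subset_Icc_self hs)

theorem integral_memory_of_continuous (hα₀ : 0 < α) (hα₁ : α < 1) (hf : Continuous f) {t : ℝ}
    (ht : 0 ≤ t) : ∫ θ, memory f t θ ∂(wMeasure α) = volterra (gker α) f t :=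
  integral_memory_wMeasure hα₀ hα₁ ht hf.aestronglyMeasurable (integrableOn_gker_mul hα₀ hf ht)

/-- The first energy identity: the `w_α`-average of the memory equation
`(1 - θ) ∂_t v + θ v = f` tested with `v`. -/
theorem energy_memory (hα₀ : 0 < α) (hα₁ : α < 1) (hf : Continuous f) {t : ℝ} (ht : 0 ≤ t) :
    (∫ θ, (1 - θ) * memory f t θ ^ 2 ∂(wMeasure α)) / 2 +
      ∫ θ, (θ * ∫ s in (0 : ℝ)..t, memory f s θ ^ 2) ∂(wMeasure α) =
    ∫ s in (0 : ℝ)..t, f s * volterra (gker α) f s := by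
  have := isProbabilityMeasure_wMeasure hα₀ hα₁
  obtain ⟨h1, h2⟩ := integral_integral_mul_memory hα₀ hα₁ hf ht (integrable_of_continuous hf t)
  have h3 : ∫ s in (0 : ℝ)..t, f s * volterra (gker α) f s =
      ∫ s in (0 : ℝ)..t, f s * ∫ θ, memory f s θ ∂(wMeasure α) := by
    refine intervalIntegral.integral_congr fun s hs => ?_
    rw [uIcc_of_le ht] at hs
    rw [integral_memory_of_continuous hα₀ hα₁ hf hs.1]
  have h4 : ∫ θ, (∫ s in (0 : ℝ)..t, f s * memory f s θ) ∂(wMeasure α) =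
      ∫ θ, ((1 - θ) * memory f t θ ^ 2 / 2 + θ * ∫ s in (0 : ℝ)..t, memory f s θ ^ 2)
        ∂(wMeasure α) :=
    integral_congr_ae ((ae_wMeasure_mem α).mono fun θ hθ =>
      integral_mul_memory hf ⟨ht, le_rfl⟩ hθ)
  have h5 := integrable_one_sub_mul (integrable_memory_sq hα₀ hα₁ hf ht)
  have h6 : Integrable (fun θ => ∫ s in (0 : ℝ)..t, memory f s θ ^ 2) (wMeasure α) := by
    simp only [intervalIntegral_eq_timeMeasure _ ht]
    exact (integrable_memory_sq_prod hα₀ hα₁ hf t).integral_prod_right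
  have h7 := integrable_id_mul h6
  rw [h3, ← h2, h4, integral_add (h5.div_const 2) h7, integral_div]

/-- The second energy identity: the `w_α`-average of the memory equation tested with `∂_t v`, where
`f = c - lam (g_α * f)` and `ρ` is the derivative of `g_α * f`. -/
theorem energy_memoryRate (hα₀ : 0 < α) (hα₁ : α < 1) (hf : Continuous f)
    (hρ : Integrable ρ (timeMeasure T))
    (hfρ : ∀ s ∈ Icc 0 T, f s = c - lam * ∫ r in (0 : ℝ)..s, ρ r)
    (hR : ∀ s ∈ Icc 0 T, volterra (gker α) f s = ∫ r in (0 : ℝ)..s, ρ r) {t : ℝ}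
    (ht : t ∈ Icc 0 T) :
    Integrable (fun θ => (1 - θ) * ∫ s in (0 : ℝ)..t, memoryRate f s θ ^ 2) (wMeasure α) ∧
    (∫ θ, ((1 - θ) * ∫ s in (0 : ℝ)..t, memoryRate f s θ ^ 2) ∂(wMeasure α)) +
      (∫ θ, θ * memory f t θ ^ 2 ∂(wMeasure α)) / 2 =
    f t * volterra (gker α) f t + lam * volterra (gker α) f t ^ 2 / 2 := by
  have := isProbabilityMeasure_wMeasure hα₀ hα₁
  have hρt : Integrable ρ (timeMeasure t) := hρ.mono_measure
    (Measure.restrict_mono_set _ (Ioo_subset_Ioo_right ht.2))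
  obtain ⟨h1, h2⟩ := integral_integral_mul_memory hα₀ hα₁ hf ht.1 hρt
  have h3 : ∫ s in (0 : ℝ)..t, ρ s * ∫ θ, memory f s θ ∂(wMeasure α) =
      volterra (gker α) f t ^ 2 / 2 := by
    rw [hR t ht, ← integral_self_mul_primitive hρ ht]
    refine intervalIntegral.integral_congr fun s hs => ?_
    rw [uIcc_of_le ht.1] at hs
    rw [integral_memory_of_continuous hα₀ hα₁ hf hs.1, hR s ⟨hs.1, hs.2.trans ht.2⟩]
  obtain ⟨B, hB⟩ := exists_bound hf t
  have h4 : Integrable (fun θ => memory f t θ) (wMeasure α) :=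
    integrable_of_bounded hα₀ hα₁ (stronglyMeasurable_section (stronglyMeasurable_memory hf) t)
      fun θ hθ => norm_memory_le (f := f) ⟨ht.1, le_rfl⟩ hB hθ
  have h5 := integrable_id_mul (integrable_memory_sq hα₀ hα₁ hf ht.1)
  have h6 : (fun θ => (1 - θ) * ∫ s in (0 : ℝ)..t, memoryRate f s θ ^ 2) =ᵐ[wMeasure α]
      fun θ => f t * memory f t θ + lam * (∫ s in (0 : ℝ)..t, ρ s * memory f s θ) -
        θ * memory f t θ ^ 2 / 2 :=
    (ae_wMeasure_mem α).mono fun θ hθ => integral_memoryRate_sq hf hρ hfρ ht hθ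
  have h7 : Integrable (fun θ => f t * memory f t θ +
      lam * ∫ s in (0 : ℝ)..t, ρ s * memory f s θ) (wMeasure α) :=
    (h4.const_mul (f t)).add (h1.const_mul lam)
  refine ⟨(h7.sub (h5.div_const 2)).congr h6.symm, ?_⟩
  rw [integral_congr_ae h6, integral_sub h7 (h5.div_const 2), integral_div]
  rw [integral_add (h4.const_mul (f t)) (h1.const_mul lam), integral_const_mul,
    integral_const_mul, h2, h3, integral_memory_of_continuous hα₀ hα₁ hf ht.1]
  ring

end ScalarEnergy

/-! ### Bounds for the modes, uniform in the eigenvalue -/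

section ScalarEstimates

variable {α T : ℝ}

/-- A continuous solution of `f = c - lam (g_α * f)`, obtained from an integrable solution `ρ` of
`ρ = c g_α - lam (g_α * ρ)`, the equation for the derivative of `g_α * f`. -/
theorem exists_continuous_solution (hα₀ : 0 < α) (T lam c : ℝ) :
    ∃ f ρ : ℝ → ℝ, Continuous f ∧ Integrable ρ (timeMeasure T) ∧
      (∀ s ∈ Icc 0 T, f s = c - lam * ∫ r in (0 : ℝ)..s, ρ r) ∧
      ∀ s ∈ Icc 0 T, volterra (gker α) f s = ∫ r in (0 : ℝ)..s, ρ r := by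
  have hg := integrable_gker hα₀ T
  obtain ⟨ρ, hρ, h⟩ := exists_volterra_solution hα₀ lam (hg.const_mul c)
  set ρ' := (Ioo 0 T).indicator ρ with hρ'
  have hρ'i : Integrable ρ' := integrable_indicator_Ioo hρ
  have hcont : Continuous fun s => ∫ r in (0 : ℝ)..s, ρ' r :=
    intervalIntegral.continuous_primitive (fun a b => hρ'i.intervalIntegrable) 0
  refine ⟨fun s => c - lam * ∫ r in (0 : ℝ)..s, ρ' r, ρ', by fun_prop, hρ'i.restrict,
    fun _ _ => rfl, fun t ht => ?_⟩
  have h2 : ∀ᵐ s ∂(timeMeasure T), ρ' s = c * gker α s - lam * volterra (gker α) ρ' s := by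
    filter_upwards [h, ae_timeMeasure_mem T] with s hs hsT
    have h3 : ∀ᵐ r ∂(timeMeasure T), ρ r = ρ' r := (ae_timeMeasure_mem T).mono fun r hr => by
      rw [hρ', indicator_of_mem hr]
    rw [← volterra_congr (Ioo_subset_Icc_self hsT) (fun _ _ => rfl) h3, ← hs, hρ',
      indicator_of_mem hsT]
  have h4 : IntegrableOn (fun s => gker α (t - s) • c) (Ioo 0 t) :=
    integrableOn_gker_mul hα₀ continuous_const ht.1
  have h5 : IntegrableOn (fun s => gker α (t - s) • (lam * ∫ r in (0 : ℝ)..s, ρ' r)) (Ioo 0 t) :=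
    integrableOn_gker_mul hα₀ (continuous_const.mul hcont) ht.1
  rw [volterra_sub ht.1 h4 h5, volterra_comm]
  have h6 : volterra (gker α) (fun s => lam * ∫ r in (0 : ℝ)..s, ρ' r) t =
      lam * ∫ s in (0 : ℝ)..t, volterra (gker α) ρ' s := by
    rw [← volterra_integral_right ht hg hρ'i.restrict]
    simp only [volterra, smul_eq_mul, mul_left_comm _ lam]
    rw [intervalIntegral.integral_const_mul]
  have h7 : volterra (fun _ => c) (gker α) t = c * ∫ s in (0 : ℝ)..t, gker α s := by
    simp only [volterra, smul_eq_mul]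
    rw [intervalIntegral.integral_const_mul]
  rw [h6, h7, ← intervalIntegral.integral_const_mul, ← intervalIntegral.integral_const_mul,
    ← intervalIntegral.integral_sub
      ((intervalIntegrable_of_timeMeasure hg ht).const_mul c)
      ((intervalIntegrable_of_timeMeasure (integrable_volterra hg hρ'i.restrict) ht).const_mul lam)]
  rw [intervalIntegral_eq_timeMeasure _ ht.1, intervalIntegral_eq_timeMeasure _ ht.1]
  refine integral_congr_ae ?_
  have h8 : ∀ᵐ s ∂(timeMeasure t), ρ' s = c * gker α s - lam * volterra (gker α) ρ' s :=
    ae_mono (Measure.restrict_mono_set volume (Ioo_subset_Ioo_right ht.2)) h2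
  exact h8.mono fun s hs => hs.symm

/-- Convolution with `g_{1-α}` inverts that with `g_α` up to one integration, as
`g_{1-α} * g_α = 1`. -/
theorem integral_eq_volterra_gker (hα₀ : 0 < α) (hα₁ : α < 1) {Y : Type*} [NormedAddCommGroup Y]
    [NormedSpace ℝ Y] [CompleteSpace Y] {f : ℝ → Y} {t : ℝ}
    (ht : t ∈ Icc 0 T) (hf : Integrable f (timeMeasure T)) :
    volterra (gker (1 - α)) (volterra (gker α) f) t = ∫ s in (0 : ℝ)..t, f s := by
  have h1 : 0 < 1 - α := by linarith
  have h2 : ∀ s ∈ Ioo 0 T, volterra (gker (1 - α)) (gker α) s = 1 := fun s hs => by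
    rw [volterra_gker_gker h1 hα₀ hs.1, sub_add_cancel, gker_one]
  have h3 : ∀ s ∈ Ioo 0 T, volterra (fun r => |gker (1 - α) r|) (fun r => |gker α r|) s ≤ 1 := by
    intro s hs
    refine le_of_eq ((?_ : _ = volterra (gker (1 - α)) (gker α) s).trans (h2 s hs))
    refine (volterra_congr (T := s) ⟨hs.1.le, le_rfl⟩
      (fun r hr => abs_of_pos (gker_pos h1 hr.1)) ((ae_timeMeasure_mem s).mono fun r hr =>
      abs_of_pos (gker_pos hα₀ hr.1)))
  rw [volterra_assoc ht (integrable_gker h1 T) (integrable_gker hα₀ T) hf h3,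
    volterra_congr ht h2 (Eventually.of_forall fun _ => rfl), volterra_one]

theorem abs_volterra_gker_le {β : ℝ} (hβ : 0 < β) {h : ℝ → ℝ} {B t : ℝ} (ht : t ∈ Icc 0 T)
    (hB : ∀ s ∈ Icc 0 T, |h s| ≤ B) :
    |volterra (gker β) h t| ≤ B * ∫ s, gker β s ∂(timeMeasure T) := by
  have hg := integrable_gker hβ T
  have hgt := integrable_gker hβ t
  have h0 : (0 : ℝ) ≤ B := (abs_nonneg _).trans (hB t ht)
  rw [volterra_comm, volterra_eq_setIntegral _ _ ht.1]
  have h1 : ‖∫ s in Ioo 0 t, h (t - s) • gker β s‖ ≤ ∫ s in Ioo 0 t, B * gker β s := by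
    refine norm_integral_le_of_norm_le (Integrable.const_mul hgt B) ?_
    filter_upwards [ae_restrict_mem measurableSet_Ioo] with s hs
    rw [norm_smul, Real.norm_eq_abs, Real.norm_eq_abs, abs_of_pos (gker_pos hβ hs.1)]
    exact mul_le_mul_of_nonneg_right (hB _ ⟨by linarith [hs.2], by linarith [hs.1, ht.2]⟩)
      (gker_pos hβ hs.1).le
  refine h1.trans ?_
  rw [integral_const_mul]
  refine mul_le_mul_of_nonneg_left ?_ h0
  refine setIntegral_mono_set hg ?_ (Ioo_subset_Ioo_right ht.2).eventuallyLE
  exact (ae_timeMeasure_mem T).mono fun s hs => (gker_pos hβ hs.1).le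

/-- The bounds satisfied by the modes of the fractional flow: `f` is the force, `c` its initial
value, and `M` the size of the eigenvalue. -/
structure ModeBounds (α T M K c : ℝ) (f : ℝ → ℝ) : Prop where
  force : M * ∫ t, f t ^ 2 ∂(timeMeasure T) ≤ K * c ^ 2
  memory_sup : ∀ t ∈ Icc 0 T, M * ∫ θ, memory f t θ ^ 2 ∂(wMeasure α) ≤ K * c ^ 2
  integrable_rate : Integrable (fun z : ℝ × ℝ => (1 - z.2) * memoryRate f z.1 z.2 ^ 2)
    ((timeMeasure T).prod (wMeasure α))
  rate : M * ∫ z : ℝ × ℝ, (1 - z.2) * memoryRate f z.1 z.2 ^ 2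
    ∂((timeMeasure T).prod (wMeasure α)) ≤ K * c ^ 2
  memory_sq : M ^ 2 * ∫ z : ℝ × ℝ, memory f z.1 z.2 ^ 2 ∂((timeMeasure T).prod (wMeasure α)) ≤
    K * c ^ 2

theorem integrable_rate_prod (hα₀ : 0 < α) (hα₁ : α < 1) (hT : 0 ≤ T) {f : ℝ → ℝ}
    (hf : Continuous f)
    (h : Integrable (fun θ => (1 - θ) * ∫ s in (0 : ℝ)..T, memoryRate f s θ ^ 2) (wMeasure α)) :
    Integrable (fun z : ℝ × ℝ => (1 - z.2) * memoryRate f z.1 z.2 ^ 2)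
        ((timeMeasure T).prod (wMeasure α)) ∧
      ∫ z : ℝ × ℝ, (1 - z.2) * memoryRate f z.1 z.2 ^ 2 ∂((timeMeasure T).prod (wMeasure α)) =
        ∫ θ, ((1 - θ) * ∫ s in (0 : ℝ)..T, memoryRate f s θ ^ 2) ∂(wMeasure α) := by
  have := isProbabilityMeasure_wMeasure hα₀ hα₁
  have hm : AEStronglyMeasurable (fun z : ℝ × ℝ => (1 - z.2) * memoryRate f z.1 z.2 ^ 2)
      ((timeMeasure T).prod (wMeasure α)) :=
    ((measurable_const.sub measurable_snd).stronglyMeasurable.mul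
      ((stronglyMeasurable_memoryRate hf).pow 2)).aestronglyMeasurable
  have hint : Integrable (fun z : ℝ × ℝ => (1 - z.2) * memoryRate f z.1 z.2 ^ 2)
        ((timeMeasure T).prod (wMeasure α)) := by
    rw [integrable_prod_iff' hm]
    refine ⟨Eventually.of_forall fun θ => ?_, h.congr ((ae_wMeasure_mem α).mono fun θ hθ => ?_)⟩
    · have hc : Continuous fun s => (1 - θ) * memoryRate f s θ ^ 2 :=
        continuous_const.mul ((continuous_memoryRate hf θ).pow 2)
      exact integrable_of_continuous hc T
    · simp only
      rw [intervalIntegral_eq_timeMeasure _ hT, ← integral_const_mul]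
      refine integral_congr_ae (Eventually.of_forall fun s => ?_)
      simp only
      rw [Real.norm_of_nonneg (mul_nonneg (by linarith [hθ.2]) (sq_nonneg _))]
  refine ⟨hint, ?_⟩
  rw [integral_prod_symm _ hint]
  simp only [integral_const_mul, intervalIntegral_eq_timeMeasure _ hT]

theorem integral_memory_sq_split (hα₀ : 0 < α) (hα₁ : α < 1) {f : ℝ → ℝ} (hf : Continuous f)
    {t : ℝ} (ht : 0 ≤ t) :
    ∫ θ, memory f t θ ^ 2 ∂(wMeasure α) =
      (∫ θ, (1 - θ) * memory f t θ ^ 2 ∂(wMeasure α)) +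
        ∫ θ, θ * memory f t θ ^ 2 ∂(wMeasure α) := by
  have h := integrable_memory_sq hα₀ hα₁ hf ht
  rw [← integral_add (integrable_one_sub_mul h) (integrable_id_mul h)]
  refine integral_congr_ae (Eventually.of_forall fun θ => ?_)
  simp only
  ring

theorem integral_memory_sq_prod_le (hα₀ : 0 < α) (hα₁ : α < 1) (hT : 0 ≤ T) {f : ℝ → ℝ}
    (hf : Continuous f) {P : ℝ}
    (hP : ∀ t ∈ Icc 0 T, ∫ θ, (1 - θ) * memory f t θ ^ 2 ∂(wMeasure α) ≤ P) :
    ∫ z : ℝ × ℝ, memory f z.1 z.2 ^ 2 ∂((timeMeasure T).prod (wMeasure α)) ≤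
      T * P + ∫ θ, (θ * ∫ s in (0 : ℝ)..T, memory f s θ ^ 2) ∂(wMeasure α) := by
  have := isProbabilityMeasure_wMeasure hα₀ hα₁
  have h := integrable_memory_sq_prod hα₀ hα₁ hf T
  have h1 : Integrable (fun z : ℝ × ℝ => z.2 * memory f z.1 z.2 ^ 2)
      ((timeMeasure T).prod (wMeasure α)) := by
    refine h.bdd_mul (c := 1) measurable_snd.aestronglyMeasurable
      ((ae_prod_mem hα₀ hα₁ T).mono fun z hz => ?_)
    rw [Real.norm_eq_abs, abs_of_pos hz.2.1]
    exact hz.2.2.le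
  have h2 : Integrable (fun z : ℝ × ℝ => (1 - z.2) * memory f z.1 z.2 ^ 2)
      ((timeMeasure T).prod (wMeasure α)) :=
    (h.sub h1).congr (Eventually.of_forall fun z => by simp only [Pi.sub_apply]; ring)
  have h3 : ∫ z : ℝ × ℝ, memory f z.1 z.2 ^ 2 ∂((timeMeasure T).prod (wMeasure α)) =
      (∫ z : ℝ × ℝ, (1 - z.2) * memory f z.1 z.2 ^ 2 ∂((timeMeasure T).prod (wMeasure α))) +
        ∫ z : ℝ × ℝ, z.2 * memory f z.1 z.2 ^ 2 ∂((timeMeasure T).prod (wMeasure α)) := by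
    rw [← integral_add h2 h1]
    refine integral_congr_ae (Eventually.of_forall fun z => ?_)
    simp only
    ring
  rw [h3]
  refine add_le_add ?_ (le_of_eq ?_)
  · rw [integral_prod _ h2]
    refine (integral_mono_ae h2.integral_prod_left (integrable_const_timeMeasure T P)
      ((ae_timeMeasure_mem T).mono fun t ht => hP t (Ioo_subset_Icc_self ht))).trans (le_of_eq ?_)
    rw [← intervalIntegral_eq_timeMeasure _ hT, intervalIntegral.integral_const]
    simp
  · rw [integral_prod_symm _ h1]
    simp only [integral_const_mul, intervalIntegral_eq_timeMeasure _ hT]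

theorem integral_nonneg_wMeasure {g : ℝ → ℝ} (h : ∀ θ ∈ Ioo (0 : ℝ) 1, 0 ≤ g θ) :
    0 ≤ ∫ θ, g θ ∂(wMeasure α) :=
  integral_nonneg_of_ae ((ae_wMeasure_mem α).mono h)

/-- Mode bounds for bounded eigenvalues, from an a priori bound of the force. -/
theorem modeBounds_of_abs_le (hα₀ : 0 < α) (hα₁ : α < 1) (hT : 0 ≤ T) {M N L B lam c : ℝ}
    (hM0 : 0 ≤ M) (hM : M ≤ N) (hN : 1 ≤ N) (hL : |lam| ≤ L) (hB : 0 ≤ B) {f ρ : ℝ → ℝ}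
    (hf : Continuous f) (hρ : Integrable ρ (timeMeasure T))
    (hfρ : ∀ s ∈ Icc 0 T, f s = c - lam * ∫ r in (0 : ℝ)..s, ρ r)
    (hR : ∀ s ∈ Icc 0 T, volterra (gker α) f s = ∫ r in (0 : ℝ)..s, ρ r)
    (hfB : ∀ s ∈ Icc 0 T, |f s| ≤ B * |c|) :
    ModeBounds α T M (N ^ 2 * (T + (2 + 2 * T) + (1 + L + T) * (2 + 2 * T) ^ 2) * B ^ 2) c f := by
  have := isProbabilityMeasure_wMeasure hα₀ hα₁
  set D := 2 + 2 * T with hD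
  have hD0 : 0 ≤ D := by positivity
  have hL0 : 0 ≤ L := (abs_nonneg _).trans hL
  have hN0 : 0 ≤ N := by linarith
  have hBc : 0 ≤ B * |c| := by positivity
  set X := B ^ 2 * c ^ 2 with hX
  have hX0 : 0 ≤ X := by positivity
  have hBcX : (B * |c|) ^ 2 = X := by rw [mul_pow, sq_abs]
  have hm : ∀ t ∈ Icc 0 T, ∀ θ ∈ Ioo (0 : ℝ) 1, memory f t θ ^ 2 ≤ D ^ 2 * X := fun t ht θ hθ => by
    have := abs_memory_sq_le hfB ht hθ
    rw [mul_pow, hBcX] at this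
    exact (le_abs_self _).trans this
  have hsup : ∀ t ∈ Icc 0 T, ∫ θ, memory f t θ ^ 2 ∂(wMeasure α) ≤ D ^ 2 * X := fun t ht => by
    refine (integral_mono_ae (integrable_memory_sq hα₀ hα₁ hf ht.1) (integrable_const _)
      ((ae_wMeasure_mem α).mono (hm t ht))).trans (le_of_eq ?_)
    simp
  have hforce : ∫ t, f t ^ 2 ∂(timeMeasure T) ≤ T * X := by
    refine (integral_mono_ae (integrable_of_continuous (hf.pow 2) T)
      (integrable_const_timeMeasure T X) ((ae_timeMeasure_mem T).mono fun t ht => ?_)).trans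
      (le_of_eq ?_)
    · have := hfB t (Ioo_subset_Icc_self ht)
      rw [Pi.pow_apply, ← sq_abs, ← hBcX]
      exact pow_le_pow_left₀ (abs_nonneg _) this 2
    · rw [← intervalIntegral_eq_timeMeasure _ hT, intervalIntegral.integral_const]
      simp
  have hsq : ∫ z : ℝ × ℝ, memory f z.1 z.2 ^ 2 ∂((timeMeasure T).prod (wMeasure α)) ≤
      T * (D ^ 2 * X) := by
    have h := integrable_memory_sq_prod hα₀ hα₁ hf T
    rw [integral_prod _ h]
    refine (integral_mono_ae h.integral_prod_left (integrable_const_timeMeasure T (D ^ 2 * X))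
      ((ae_timeMeasure_mem T).mono fun t ht => hsup t (Ioo_subset_Icc_self ht))).trans (le_of_eq ?_)
    rw [← intervalIntegral_eq_timeMeasure _ hT, intervalIntegral.integral_const]
    simp
  have hTmem : T ∈ Icc 0 T := ⟨hT, le_rfl⟩
  obtain ⟨hi, hE⟩ := energy_memoryRate hα₀ hα₁ hf hρ hfρ hR hTmem
  obtain ⟨hint, hprod⟩ := integrable_rate_prod hα₀ hα₁ hT hf hi
  have hRb : |volterra (gker α) f T| ≤ D * (B * |c|) := by
    rw [← integral_memory_of_continuous hα₀ hα₁ hf hT]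
    have h1 := norm_integral_le_of_norm_le_const (μ := wMeasure α) (f := fun θ => memory f T θ)
      (C := D * (B * |c|)) ((ae_wMeasure_mem α).mono fun θ hθ => norm_memory_le hTmem hfB hθ)
    simpa using h1
  have hrate : ∫ z : ℝ × ℝ, (1 - z.2) * memoryRate f z.1 z.2 ^ 2
      ∂((timeMeasure T).prod (wMeasure α)) ≤ D * X + L * D ^ 2 * X := by
    rw [hprod]
    have h0 : 0 ≤ ∫ θ, θ * memory f T θ ^ 2 ∂(wMeasure α) :=
      integral_nonneg_wMeasure fun θ hθ => mul_nonneg hθ.1.le (sq_nonneg _)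
    have h1 : f T * volterra (gker α) f T ≤ D * X := by
      refine (le_abs_self _).trans ?_
      rw [abs_mul]
      refine (mul_le_mul (hfB T hTmem) hRb (abs_nonneg _) hBc).trans (le_of_eq ?_)
      rw [← hBcX]; ring
    have h2 : lam * volterra (gker α) f T ^ 2 ≤ L * D ^ 2 * X := by
      refine (mul_le_mul_of_nonneg_right ((le_abs_self _).trans hL) (sq_nonneg _)).trans ?_
      rw [mul_assoc]
      refine mul_le_mul_of_nonneg_left ?_ hL0
      rw [← sq_abs, ← hBcX, ← mul_pow]
      exact pow_le_pow_left₀ (abs_nonneg _) hRb 2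
    have h3 : 0 ≤ L * D ^ 2 * X := by positivity
    linarith
  have hN2 : M ≤ N ^ 2 := by nlinarith
  have hM2 : M ^ 2 ≤ N ^ 2 := pow_le_pow_left₀ hM0 hM 2
  have key : ∀ {m x : ℝ}, 0 ≤ m → m ≤ N ^ 2 →
      x ≤ (T + D + (1 + L + T) * D ^ 2) * X →
      m * x ≤ N ^ 2 * (T + D + (1 + L + T) * D ^ 2) * B ^ 2 * c ^ 2 := by
    intro m x hm0 hmN hx
    have h0 : 0 ≤ (T + D + (1 + L + T) * D ^ 2) * X := by positivity
    refine (mul_le_mul_of_nonneg_left hx hm0).trans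
      ((mul_le_mul_of_nonneg_right hmN h0).trans (le_of_eq ?_))
    rw [hX]; ring
  have p1 : 0 ≤ T * X := by positivity
  have p2 : 0 ≤ D * X := by positivity
  have p3 : 0 ≤ D ^ 2 * X := by positivity
  have p4 : 0 ≤ L * D ^ 2 * X := by positivity
  have p5 : 0 ≤ T * (D ^ 2 * X) := by positivity
  refine ⟨key hM0 hN2 (hforce.trans ?_), fun t ht => key hM0 hN2 ((hsup t ht).trans ?_), hint,
    key hM0 hN2 (hrate.trans ?_), key (sq_nonneg M) hM2 (hsq.trans ?_)⟩ <;> linarith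

/-- Mode bounds for large eigenvalues: the energy identities gain the required powers of the
eigenvalue. -/
theorem modeBounds_of_one_le (hα₀ : 0 < α) (hα₁ : α < 1) (hT : 0 ≤ T) {M a lam c : ℝ}
    (hM0 : 0 ≤ M) (ha : 1 ≤ a) (hM : M ≤ a * lam) (hlam : 1 ≤ lam) {f ρ : ℝ → ℝ}
    (hf : Continuous f) (hρ : Integrable ρ (timeMeasure T))
    (hfρ : ∀ s ∈ Icc 0 T, f s = c - lam * ∫ r in (0 : ℝ)..s, ρ r)
    (hR : ∀ s ∈ Icc 0 T, volterra (gker α) f s = ∫ r in (0 : ℝ)..s, ρ r) :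
    ModeBounds α T M
      (a ^ 2 * (1 + (6 + 4 * T) * ∫ s, gker (1 - α) s ∂(timeMeasure T))) c f := by
  have := isProbabilityMeasure_wMeasure hα₀ hα₁
  have hα : 0 < 1 - α := by linarith
  set G := ∫ s, gker (1 - α) s ∂(timeMeasure T) with hG
  have hG0 : 0 ≤ G := integral_nonneg_of_ae
    ((ae_timeMeasure_mem T).mono fun s hs => (gker_pos hα hs.1).le)
  have hl0 : 0 < lam := by linarith
  set R := volterra (gker α) f with hRdef
  have hfR : ∀ s ∈ Icc 0 T, f s = c - lam * R s := fun s hs => by rw [hfρ s hs, hR s hs]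
  -- the energy identity for the rate controls `R` and the weighted memory
  have hE2 : ∀ t ∈ Icc 0 T, 0 ≤ (∫ θ, θ * memory f t θ ^ 2 ∂(wMeasure α)) ∧
      0 ≤ (∫ θ, ((1 - θ) * ∫ s in (0 : ℝ)..t, memoryRate f s θ ^ 2) ∂(wMeasure α)) ∧
      (∫ θ, ((1 - θ) * ∫ s in (0 : ℝ)..t, memoryRate f s θ ^ 2) ∂(wMeasure α)) +
        (∫ θ, θ * memory f t θ ^ 2 ∂(wMeasure α)) / 2 = c * R t - lam * R t ^ 2 / 2 := by
    intro t ht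
    refine ⟨integral_nonneg_wMeasure fun θ hθ => mul_nonneg hθ.1.le (sq_nonneg _),
      integral_nonneg_wMeasure fun θ hθ => mul_nonneg (by linarith [hθ.2])
        (intervalIntegral.integral_nonneg ht.1 fun _ _ => sq_nonneg _), ?_⟩
    rw [(energy_memoryRate hα₀ hα₁ hf hρ hfρ hR ht).2, ← hRdef, hfR t ht]
    ring
  have hRb : ∀ t ∈ Icc 0 T, |lam * R t| ≤ 2 * |c| := by
    intro t ht
    obtain ⟨h1, h2, h3⟩ := hE2 t ht
    refine abs_le_of_sq_le_sq ?_ (by positivity)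
    have h4 : 0 ≤ c * R t - lam * R t ^ 2 / 2 := by rw [← h3]; positivity
    have h5 : (lam * R t) ^ 2 ≤ 2 * c * (lam * R t) := by nlinarith
    have h6 : (2 * |c|) ^ 2 = 4 * c ^ 2 := by rw [mul_pow, sq_abs]; norm_num
    rw [h6]
    nlinarith [sq_nonneg (lam * R t - 2 * c)]
  -- as `lam ^ 2 R ^ 2 - 2 lam c R + c ^ 2` is a square
  have hcR : ∀ t, lam * (c * R t - lam * R t ^ 2 / 2) ≤ c ^ 2 / 2 := fun t => by
    nlinarith [sq_nonneg (c - lam * R t)]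
  -- the integral of the force is of order `1 / lam`
  have hfint : ∀ t ∈ Icc 0 T, |lam * ∫ s in (0 : ℝ)..t, f s| ≤ 2 * |c| * G := by
    intro t ht
    rw [← integral_eq_volterra_gker hα₀ hα₁ ht (integrable_of_continuous hf T), ← hRdef]
    have h1 : lam * volterra (gker (1 - α)) R t = volterra (gker (1 - α)) (fun s => lam * R s) t := by
      simp only [volterra, smul_eq_mul, mul_left_comm _ lam]
      rw [intervalIntegral.integral_const_mul]
    rw [h1]
    exact abs_volterra_gker_le hα ht hRb
  have hcf : ∀ t ∈ Icc 0 T, lam * (c * ∫ s in (0 : ℝ)..t, f s) ≤ 2 * G * c ^ 2 := by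
    intro t ht
    rw [mul_left_comm]
    refine (le_abs_self _).trans ?_
    rw [abs_mul]
    refine (mul_le_mul_of_nonneg_left (hfint t ht) (abs_nonneg c)).trans (le_of_eq ?_)
    rw [← sq_abs c]; ring
  -- `lam ∫ f R` and `∫ f ^ 2` add up to `c ∫ f`
  have hW : ∀ t ∈ Icc 0 T, lam * (∫ s in (0 : ℝ)..t, f s * R s) =
      c * (∫ s in (0 : ℝ)..t, f s) - ∫ s in (0 : ℝ)..t, f s ^ 2 := by
    intro t ht
    rw [← intervalIntegral.integral_const_mul, ← intervalIntegral.integral_const_mul,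
      ← intervalIntegral.integral_sub (Continuous.intervalIntegrable (by fun_prop) _ _)
      (Continuous.intervalIntegrable (by fun_prop) _ _)]
    refine intervalIntegral.integral_congr fun s hs => ?_
    rw [uIcc_of_le ht.1] at hs
    have := hfR s ⟨hs.1, hs.2.trans ht.2⟩
    linear_combination f s * this
  have hf2 : ∀ t ∈ Icc 0 T, 0 ≤ ∫ s in (0 : ℝ)..t, f s ^ 2 := fun t ht =>
    intervalIntegral.integral_nonneg ht.1 fun _ _ => sq_nonneg _
  have hWle : ∀ t ∈ Icc 0 T, lam ^ 2 * (∫ s in (0 : ℝ)..t, f s * R s) ≤ 2 * G * c ^ 2 := by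
    intro t ht
    have h1 := hcf t ht
    have h2 : lam ^ 2 * (∫ s in (0 : ℝ)..t, f s * R s) =
        lam * (c * ∫ s in (0 : ℝ)..t, f s) - lam * ∫ s in (0 : ℝ)..t, f s ^ 2 := by
      rw [sq, mul_assoc, hW t ht]; ring
    have h3 := mul_nonneg hl0.le (hf2 t ht)
    linarith
  -- the energy identity for the memory variable
  have hE1 : ∀ t ∈ Icc 0 T, 0 ≤ (∫ θ, (1 - θ) * memory f t θ ^ 2 ∂(wMeasure α)) ∧
      0 ≤ (∫ θ, (θ * ∫ s in (0 : ℝ)..t, memory f s θ ^ 2) ∂(wMeasure α)) ∧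
      (∫ θ, (1 - θ) * memory f t θ ^ 2 ∂(wMeasure α)) / 2 +
        (∫ θ, (θ * ∫ s in (0 : ℝ)..t, memory f s θ ^ 2) ∂(wMeasure α)) =
      ∫ s in (0 : ℝ)..t, f s * R s := fun t ht =>
    ⟨integral_nonneg_wMeasure fun θ hθ => mul_nonneg (by linarith [hθ.2]) (sq_nonneg _),
      integral_nonneg_wMeasure fun θ hθ => mul_nonneg hθ.1.le
        (intervalIntegral.integral_nonneg ht.1 fun _ _ => sq_nonneg _),
      energy_memory hα₀ hα₁ hf ht.1⟩
  have hTmem : T ∈ Icc 0 T := ⟨hT, le_rfl⟩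
  have hl2 : 0 < lam ^ 2 := by positivity
  have hGc : 0 ≤ G * c ^ 2 := by positivity
  have hforce : lam * ∫ t, f t ^ 2 ∂(timeMeasure T) ≤ 2 * G * c ^ 2 := by
    rw [← intervalIntegral_eq_timeMeasure _ hT]
    obtain ⟨h1, h2, h3⟩ := hE1 T hTmem
    have h4 : 0 ≤ ∫ s in (0 : ℝ)..T, f s * R s := by rw [← h3]; positivity
    have h5 := mul_nonneg hl0.le (mul_nonneg hl0.le h4)
    rw [hW T hTmem, mul_sub] at h5
    linarith [hcf T hTmem]
  have hP : ∀ t ∈ Icc 0 T, lam ^ 2 * ∫ θ, (1 - θ) * memory f t θ ^ 2 ∂(wMeasure α) ≤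
      4 * G * c ^ 2 := fun t ht => by
    obtain ⟨h1, h2, h3⟩ := hE1 t ht
    have h4 := hWle t ht
    rw [← h3, mul_add] at h4
    have := mul_nonneg hl2.le h2
    linarith
  have hsup : ∀ t ∈ Icc 0 T, lam * ∫ θ, memory f t θ ^ 2 ∂(wMeasure α) ≤ (1 + 4 * G) * c ^ 2 := by
    intro t ht
    rw [integral_memory_sq_split hα₀ hα₁ hf ht.1, mul_add]
    obtain ⟨h1, h2, h3⟩ := hE2 t ht
    have h4 := hcR t
    rw [← h3, mul_add] at h4
    have h5 := mul_nonneg hl0.le h2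
    have h6 := (mul_le_mul_of_nonneg_right (le_self_pow₀ hlam two_ne_zero) (hE1 t ht).1).trans
      (hP t ht)
    linarith
  obtain ⟨hi, -⟩ := energy_memoryRate hα₀ hα₁ hf hρ hfρ hR hTmem
  obtain ⟨hint, hprod⟩ := integrable_rate_prod hα₀ hα₁ hT hf hi
  have hrate : lam * ∫ z : ℝ × ℝ, (1 - z.2) * memoryRate f z.1 z.2 ^ 2
      ∂((timeMeasure T).prod (wMeasure α)) ≤ c ^ 2 := by
    rw [hprod]
    obtain ⟨h1, h2, h3⟩ := hE2 T hTmem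
    have h4 := hcR T
    rw [← h3, mul_add] at h4
    have h5 := mul_nonneg hl0.le h1
    linarith [sq_nonneg c]
  have hsq : lam ^ 2 * ∫ z : ℝ × ℝ, memory f z.1 z.2 ^ 2 ∂((timeMeasure T).prod (wMeasure α)) ≤
      (2 + 4 * T) * (G * c ^ 2) := by
    have h1 := integral_memory_sq_prod_le hα₀ hα₁ hT hf (P := 4 * G * c ^ 2 / lam ^ 2)
      fun t ht => by rw [le_div_iff₀ hl2, mul_comm]; exact hP t ht
    refine (mul_le_mul_of_nonneg_left h1 hl2.le).trans ?_
    obtain ⟨h2, h3, h4⟩ := hE1 T hTmem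
    have h5 := hWle T hTmem
    rw [← h4, mul_add] at h5
    have h6 := mul_nonneg hl2.le h2
    have h7 : lam ^ 2 * (T * (4 * G * c ^ 2 / lam ^ 2)) = T * (4 * G * c ^ 2) := by
      field_simp
    rw [mul_add, h7]
    linarith
  have ha0 : 0 ≤ a := by linarith
  have hMa : M ≤ a ^ 2 * lam := hM.trans (mul_le_mul_of_nonneg_right (le_self_pow₀ ha two_ne_zero) hl0.le)
  have hM2 : M ^ 2 ≤ a ^ 2 * lam ^ 2 := by rw [← mul_pow]; exact pow_le_pow_left₀ hM0 hM 2
  have key : ∀ {m b x : ℝ}, m ≤ a ^ 2 * b → 0 ≤ x → b * x ≤ (1 + (6 + 4 * T) * G) * c ^ 2 →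
      m * x ≤ a ^ 2 * (1 + (6 + 4 * T) * G) * c ^ 2 := by
    intro m b x hm hx hb
    refine (mul_le_mul_of_nonneg_right hm hx).trans ?_
    rw [mul_assoc, mul_assoc]
    exact mul_le_mul_of_nonneg_left hb (sq_nonneg a)
  have hTG : 0 ≤ T * (G * c ^ 2) := by positivity
  have hc2 := sq_nonneg c
  refine ⟨key hMa (integral_nonneg fun _ => sq_nonneg _) (hforce.trans ?_),
    fun t ht => key hMa (integral_nonneg fun _ => sq_nonneg _) ((hsup t ht).trans ?_), hint,
    key hMa (integral_nonneg_of_ae ((ae_prod_mem hα₀ hα₁ T).mono fun z hz =>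
      mul_nonneg (by linarith [hz.2.2]) (sq_nonneg _))) (hrate.trans ?_),
    key hM2 (integral_nonneg fun _ => sq_nonneg _) (hsq.trans ?_)⟩ <;> linarith

/-- Each mode of the fractional flow is determined by a scalar Volterra equation, whose solution
is continuous and satisfies bounds with a constant that does not depend on the eigenvalue. -/
theorem exists_modeBounds (hα₀ : 0 < α) (hα₁ : α < 1) (hT : 0 ≤ T) {C₂ : ℝ} (hC₂ : 0 ≤ C₂) :
    ∃ K, ∀ lam c : ℝ, 0 < lam + C₂ → ∃ f : ℝ → ℝ, Continuous f ∧
      (∀ t ∈ Icc 0 T, f t = c - lam * volterra (gker α) f t) ∧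
      ModeBounds α T (lam + C₂) K c f := by
  obtain ⟨γ, hγ, hs⟩ := exists_laplace_small hα₀ (1 + C₂)
  set K₁ := (1 + 2 * C₂) ^ 2 * (T + (2 + 2 * T) + (1 + (1 + C₂) + T) * (2 + 2 * T) ^ 2) *
    (2 * Real.exp (γ * T)) ^ 2 with hK₁
  set K₂ := (1 + C₂) ^ 2 * (1 + (6 + 4 * T) * ∫ s, gker (1 - α) s ∂(timeMeasure T)) with hK₂
  have hmono : ∀ {M K K' c : ℝ} {f : ℝ → ℝ}, K ≤ K' → ModeBounds α T M K c f →
      ModeBounds α T M K' c f := fun {M K K' c f} hK h =>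
    have h1 := mul_le_mul_of_nonneg_right hK (sq_nonneg c)
    ⟨h.force.trans h1, fun t ht => (h.memory_sup t ht).trans h1, h.integrable_rate,
      h.rate.trans h1, h.memory_sq.trans h1⟩
  refine ⟨max K₁ K₂, fun lam c hlam => ?_⟩
  obtain ⟨f, ρ, hf, hρ, hfρ, hR⟩ := exists_continuous_solution hα₀ T lam c
  have hfR : ∀ t ∈ Icc 0 T, f t = c - lam * volterra (gker α) f t := fun t ht => by
    rw [hfρ t ht, hR t ht]
  refine ⟨f, hf, hfR, ?_⟩
  -- eigenvalues above `1` are handled by the energy identities, the others lie in a bounded set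
  rcases le_total 1 lam with h1 | h1
  · exact hmono (le_max_right _ _) (modeBounds_of_one_le hα₀ hα₁ hT hlam.le (a := 1 + C₂)
      (by linarith) (by nlinarith) h1 hf hρ hfρ hR)
  · have hL : |lam| ≤ 1 + C₂ := abs_le.2 ⟨by linarith, by linarith⟩
    exact hmono (le_max_left _ _) (modeBounds_of_abs_le hα₀ hα₁ hT hlam.le (N := 1 + 2 * C₂)
      (by linarith) (by linarith) hL (by positivity) hf hρ hfρ hR
      fun s hs' => abs_le_of_volterra hα₀ hγ hs hL hf hfR hs')

end ScalarEstimates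

/-! ### Square integrable functions of θ and the first variation of the augmented energy -/

section SectionLp

variable {ν : Measure ℝ}

/-- The curried function `t ↦ G t · ∈ L²(ν)`, with the value `0` where `G t` is not square
integrable. -/
def sectionLp (ν : Measure ℝ) (G : ℝ → ℝ → ℝ) (t : ℝ) : Lp ℝ 2 ν :=
  open Classical in if h : MemLp (G t) 2 ν then h.toLp (G t) else 0

theorem coeFn_sectionLp {G : ℝ → ℝ → ℝ} {t : ℝ} (h : MemLp (G t) 2 ν) :
    sectionLp ν G t =ᵐ[ν] G t := by
  rw [sectionLp, dif_pos h]
  exact h.coeFn_toLp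

theorem norm_sectionLp_sq {G : ℝ → ℝ → ℝ} {t : ℝ} (h : MemLp (G t) 2 ν) :
    ‖sectionLp ν G t‖ ^ 2 = ∫ θ, G t θ ^ 2 ∂ν := by
  rw [norm_sq_eq_integral]
  refine integral_congr_ae ((coeFn_sectionLp h).mono fun θ hθ => ?_)
  simp only [hθ, Real.norm_eq_abs, sq_abs]

/-- Currying preserves measurability, since `L²(ν)` has a countable Hilbert basis. -/
theorem aestronglyMeasurable_sectionLp [SFinite ν] {τ : Measure ℝ} {G : ℝ → ℝ → ℝ}
    (hG : StronglyMeasurable (Function.uncurry G)) (h : ∀ᵐ t ∂τ, MemLp (G t) 2 ν) :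
    AEStronglyMeasurable (sectionLp ν G) τ := by
  obtain ⟨w, b, -⟩ := exists_hilbertBasis ℝ (Lp ℝ 2 ν)
  have : Fact ((2 : ℝ≥0∞) ≠ ⊤) := ⟨by norm_num⟩
  have : Countable w := countable_of_orthonormal b.orthonormal
  refine aestronglyMeasurable_of_tendsto_ae (atTop : Filter (Finset w))
    (f := fun F t => ∑ n ∈ F, b.repr (sectionLp ν G t) n • b n) (fun F => ?_)
    (Eventually.of_forall fun t => b.hasSum_repr _)
  refine Finset.aestronglyMeasurable_fun_sum _ fun n _ => AEStronglyMeasurable.smul_const ?_ _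
  obtain ⟨g, hg, hgn⟩ := (Lp.aestronglyMeasurable (b n))
  have h1 : StronglyMeasurable fun t => ∫ θ, G t θ * g θ ∂ν :=
    StronglyMeasurable.integral_prod_right (hG.mul (hg.comp_measurable measurable_snd))
  refine h1.aestronglyMeasurable.congr (h.mono fun t ht => ?_)
  simp only
  rw [b.repr_apply_apply, L2.inner_def]
  refine integral_congr_ae ?_
  filter_upwards [coeFn_sectionLp ht, hgn] with θ h2 h3
  rw [h2, h3]
  rfl

theorem memLp_sectionLp [SFinite ν] {T : ℝ} {G : ℝ → ℝ → ℝ}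
    (hG : StronglyMeasurable (Function.uncurry G))
    (h : Integrable (fun z : ℝ × ℝ => G z.1 z.2 ^ 2) ((timeMeasure T).prod ν)) :
    (∀ᵐ t ∂(timeMeasure T), MemLp (G t) 2 ν) ∧ MemLp (sectionLp ν G) 2 (timeMeasure T) ∧
      ∫ t, ‖sectionLp ν G t‖ ^ 2 ∂(timeMeasure T) =
        ∫ z : ℝ × ℝ, G z.1 z.2 ^ 2 ∂((timeMeasure T).prod ν) := by
  have h1 : ∀ᵐ t ∂(timeMeasure T), MemLp (G t) 2 ν := by
    filter_upwards [h.prod_right_ae] with t ht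
    exact (memLp_two_iff_integrable_sq (stronglyMeasurable_section hG t).aestronglyMeasurable).2 ht
  have h2 : ∀ᵐ t ∂(timeMeasure T), ‖sectionLp ν G t‖ ^ 2 = ∫ θ, G t θ ^ 2 ∂ν :=
    h1.mono fun t ht => norm_sectionLp_sq ht
  refine ⟨h1, ?_, ?_⟩
  · rw [memLp_two_iff_integrable_sq_norm (aestronglyMeasurable_sectionLp hG h1)]
    exact h.integral_prod_left.congr (h2.mono fun t ht => ht.symm)
  · rw [integral_congr_ae h2, integral_prod _ h]

end SectionLp

section LpOperators

variable {Ω : Type*} [MeasurableSpace Ω] {ν : Measure Ω}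
variable {Y Z : Type*} [NormedAddCommGroup Y] [NormedSpace ℝ Y] [NormedAddCommGroup Z]
  [NormedSpace ℝ Z]

theorem compLpL_smulVec (L : Y →L[ℝ] Z) (y : Y) (g : Lp ℝ 2 ν) :
    L.compLpL 2 ν (smulVec ν y g) = smulVec ν (L y) g := by
  refine Lp.ext ?_
  filter_upwards [L.coeFn_compLpL (smulVec ν y g), coeFn_smulVec y g, coeFn_smulVec (L y) g]
    with a h1 h2 h3
  rw [h1, h2, h3, map_smul]

theorem smulVec_real (c : ℝ) (g : Lp ℝ 2 ν) : smulVec ν c g = c • g := by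
  refine Lp.ext ?_
  filter_upwards [coeFn_smulVec c g, Lp.coeFn_smul c g] with a h1 h2
  rw [h1, h2, Pi.smul_apply, smul_eq_mul, smul_eq_mul, mul_comm]

/-- The mean value as an operator on `L²(ν;Y)`. -/
def meanL (ν : Measure Ω) [IsProbabilityMeasure ν] (Y : Type*) [NormedAddCommGroup Y]
    [NormedSpace ℝ Y] : Lp Y 2 ν →L[ℝ] Y :=
  LinearMap.mkContinuous
    { toFun := fun v => ∫ a, v a ∂ν
      map_add' := fun v w => by
        rw [← integral_add ((Lp.memLp v).integrable (by norm_num))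
          ((Lp.memLp w).integrable (by norm_num))]
        exact integral_congr_ae (Lp.coeFn_add v w)
      map_smul' := fun c v => by
        rw [RingHom.id_apply, ← integral_smul]
        exact integral_congr_ae (Lp.coeFn_smul c v) } 1 fun v => by
    refine (norm_integral_le_integral_norm _).trans ?_
    rw [one_mul, integral_norm_eq_lintegral_enorm (Lp.aestronglyMeasurable v),
      ← eLpNorm_one_eq_lintegral_enorm, Lp.norm_def]
    exact ENNReal.toReal_mono (Lp.eLpNorm_ne_top v)
      (eLpNorm_le_eLpNorm_of_exponent_le (by norm_num) (Lp.aestronglyMeasurable v))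

theorem meanL_apply [IsProbabilityMeasure ν] (v : Lp Y 2 ν) : meanL ν Y v = ∫ a, v a ∂ν := rfl

theorem map_meanL [IsProbabilityMeasure ν] [CompleteSpace Y] [CompleteSpace Z] (L : Y →L[ℝ] Z)
    (v : Lp Y 2 ν) : L (meanL ν Y v) = meanL ν Z (L.compLpL 2 ν v) := by
  rw [meanL_apply, meanL_apply, ← L.integral_comp_comm ((Lp.memLp v).integrable (by norm_num))]
  exact integral_congr_ae ((L.coeFn_compLpL v).mono fun a ha => ha.symm)

theorem meanL_smulVec [IsProbabilityMeasure ν] [CompleteSpace Y] (y : Y) (g : Lp ℝ 2 ν) :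
    meanL ν Y (smulVec ν y g) = (meanL ν ℝ g) • y := by
  rw [meanL_apply, meanL_apply, ← integral_smul_const]
  exact integral_congr_ae (coeFn_smulVec y g)

/-- Elements of `L²(ν;H)` are determined by their coefficients. -/
theorem Lp_ext_of_coeff {H ι : Type*} [NormedAddCommGroup H] [InnerProductSpace ℝ H] [Countable ι]
    (b : HilbertBasis ι ℝ H) {v w : Lp H 2 ν}
    (h : ∀ k, (innerSL ℝ (b k)).compLpL 2 ν v = (innerSL ℝ (b k)).compLpL 2 ν w) : v = w := by
  refine Lp.ext ?_
  have h1 : ∀ k, ∀ᵐ a ∂ν, inner ℝ (b k) (v a) = inner ℝ (b k) (w a) := fun k => by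
    filter_upwards [(innerSL ℝ (b k)).coeFn_compLpL v, (innerSL ℝ (b k)).coeFn_compLpL w]
      with a h1 h2
    rw [h k, h2] at h1
    exact h1.symm
  filter_upwards [ae_all_iff.2 h1] with a ha
  refine b.repr.injective ?_
  ext k
  rw [b.repr_apply_apply, b.repr_apply_apply, ha]

theorem ext_of_coeff {H ι : Type*} [NormedAddCommGroup H] [InnerProductSpace ℝ H]
    (b : HilbertBasis ι ℝ H) {v w : H} (h : ∀ k, inner ℝ (b k) v = inner ℝ (b k) w) : v = w := by
  refine b.repr.injective ?_
  ext k
  rw [b.repr_apply_apply, b.repr_apply_apply, h]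

end LpOperators

section WeightedSpaces

variable {α : ℝ}

instance instSFiniteWMeasure (α : ℝ) : SFinite (wMeasure α) := by
  rw [wMeasure]; infer_instance

instance instSFiniteWMeasure₀ (α : ℝ) : SFinite (wMeasure₀ α) := by
  rw [wMeasure₀]; infer_instance

theorem coeFn_inclL2w (α : ℝ) {Y : Type*} [NormedAddCommGroup Y] [NormedSpace ℝ Y] (v : L2w α Y) :
    inclL2w α Y v =ᵐ[wMeasure₀ α] v :=
  Lp.coeFn_LpToLpOfMeasureLeSMul _ _ v

theorem inclL2w_injective (hα₀ : 0 < α) (hα₁ : α < 1) {Y : Type*} [NormedAddCommGroup Y]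
    [NormedSpace ℝ Y] : Function.Injective (inclL2w α Y) := by
  intro v w h
  refine Lp.ext ((ae_wMeasure₀_iff hα₀ hα₁).1 ?_)
  have h1 := coeFn_inclL2w α v
  rw [h] at h1
  exact h1.symm.trans (coeFn_inclL2w α w)

theorem inclL2w_compLpL {Y Z : Type*} [NormedAddCommGroup Y] [NormedSpace ℝ Y]
    [NormedAddCommGroup Z] [NormedSpace ℝ Z] (L : Y →L[ℝ] Z) (v : L2w α Y) :
    inclL2w α Z (L.compLpL 2 (wMeasure α) v) = L.compLpL 2 (wMeasure₀ α) (inclL2w α Y v) := by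
  have hac : wMeasure₀ α ≪ wMeasure α := Measure.absolutelyContinuous_of_le_smul (wMeasure₀_le α)
  refine Lp.ext ?_
  filter_upwards [coeFn_inclL2w α (L.compLpL 2 (wMeasure α) v),
    L.coeFn_compLpL (inclL2w α Y v), coeFn_inclL2w α v, hac.ae_le (L.coeFn_compLpL v)]
    with a h1 h2 h3 h4
  rw [h1, h2, h3, h4]

theorem inclL2w_smulVec {Y : Type*} [NormedAddCommGroup Y] [NormedSpace ℝ Y] (y : Y)
    (g : L2w α ℝ) :
    inclL2w α Y (smulVec (wMeasure α) y g) = smulVec (wMeasure₀ α) y (inclL2w α ℝ g) :=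
  inclL2w_compLpL (ContinuousLinearMap.toSpanSingleton ℝ y) g

theorem inner_inclL2w (hα₀ : 0 < α) (hα₁ : α < 1) {K : Type*} [NormedAddCommGroup K]
    [InnerProductSpace ℝ K] (v w : L2w α K) :
    inner ℝ (inclL2w α K v) (inclL2w α K w) =
      ∫ θ, (1 - θ) * inner ℝ (v θ) (w θ) ∂(wMeasure α) := by
  rw [L2.inner_def]
  have h : ∫ θ, inner ℝ (inclL2w α K v θ) (inclL2w α K w θ) ∂(wMeasure₀ α) =
      ∫ θ, inner ℝ (v θ) (w θ) ∂(wMeasure₀ α) := by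
    refine integral_congr_ae ?_
    filter_upwards [coeFn_inclL2w α v, coeFn_inclL2w α w] with θ h1 h2
    rw [h1, h2]
  rw [h, integral_wMeasure₀ hα₀ hα₁]
  rfl

variable {X H : Type*} [NormedAddCommGroup X] [NormedSpace ℝ X]
  [NormedAddCommGroup H] [InnerProductSpace ℝ H]

theorem opC_eq (hα₀ : 0 < α) (hα₁ : α < 1) [IsProbabilityMeasure (wMeasure α)] (u₀ : X)
    (v : L2w α X) : opC α u₀ v = u₀ + meanL (wMeasure α) X v := by
  rw [opC, meanL_apply, integral_wMeasure hα₀ hα₁]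
  rfl

theorem liftL2w_smulVec (i : X →L[ℝ] H) (x : X) (g : L2w α ℝ) :
    liftL2w i α (smulVec (wMeasure α) x g) = smulVec (wMeasure α) (i x) g :=
  compLpL_smulVec i x g

theorem coeFn_liftL2w (i : X →L[ℝ] H) (v : L2w α X) :
    liftL2w i α v =ᵐ[wMeasure α] fun θ => i (v θ) :=
  i.coeFn_compLpL v

theorem augEmb_apply (i : X →L[ℝ] H) (v : L2w α X) :
    augEmb i α v = inclL2w α H (liftL2w i α v) := rfl

/-- The weight `θ w_α` is the difference of the weights `w_α` and `(1 - θ) w_α`. -/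
theorem historyEnergy_eq (hα₀ : 0 < α) (hα₁ : α < 1) (i : X →L[ℝ] H) (v : L2w α X) :
    historyEnergy i α v = (1 / 2) * (‖liftL2w i α v‖ ^ 2 - ‖augEmb i α v‖ ^ 2) := by
  rw [historyEnergy, ← real_inner_self_eq_norm_sq (augEmb i α v), augEmb_apply,
    inner_inclL2w hα₀ hα₁, norm_sq_eq_integral]
  congr 1
  have h1 := integrable_norm_sq (liftL2w i α v)
  have h2 : Integrable (fun θ => (1 - θ) * inner ℝ (liftL2w i α v θ) (liftL2w i α v θ))
      (wMeasure α) := by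
    simp only [real_inner_self_eq_norm_sq]
    exact integrable_one_sub_mul h1
  rw [← integral_sub h1 h2, integral_wMeasure hα₀ hα₁]
  refine integral_congr_ae ?_
  filter_upwards [(ae_wMeasure_iff hα₀ hα₁).1 (coeFn_liftL2w i v)] with θ h3
  rw [h3, real_inner_self_eq_norm_sq, weight, smul_eq_mul]
  ring

/-- The first variation of the augmented energy. -/
theorem hasLineDerivAt_augEnergy (hα₀ : 0 < α) (hα₁ : α < 1) [IsProbabilityMeasure (wMeasure α)]
    (i : X →L[ℝ] H) {E : X → ℝ} (hE : Differentiable ℝ E) (u₀ : X) (v w : L2w α X) :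
    HasLineDerivAt ℝ (augEnergy i E α u₀)
      (gradH E (opC α u₀ v) (meanL (wMeasure α) X w) +
        (inner ℝ (liftL2w i α v) (liftL2w i α w) - inner ℝ (augEmb i α v) (augEmb i α w))) v w := by
  have h1 : HasDerivAt (fun s : ℝ => E (opC α u₀ (v + s • w)))
      (gradH E (opC α u₀ v) (meanL (wMeasure α) X w)) 0 := by
    have hd : HasDerivAt (fun s : ℝ => opC α u₀ (v + s • w)) (meanL (wMeasure α) X w) 0 := by
      simp only [opC_eq hα₀ hα₁, map_add, map_smul, ← add_assoc]
      simpa using ((hasDerivAt_id (0 : ℝ)).smul_const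
        (meanL (wMeasure α) X w)).const_add (u₀ + meanL (wMeasure α) X v)
    have he : HasFDerivAt E (gradH E (opC α u₀ v)) (opC α u₀ (v + (0 : ℝ) • w)) := by
      rw [zero_smul, add_zero]
      exact (hE _).hasFDerivAt
    exact he.comp_hasDerivAt 0 hd
  have h2 : ∀ {K : Type _} [NormedAddCommGroup K] [InnerProductSpace ℝ K] (a b : K),
      HasDerivAt (fun s : ℝ => ‖a + s • b‖ ^ 2) (2 * inner ℝ a b) 0 := by
    intro K _ _ a b
    have hd : HasDerivAt (fun s : ℝ => a + s • b) b 0 := by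
      simpa using ((hasDerivAt_id (0 : ℝ)).smul_const b).const_add a
    simpa using hd.norm_sq
  have h3 := (((h2 (liftL2w i α v) (liftL2w i α w)).sub
    (h2 (augEmb i α v) (augEmb i α w))).const_mul (1 / 2 : ℝ))
  have h4 : (fun s : ℝ => historyEnergy i α (v + s • w)) = fun s : ℝ =>
      (1 / 2 : ℝ) * (‖liftL2w i α v + s • liftL2w i α w‖ ^ 2 -
        ‖augEmb i α v + s • augEmb i α w‖ ^ 2) := by
    funext s
    rw [historyEnergy_eq hα₀ hα₁, map_add, map_add, map_smul, map_smul]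
  have h5 : HasDerivAt (fun s : ℝ => historyEnergy i α (v + s • w))
      (inner ℝ (liftL2w i α v) (liftL2w i α w) - inner ℝ (augEmb i α v) (augEmb i α w)) 0 := by
    rw [h4]
    refine h3.congr_deriv ?_
    ring
  exact h1.add h5

end WeightedSpaces

/-! ### The series of modes -/

section ProdDensity

variable {α T : ℝ}

theorem prod_wMeasure₀ (hα₀ : 0 < α) (hα₁ : α < 1) (τ : Measure ℝ) [SFinite τ] :
    τ.prod (wMeasure₀ α) =
      (τ.prod (wMeasure α)).withDensity fun z => ENNReal.ofReal (1 - z.2) := by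
  rw [wMeasure₀_eq hα₀ hα₁, prod_withDensity_right measurable_one_sub]

theorem integrable_prod_wMeasure₀_iff (hα₀ : 0 < α) (hα₁ : α < 1) (T : ℝ) (g : ℝ × ℝ → ℝ) :
    Integrable g ((timeMeasure T).prod (wMeasure₀ α)) ↔
      Integrable (fun z => (1 - z.2) * g z) ((timeMeasure T).prod (wMeasure α)) := by
  rw [prod_wMeasure₀ hα₀ hα₁, integrable_withDensity_iff_integrable_smul'
    (show Measurable fun z : ℝ × ℝ => ENNReal.ofReal (1 - z.2) from
      measurable_one_sub.comp measurable_snd)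
    (Eventually.of_forall fun _ => ENNReal.ofReal_lt_top)]
  refine integrable_congr ((ae_prod_mem hα₀ hα₁ T).mono fun z hz => ?_)
  simp only [ENNReal.toReal_ofReal (sub_pos.2 hz.2.2).le, smul_eq_mul]

theorem integral_prod_wMeasure₀ (hα₀ : 0 < α) (hα₁ : α < 1) (T : ℝ) (g : ℝ × ℝ → ℝ) :
    ∫ z, g z ∂((timeMeasure T).prod (wMeasure₀ α)) =
      ∫ z, (1 - z.2) * g z ∂((timeMeasure T).prod (wMeasure α)) := by
  rw [prod_wMeasure₀ hα₀ hα₁, integral_withDensity_eq_integral_toReal_smul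
    (show Measurable fun z : ℝ × ℝ => ENNReal.ofReal (1 - z.2) from
      measurable_one_sub.comp measurable_snd)
    (Eventually.of_forall fun _ => ENNReal.ofReal_lt_top)]
  refine integral_congr_ae ((ae_prod_mem hα₀ hα₁ T).mono fun z hz => ?_)
  simp only [ENNReal.toReal_ofReal (sub_pos.2 hz.2.2).le, smul_eq_mul]

end ProdDensity

section Superposition

variable {X H : Type*} [NormedAddCommGroup X] [NormedSpace ℝ X]
  [NormedAddCommGroup H] [InnerProductSpace ℝ H] {i : X →L[ℝ] H} {A : X →L[ℝ] StrongDual ℝ X}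
  {C₁ C₂ : ℝ} {ι : Type*}

/-- The modes `f k` of the force of a solution with initial force `c`. -/
structure IsModeFamily (e : EigenBasis i A C₁ C₂ ι) (α T K : ℝ) (c : ι → ℝ) (f : ι → ℝ → ℝ) :
    Prop where
  cont : ∀ k, Continuous (f k)
  eq : ∀ k, ∀ t ∈ Icc 0 T, f k t = c k - e.lam k * volterra (gker α) (f k) t
  bounds : ∀ k, ModeBounds α T (e.lam k + C₂) K (c k) (f k)
  summable : Summable fun k => c k ^ 2 / (e.lam k + C₂)

theorem exists_isModeFamily (e : EigenBasis i A C₁ C₂ ι) {α T : ℝ} (hα₀ : 0 < α) (hα₁ : α < 1)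
    (hT : 0 ≤ T) (hC₂ : 0 ≤ C₂) {c : ι → ℝ} (hc : Summable fun k => c k ^ 2 / (e.lam k + C₂)) :
    ∃ K f, IsModeFamily e α T K c f := by
  obtain ⟨K, hK⟩ := exists_modeBounds hα₀ hα₁ hT hC₂
  choose f hf using fun k => hK (e.lam k) (c k) (e.pos k)
  exact ⟨K, f, fun k => (hf k).1, fun k => (hf k).2.1, fun k => (hf k).2.2, hc⟩

variable (e : EigenBasis i A C₁ C₂ ι) {α T K : ℝ} {c : ι → ℝ} {f : ι → ℝ → ℝ}

/-- The force with modes `f k`. -/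
def forceSeries (f : ι → ℝ → ℝ) (t : ℝ) : H :=
  ∑' k, ContinuousLinearMap.toSpanSingleton ℝ (e.b k) (f k t)

/-- The augmented state whose modes are the memory variables of `f k`. -/
def memorySeries (α : ℝ) (f : ι → ℝ → ℝ) (t : ℝ) : L2w α X :=
  ∑' k, smulVec (wMeasure α) (e.x k) (sectionLp (wMeasure α) (memory (f k)) t)

/-- The time derivative of the augmented state. -/
def rateSeries (α : ℝ) (f : ι → ℝ → ℝ) (t : ℝ) : L2w₀ α H :=
  ∑' k, smulVec (wMeasure₀ α) (e.b k) (sectionLp (wMeasure₀ α) (memoryRate (f k)) t)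

theorem EigenBasis.norm_sum_b (F : Finset ι) (y : ι → ℝ) :
    1 * ‖∑ k ∈ F, y k • e.b k‖ ^ 2 ≤ ∑ k ∈ F, 1 * y k ^ 2 := by
  rw [one_mul, ← real_inner_self_eq_norm_sq, e.b.orthonormal.inner_sum]
  refine Finset.sum_le_sum fun k _ => ?_
  simp [sq]

variable {e} in
theorem IsModeFamily.summable_of_le (hf : IsModeFamily e α T K c f) {a : ι → ℝ}
    (h0 : ∀ k, 0 ≤ a k) (h : ∀ k, (e.lam k + C₂) * a k ≤ K * c k ^ 2) :
    Summable a ∧ ∑' k, a k ≤ ∑' k, K * (c k ^ 2 / (e.lam k + C₂)) := by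
  have h1 : ∀ k, a k ≤ K * (c k ^ 2 / (e.lam k + C₂)) := fun k => by
    rw [← mul_div_assoc, le_div_iff₀ (e.pos k), mul_comm]
    exact h k
  have hs := Summable.of_nonneg_of_le h0 h1 (hf.summable.mul_left K)
  exact ⟨hs, hs.tsum_le_tsum h1 (hf.summable.mul_left K)⟩

theorem memLp_memory (hα₀ : 0 < α) (hα₁ : α < 1) (hf : IsModeFamily e α T K c f) (k : ι) {t : ℝ}
    (ht : 0 ≤ t) : MemLp (memory (f k) t) 2 (wMeasure α) :=
  (memLp_two_iff_integrable_sq (stronglyMeasurable_section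
    (stronglyMeasurable_memory (hf.cont k)) t).aestronglyMeasurable).2
    (integrable_memory_sq hα₀ hα₁ (hf.cont k) ht)

theorem integrable_memoryRate_prod (hα₀ : 0 < α) (hα₁ : α < 1) (hf : IsModeFamily e α T K c f)
    (k : ι) : Integrable (fun z : ℝ × ℝ => memoryRate (f k) z.1 z.2 ^ 2)
      ((timeMeasure T).prod (wMeasure₀ α)) :=
  (integrable_prod_wMeasure₀_iff hα₀ hα₁ T _).2 (hf.bounds k).integrable_rate

variable [Countable ι]

theorem memLp_forceSeries [CompleteSpace H] (hf : IsModeFamily e α T K c f) :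
    (∀ᵐ t ∂(timeMeasure T),
      Summable fun k => ContinuousLinearMap.toSpanSingleton ℝ (e.b k) (f k t)) ∧
    MemLp (forceSeries e f) 2 (timeMeasure T) := by
  have hm : ∀ k, MemLp (f k) 2 (timeMeasure T) := fun k =>
    (memLp_two_iff_integrable_sq (hf.cont k).aestronglyMeasurable).2
      (integrable_of_continuous ((hf.cont k).pow 2) T)
  refine memLp_two_tsum (S := fun k => ContinuousLinearMap.toSpanSingleton ℝ (e.b k))
    (M := fun _ => 1) (fun _ => zero_le_one) zero_lt_one (fun F y => ?_) hm ?_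
  · have := e.norm_sum_b F y
    simpa only [ContinuousLinearMap.toSpanSingleton_apply, Real.norm_eq_abs, sq_abs] using this
  · simp only [one_mul, Real.norm_eq_abs, sq_abs]
    exact (hf.summable_of_le (fun k => integral_nonneg fun _ => sq_nonneg _)
      fun k => (hf.bounds k).force).1

theorem memLp_memorySeries [CompleteSpace X] (hα₀ : 0 < α) (hα₁ : α < 1)
    (hf : IsModeFamily e α T K c f) :
    (∀ᵐ t ∂(timeMeasure T), Summable fun k =>
      smulVec (wMeasure α) (e.x k) (sectionLp (wMeasure α) (memory (f k)) t)) ∧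
    MemLp (memorySeries e α f) 2 (timeMeasure T) := by
  have hm : ∀ k, _ := fun k => memLp_sectionLp (stronglyMeasurable_memory (hf.cont k))
    (integrable_memory_sq_prod hα₀ hα₁ (hf.cont k) T)
  refine memLp_two_tsum (S := fun k => smulVec (wMeasure α) (e.x k))
    (M := fun k => e.lam k + C₂) (fun k => (e.pos k).le) e.C₁_pos
    (fun F y => norm_sum_smulVec_le e.norm_sum_le F y) (fun k => (hm k).2.1) ?_
  refine (hf.summable_of_le (fun k => mul_nonneg (e.pos k).le
    (integral_nonneg fun _ => by positivity)) fun k => ?_).1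
  rw [(hm k).2.2, ← mul_assoc, ← sq]
  exact (hf.bounds k).memory_sq

theorem memLp_rateSeries [CompleteSpace H] (hα₀ : 0 < α) (hα₁ : α < 1)
    (hf : IsModeFamily e α T K c f) :
    (∀ᵐ t ∂(timeMeasure T), Summable fun k =>
      smulVec (wMeasure₀ α) (e.b k) (sectionLp (wMeasure₀ α) (memoryRate (f k)) t)) ∧
    MemLp (rateSeries e α f) 2 (timeMeasure T) := by
  have hm : ∀ k, _ := fun k => memLp_sectionLp (stronglyMeasurable_memoryRate (hf.cont k))
    (integrable_memoryRate_prod e hα₀ hα₁ hf k)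
  refine memLp_two_tsum (S := fun k => smulVec (wMeasure₀ α) (e.b k))
    (M := fun k => 1) (fun k => zero_le_one) zero_lt_one
    (fun F y => norm_sum_smulVec_le e.norm_sum_b F y) (fun k => (hm k).2.1) ?_
  refine (hf.summable_of_le (fun k => mul_nonneg zero_le_one
    (integral_nonneg fun _ => by positivity)) fun k => ?_).1
  rw [(hm k).2.2, one_mul, integral_prod_wMeasure₀ hα₀ hα₁]
  exact (hf.bounds k).rate

/-- The modes of the force. -/
theorem inner_forceSeries [CompleteSpace H] (hf : IsModeFamily e α T K c f) :
    ∀ᵐ t ∂(timeMeasure T), ∀ k, inner ℝ (e.b k) (forceSeries e f t) = f k t := by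
  classical
  filter_upwards [(memLp_forceSeries e hf).1] with t ht k
  have h1 := (innerSL ℝ (e.b k)).map_tsum ht
  rw [innerSL_apply_apply] at h1
  rw [forceSeries, h1, tsum_eq_single k]
  · simp [e.b.orthonormal.1 k]
  · intro l hl
    simp [e.b.orthonormal.2 hl.symm]

/-- The modes of the augmented state. -/
theorem coeff_memorySeries [CompleteSpace X] (hα₀ : 0 < α) (hα₁ : α < 1)
    (hf : IsModeFamily e α T K c f) :
    ∀ᵐ t ∂(timeMeasure T), ∀ k, (innerSL ℝ (e.b k)).compLpL 2 (wMeasure α)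
      (liftL2w i α (memorySeries e α f t)) = sectionLp (wMeasure α) (memory (f k)) t := by
  classical
  filter_upwards [(memLp_memorySeries e hα₀ hα₁ hf).1] with t ht k
  have h1 := (((innerSL ℝ (e.b k)).compLpL 2 (wMeasure α)).comp (liftL2w i α)).map_tsum ht
  rw [ContinuousLinearMap.comp_apply] at h1
  rw [memorySeries, h1, tsum_eq_single k]
  · rw [ContinuousLinearMap.comp_apply, liftL2w_smulVec, compLpL_smulVec, smulVec_real, e.i_x]
    simp [e.b.orthonormal.1 k]
  · intro l hl
    rw [ContinuousLinearMap.comp_apply, liftL2w_smulVec, compLpL_smulVec, smulVec_real, e.i_x]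
    simp [e.b.orthonormal.2 hl.symm]

/-- The modes of the time derivative of the augmented state. -/
theorem coeff_rateSeries [CompleteSpace H] (hα₀ : 0 < α) (hα₁ : α < 1)
    (hf : IsModeFamily e α T K c f) :
    ∀ᵐ t ∂(timeMeasure T), ∀ k, (innerSL ℝ (e.b k)).compLpL 2 (wMeasure₀ α)
      (rateSeries e α f t) = sectionLp (wMeasure₀ α) (memoryRate (f k)) t := by
  classical
  filter_upwards [(memLp_rateSeries e hα₀ hα₁ hf).1] with t ht k
  have h1 := ((innerSL ℝ (e.b k)).compLpL 2 (wMeasure₀ α)).map_tsum ht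
  rw [rateSeries, h1, tsum_eq_single k]
  · rw [compLpL_smulVec, smulVec_real]
    simp [e.b.orthonormal.1 k]
  · intro l hl
    rw [compLpL_smulVec, smulVec_real]
    simp [e.b.orthonormal.2 hl.symm]

/-- Boundedness in time, from the pointwise bound on the memory of each mode. -/
theorem memLp_top_liftL2w_memorySeries [CompleteSpace X] [CompleteSpace H] (hα₀ : 0 < α)
    (hα₁ : α < 1) (hf : IsModeFamily e α T K c f) :
    MemLp (fun t => liftL2w i α (memorySeries e α f t)) ⊤ (timeMeasure T) := by
  obtain ⟨h1, h2⟩ := memLp_memorySeries e hα₀ hα₁ hf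
  refine memLp_top_of_bound ((liftL2w i α).continuous.comp_aestronglyMeasurable
    h2.aestronglyMeasurable) √(∑' k, K * (c k ^ 2 / (e.lam k + C₂))) ?_
  filter_upwards [h1, ae_timeMeasure_mem T] with t ht htT
  have h3 := (liftL2w i α).map_tsum ht
  rw [memorySeries, h3]
  simp only [liftL2w_smulVec, e.i_x]
  have h4 := hf.summable_of_le (a := fun k => ‖sectionLp (wMeasure α) (memory (f k)) t‖ ^ 2)
    (fun k => by positivity) fun k => by
      rw [norm_sectionLp_sq (memLp_memory e hα₀ hα₁ hf k htT.1.le)]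
      exact (hf.bounds k).memory_sup t (Ioo_subset_Icc_self htT)
  have h5 := (summable_of_norm_sq_sum_le (C := 1) zero_lt_one h4.1 (z := fun k =>
    smulVec (wMeasure α) (e.b k) (sectionLp (wMeasure α) (memory (f k)) t)) fun F => by
      simpa only [one_mul] using norm_sum_smulVec_le e.norm_sum_b F
        fun k => sectionLp (wMeasure α) (memory (f k)) t).2
  rw [one_mul] at h5
  exact Real.le_sqrt_of_sq_le (h5.trans h4.2)

end Superposition

/-! ### The equations satisfied by the series -/

section ModeSolution

theorem map_volterra {Y Z : Type*} [NormedAddCommGroup Y] [NormedSpace ℝ Y] [CompleteSpace Y]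
    [NormedAddCommGroup Z] [NormedSpace ℝ Z] [CompleteSpace Z] (L : Y →L[ℝ] Z) {k : ℝ → ℝ}
    {h : ℝ → Y} {t : ℝ} (ht : 0 ≤ t) (hi : IntegrableOn (fun s => k (t - s) • h s) (Ioo 0 t)) :
    L (volterra k h t) = volterra k (fun s => L (h s)) t := by
  rw [volterra_eq_setIntegral _ _ ht, volterra_eq_setIntegral _ _ ht, ← L.integral_comp_comm hi]
  simp only [map_smul]

theorem integrableOn_expKer_smul {Y : Type*} [NormedAddCommGroup Y] [NormedSpace ℝ Y]
    {h : ℝ → Y} {T t : ℝ} (hh : Integrable h (timeMeasure T)) (ht : t ∈ Icc 0 T) (θ : ℝ) :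
    IntegrableOn (fun s => expKer θ (t - s) • h s) (Ioo 0 t) := by
  have h1 := (intervalIntegrable_of_timeMeasure hh ht).continuousOn_smul
    (f := fun s => expKer θ (t - s))
    ((continuous_expKer θ).comp (continuous_const.sub continuous_id)).continuousOn
  rwa [intervalIntegrable_iff_integrableOn_Ioo_of_le ht.1] at h1

theorem map_memory {Y Z : Type*} [NormedAddCommGroup Y] [NormedSpace ℝ Y] [CompleteSpace Y]
    [NormedAddCommGroup Z] [NormedSpace ℝ Z] [CompleteSpace Z] (L : Y →L[ℝ] Z)
    {h : ℝ → Y} {T t : ℝ} (hh : Integrable h (timeMeasure T)) (ht : t ∈ Icc 0 T) (θ : ℝ) :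
    L (memory h t θ) = memory (fun s => L (h s)) t θ :=
  map_volterra L ht.1 (integrableOn_expKer_smul hh ht θ)

theorem memory_congr {Y : Type*} [NormedAddCommGroup Y] [NormedSpace ℝ Y] {h h' : ℝ → Y} {T t : ℝ}
    (ht : t ∈ Icc 0 T) (hh : ∀ᵐ s ∂(timeMeasure T), h s = h' s) (θ : ℝ) :
    memory h t θ = memory h' t θ :=
  volterra_congr ht (fun _ _ => rfl) hh

theorem integrable_memoryRate_mul {α T : ℝ} (hα₀ : 0 < α) (hα₁ : α < 1) {f : ℝ → ℝ}
    (hf : Continuous f) (hr : Integrable (fun z : ℝ × ℝ => memoryRate f z.1 z.2 ^ 2)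
      ((timeMeasure T).prod (wMeasure₀ α))) (η : L2w₀ α ℝ) :
    Integrable (fun z : ℝ × ℝ => memoryRate f z.1 z.2 * η z.2)
      ((timeMeasure T).prod (wMeasure₀ α)) := by
  have := isFiniteMeasure_wMeasure₀ hα₀ hα₁
  have h1 : MemLp (fun z : ℝ × ℝ => memoryRate f z.1 z.2) 2 ((timeMeasure T).prod (wMeasure₀ α)) :=
    (memLp_two_iff_integrable_sq (stronglyMeasurable_memoryRate hf).aestronglyMeasurable).2 hr
  have h2 : MemLp (fun z : ℝ × ℝ => η z.2) 2 ((timeMeasure T).prod (wMeasure₀ α)) :=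
    (Lp.memLp η).comp_snd _
  exact h1.integrable_mul h2

/-- The scalar memory variable is the primitive of its rate, in the weighted `L²` space. -/
theorem inclL2w_sectionLp_eq_integral {α T : ℝ} (hα₀ : 0 < α) (hα₁ : α < 1) {f : ℝ → ℝ}
    (hf : Continuous f) (hr : Integrable (fun z : ℝ × ℝ => memoryRate f z.1 z.2 ^ 2)
      ((timeMeasure T).prod (wMeasure₀ α))) {t : ℝ} (ht : t ∈ Icc 0 T) :
    inclL2w α ℝ (sectionLp (wMeasure α) (memory f) t) =
      ∫ s in (0 : ℝ)..t, sectionLp (wMeasure₀ α) (memoryRate f) s := by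
  have := isFiniteMeasure_wMeasure₀ hα₀ hα₁
  have hle : timeMeasure t ≤ timeMeasure T := Measure.restrict_mono_set _ (Ioo_subset_Ioo_right ht.2)
  have hr' : Integrable (fun z : ℝ × ℝ => memoryRate f z.1 z.2 ^ 2)
      ((timeMeasure t).prod (wMeasure₀ α)) :=
    hr.mono_measure (Measure.prod_mono hle le_rfl)
  obtain ⟨h1, h2, -⟩ := memLp_sectionLp (stronglyMeasurable_memoryRate hf) hr'
  have h3 : Integrable (sectionLp (wMeasure₀ α) (memoryRate f)) (timeMeasure t) :=
    h2.integrable (by norm_num)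
  have hmem : MemLp (memory f t) 2 (wMeasure α) :=
    (memLp_two_iff_integrable_sq (stronglyMeasurable_section
    (stronglyMeasurable_memory hf) t).aestronglyMeasurable).2 (integrable_memory_sq hα₀ hα₁ hf ht.1)
  -- test with `η` and apply Fubini, which reduces the claim to the pointwise identity
  refine ext_inner_left ℝ fun η => ?_
  rw [intervalIntegral_eq_timeMeasure _ ht.1, ← integral_inner h3]
  have h4 : ∀ᵐ s ∂(timeMeasure t), inner ℝ η (sectionLp (wMeasure₀ α) (memoryRate f) s) =
      ∫ θ, memoryRate f s θ * η θ ∂(wMeasure₀ α) := by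
    filter_upwards [h1] with s hs
    rw [L2.inner_def]
    refine integral_congr_ae ((coeFn_sectionLp hs).mono fun θ hθ => ?_)
    simp only [hθ]
    rfl
  have h5 := integrable_memoryRate_mul hα₀ hα₁ hf hr' η
  rw [integral_congr_ae h4, integral_integral_swap h5, L2.inner_def]
  have hac : wMeasure₀ α ≪ wMeasure α := Measure.absolutelyContinuous_of_le_smul (wMeasure₀_le α)
  refine integral_congr_ae ?_
  filter_upwards [coeFn_inclL2w α (sectionLp (wMeasure α) (memory f) t),
    hac.ae_le (coeFn_sectionLp hmem)] with θ h6 h7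
  rw [h6, h7, integral_mul_const, ← intervalIntegral_eq_timeMeasure _ ht.1,
    ← memory_eq_integral (integrable_of_continuous hf T) ht]
  rfl

variable {X H : Type*} [NormedAddCommGroup X] [NormedSpace ℝ X]
  [NormedAddCommGroup H] [InnerProductSpace ℝ H] [CompleteSpace H]
  {i : X →L[ℝ] H} {A : X →L[ℝ] StrongDual ℝ X}
  {C₁ C₂ : ℝ} {ι : Type*} [Countable ι] (e : EigenBasis i A C₁ C₂ ι) {α T K : ℝ}
  {F : X → StrongDual ℝ X} {u₀ : X} {f : ι → ℝ → ℝ}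
  {c : ι → ℝ}

theorem integrable_forceSeries (hf : IsModeFamily e α T K c f) :
    Integrable (forceSeries e f) (timeMeasure T) :=
  (memLp_forceSeries e hf).2.integrable (by norm_num)

theorem integrable_rateSeries (hα₀ : 0 < α) (hα₁ : α < 1) (hf : IsModeFamily e α T K c f) :
    Integrable (rateSeries e α f) (timeMeasure T) :=
  (memLp_rateSeries e hα₀ hα₁ hf).2.integrable (by norm_num)

theorem inner_memory_forceSeries (hf : IsModeFamily e α T K c f) {t : ℝ} (ht : t ∈ Icc 0 T)
    (θ : ℝ) (k : ι) : inner ℝ (e.b k) (memory (forceSeries e f) t θ) = memory (f k) t θ := by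
  rw [← innerSL_apply_apply (𝕜 := ℝ), map_memory (innerSL ℝ (e.b k))
    (integrable_forceSeries e hf) ht]
  exact memory_congr ht ((inner_forceSeries e hf).mono fun s hs => hs k) θ

theorem ae_inner_volterra_forceSeries (hα₀ : 0 < α) (hf : IsModeFamily e α T K c f) :
    ∀ᵐ t ∂(timeMeasure T), ∀ k, inner ℝ (e.b k) (volterra (gker α) (forceSeries e f) t) =
      volterra (gker α) (f k) t := by
  have h1 := integrable_forceSeries e hf
  filter_upwards [ae_integrableOn_volterra (integrable_gker hα₀ T) h1, ae_timeMeasure_mem T]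
    with t ht htT k
  rw [← innerSL_apply_apply (𝕜 := ℝ), map_volterra (innerSL ℝ (e.b k)) htT.1.le ht]
  exact volterra_congr (Ioo_subset_Icc_self htT) (fun _ _ => rfl)
    ((inner_forceSeries e hf).mono fun s hs => hs k)

variable [CompleteSpace X]

/-- Averaging the memory variables over `θ` turns the exponential kernels into `g_α`, mode by
mode. -/
theorem inner_opC_memorySeries (hα₀ : 0 < α) (hα₁ : α < 1) (hf : IsModeFamily e α T K c f)
    (u₀ : X) : ∀ᵐ t ∂(timeMeasure T), ∀ k,
      inner ℝ (e.b k) (i (opC α u₀ (memorySeries e α f t)) - i u₀) =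
        volterra (gker α) (f k) t := by
  have := isProbabilityMeasure_wMeasure hα₀ hα₁
  filter_upwards [coeff_memorySeries e hα₀ hα₁ hf, ae_timeMeasure_mem T] with t ht htT k
  rw [opC_eq hα₀ hα₁, map_add, add_sub_cancel_left, map_meanL, ← innerSL_apply_apply (𝕜 := ℝ),
    map_meanL]
  have h1 := ht k
  rw [liftL2w] at h1
  rw [h1, meanL_apply, ← integral_memory_of_continuous hα₀ hα₁ (hf.cont k) htT.1.le]
  exact integral_congr_ae (coeFn_sectionLp (memLp_memory e hα₀ hα₁ hf k htT.1.le))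

/-- The force is minus the gradient of the energy at the averaged augmented state. -/
theorem toDual_forceSeries (hα₀ : 0 < α) (hα₁ : α < 1) (hi : Function.Injective i)
    (hA : ∀ u, F u = F 0 + A u)
    (hf : IsModeFamily e α T K (fun k => -(F u₀ (e.x k))) f) :
    ∀ᵐ t ∂(timeMeasure T), toDual i (forceSeries e f t) =
      -F (opC α u₀ (memorySeries e α f t)) := by
  filter_upwards [inner_opC_memorySeries e hα₀ hα₁ hf u₀, inner_forceSeries e hf,
    ae_timeMeasure_mem T] with t h1 h2 htT
  refine e.dual_ext hi fun k => ?_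
  set u := opC α u₀ (memorySeries e α f t)
  have h3 : A u = A u₀ + A (u - u₀) := by rw [← map_add, add_sub_cancel]
  rw [toDual_apply, e.i_x, real_inner_comm, h2, hf.eq k t (Ioo_subset_Icc_self htT), hA u, h3,
    hA u₀, ← add_assoc, neg_apply, add_apply (F 0 + A u₀), e.A_apply_x, map_sub, h1]
  ring

/-- The averaged augmented state is the fractional integral of the force. -/
theorem opC_memorySeries_eq_volterra (hα₀ : 0 < α) (hα₁ : α < 1) (hf : IsModeFamily e α T K c f)
    (u₀ : X) : ∀ᵐ t ∂(timeMeasure T), i (opC α u₀ (memorySeries e α f t)) - i u₀ =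
      volterra (gker α) (forceSeries e f) t := by
  filter_upwards [inner_opC_memorySeries e hα₀ hα₁ hf u₀, ae_inner_volterra_forceSeries e hα₀ hf]
    with t h1 h2
  exact ext_of_coeff e.b fun k => by rw [h1, h2]

/-- The augmented state is, pointwise in `θ`, the memory variable of the force. -/
theorem memorySeries_apply (hα₀ : 0 < α) (hα₁ : α < 1) (hf : IsModeFamily e α T K c f) :
    ∀ᵐ t ∂(timeMeasure T), ∀ᵐ θ ∂(wMeasure α),
      i (memorySeries e α f t θ) = memory (forceSeries e f) t θ := by
  filter_upwards [coeff_memorySeries e hα₀ hα₁ hf, ae_timeMeasure_mem T] with t ht htT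
  have h1 : ∀ k, ∀ᵐ θ ∂(wMeasure α), inner ℝ (e.b k) (i (memorySeries e α f t θ)) =
      memory (f k) t θ := fun k => by
    filter_upwards [(innerSL ℝ (e.b k)).coeFn_compLpL (liftL2w i α (memorySeries e α f t)),
      coeFn_liftL2w i (memorySeries e α f t),
      coeFn_sectionLp (memLp_memory e hα₀ hα₁ hf k htT.1.le)] with θ h2 h3 h4
    rw [ht k, h4, h3] at h2
    exact h2.symm
  filter_upwards [ae_all_iff.2 h1] with θ hθ
  refine ext_of_coeff e.b fun k => ?_
  rw [hθ, inner_memory_forceSeries e hf (Ioo_subset_Icc_self htT)]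

/-- The equation `(1 - θ) ∂_t v = f - θ v` of the memory variable, for the series. -/
theorem rateSeries_apply (hα₀ : 0 < α) (hα₁ : α < 1) (hf : IsModeFamily e α T K c f) :
    ∀ᵐ t ∂(timeMeasure T), ∀ᵐ θ ∂(wMeasure₀ α),
      rateSeries e α f t θ =
        c₀ θ • (forceSeries e f t - θ • i (memorySeries e α f t θ)) := by
  have hm : ∀ᵐ t ∂(timeMeasure T), ∀ k, MemLp (memoryRate (f k) t) 2 (wMeasure₀ α) :=
    ae_all_iff.2 fun k => (memLp_sectionLp (stronglyMeasurable_memoryRate (hf.cont k))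
      (integrable_memoryRate_prod e hα₀ hα₁ hf k)).1
  filter_upwards [coeff_rateSeries e hα₀ hα₁ hf, memorySeries_apply e hα₀ hα₁ hf,
    inner_forceSeries e hf, hm, ae_timeMeasure_mem T] with t h1 h2 h3 h4 htT
  have h5 : ∀ k, ∀ᵐ θ ∂(wMeasure₀ α), inner ℝ (e.b k) (rateSeries e α f t θ) =
      memoryRate (f k) t θ := fun k => by
    filter_upwards [(innerSL ℝ (e.b k)).coeFn_compLpL (rateSeries e α f t),
      coeFn_sectionLp (h4 k)] with θ h2 h3
    rw [h1 k, h3] at h2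
    exact h2.symm
  filter_upwards [ae_all_iff.2 h5, (ae_wMeasure₀_iff hα₀ hα₁).2 h2] with θ hθ h6
  refine ext_of_coeff e.b fun k => ?_
  rw [hθ, h6, real_inner_smul_right, inner_sub_right, real_inner_smul_right, h3,
    inner_memory_forceSeries e hf (Ioo_subset_Icc_self htT)]
  rfl

/-- The augmented state is the primitive of its rate, starting from zero. -/
theorem augEmb_memorySeries (hα₀ : 0 < α) (hα₁ : α < 1) (hf : IsModeFamily e α T K c f) :
    ∀ᵐ t ∂(timeMeasure T), augEmb i α (memorySeries e α f t) =
      ∫ s in (0 : ℝ)..t, rateSeries e α f s := by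
  filter_upwards [coeff_memorySeries e hα₀ hα₁ hf, ae_timeMeasure_mem T] with t ht htT
  have htT' := Ioo_subset_Icc_self htT
  refine Lp_ext_of_coeff e.b fun k => ?_
  rw [augEmb_apply, ← inclL2w_compLpL, ht k, inclL2w_sectionLp_eq_integral hα₀ hα₁ (hf.cont k)
    (integrable_memoryRate_prod e hα₀ hα₁ hf k) htT',
    ← ContinuousLinearMap.intervalIntegral_comp_comm _
      (intervalIntegrable_of_timeMeasure (integrable_rateSeries e hα₀ hα₁ hf) htT')]
  rw [intervalIntegral_eq_timeMeasure _ htT.1.le, intervalIntegral_eq_timeMeasure _ htT.1.le]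
  have hle : timeMeasure t ≤ timeMeasure T :=
    Measure.restrict_mono_set _ (Ioo_subset_Ioo_right htT.2.le)
  exact integral_congr_ae (((coeff_rateSeries e hα₀ hα₁ hf).filter_mono (ae_mono hle)).mono
    fun s hs => (hs k).symm)

end ModeSolution

/-! ### The series solve both flows -/

section MemoryBounds

variable {Y : Type*} [NormedAddCommGroup Y] [NormedSpace ℝ Y]

/-- Jensen's inequality for the memory variable. -/
theorem norm_memory_sq_le {h : ℝ → Y} {t T : ℝ} (ht : t ∈ Icc 0 T)
    (hh : Integrable h (timeMeasure T)) (hh2 : Integrable (fun s => ‖h s‖ ^ 2) (timeMeasure T))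
    {θ : ℝ} (hθ : θ ∈ Ioo (0 : ℝ) 1) :
    ‖memory h t θ‖ ^ 2 ≤ (2 + 2 * T) * volterra (expKer θ) (fun s => ‖h s‖ ^ 2) t := by
  have hT : 0 ≤ T := ht.1.trans ht.2
  set L := 2 + 2 * T with hL
  have hL0 : 0 < L := by positivity
  have h1 := integrableOn_expKer_smul hh.norm ht θ
  have h2 := integrableOn_expKer_smul hh2 ht θ
  have h3 := integrableOn_expKer_smul (integrable_const_timeMeasure T (1 : ℝ)) ht θ
  set x := ∫ s in Ioo 0 t, expKer θ (t - s) • ‖h s‖ with hx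
  set P := ∫ s in Ioo 0 t, expKer θ (t - s) • (1 : ℝ) with hP
  have hPL : P ≤ L := by
    rw [hP, ← volterra_eq_setIntegral _ (fun _ => (1 : ℝ)) ht.1, volterra_comm, volterra_one]
    exact integral_expKer_le hθ ht
  have hxn : ‖memory h t θ‖ ≤ x := by
    rw [memory, volterra_eq_setIntegral _ _ ht.1]
    refine (norm_integral_le_integral_norm _).trans (le_of_eq ?_)
    refine integral_congr_ae (Eventually.of_forall fun s => ?_)
    simp only
    rw [norm_smul, Real.norm_of_nonneg (expKer_pos hθ _).le, smul_eq_mul]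
  rw [volterra_eq_setIntegral _ _ ht.1]
  -- expand the square of the deviation of `‖h‖` from the constant `x / L`
  have h4 : 0 ≤ ∫ s in Ioo 0 t, expKer θ (t - s) • (‖h s‖ - x / L) ^ 2 :=
    integral_nonneg fun s => smul_nonneg (expKer_pos hθ _).le (sq_nonneg _)
  have h5 : ∫ s in Ioo 0 t, expKer θ (t - s) • (‖h s‖ - x / L) ^ 2 =
      (∫ s in Ioo 0 t, expKer θ (t - s) • ‖h s‖ ^ 2) - 2 * (x / L) * x + (x / L) ^ 2 * P := by
    generalize x / L = a
    have h12 : IntegrableOn (fun s => expKer θ (t - s) • ‖h s‖ ^ 2 -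
        2 * a * (expKer θ (t - s) • ‖h s‖)) (Ioo 0 t) := h2.sub (h1.const_mul _)
    rw [hx, hP, ← integral_const_mul, ← integral_const_mul, ← integral_sub h2 (h1.const_mul _),
      ← integral_add h12 (h3.const_mul _)]
    refine integral_congr_ae (Eventually.of_forall fun s => ?_)
    simp only [smul_eq_mul]
    ring
  rw [h5] at h4
  have h6 : (x / L) ^ 2 * P ≤ x ^ 2 / L := by
    refine (mul_le_mul_of_nonneg_left hPL (sq_nonneg _)).trans (le_of_eq ?_)
    field_simp
  have h7 : 2 * (x / L) * x = 2 * (x ^ 2 / L) := by ring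
  have h8 : x ^ 2 / L ≤ ∫ s in Ioo 0 t, expKer θ (t - s) • ‖h s‖ ^ 2 := by linarith
  rw [div_le_iff₀ hL0, mul_comm] at h8
  exact (pow_le_pow_left₀ (norm_nonneg _) hxn 2).trans h8

/-- Young's inequality in `L²` for the memory variable, with a constant uniform in `θ`. -/
theorem eLpNorm_memory_le [CompleteSpace Y] {h : ℝ → Y} {T : ℝ} (hT : 0 ≤ T)
    (hi : Integrable h) (hh : MemLp h 2 (timeMeasure T)) {θ : ℝ}
    (hθ : θ ∈ Ioo (0 : ℝ) 1) :
    eLpNorm (fun t => memory h t θ) 2 (timeMeasure T) ≤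
      ENNReal.ofReal √((2 + 2 * T) * ((2 + 2 * T) * ∫ s, ‖h s‖ ^ 2 ∂(timeMeasure T))) := by
  have hh1 : Integrable h (timeMeasure T) := hi.restrict
  have hh2 : Integrable (fun s => ‖h s‖ ^ 2) (timeMeasure T) := hh.integrable_norm_pow (by norm_num)
  have hc : Continuous fun t => memory h t θ :=
    continuous_memory_of_intervalIntegrable (fun a b => hi.intervalIntegrable) θ
  have h1 := integrable_volterra (integrable_expKer θ T) hh2
  have hint : Integrable (fun t => ‖memory h t θ‖ ^ 2) (timeMeasure T) :=
    integrable_of_continuous (by fun_prop) T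
  have h2 : ∫ t, ‖memory h t θ‖ ^ 2 ∂(timeMeasure T) ≤
      (2 + 2 * T) * ((2 + 2 * T) * ∫ s, ‖h s‖ ^ 2 ∂(timeMeasure T)) := by
    refine (integral_mono_ae hint (h1.const_mul (2 + 2 * T)) ((ae_timeMeasure_mem T).mono
      fun t ht => norm_memory_sq_le (Ioo_subset_Icc_self ht) hh1 hh2 hθ)).trans ?_
    rw [integral_const_mul]
    refine mul_le_mul_of_nonneg_left ?_ (by positivity)
    refine (integral_volterra_le (integrable_expKer θ T) hh2 (fun s _ => (expKer_pos hθ s).le)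
      fun _ _ => by positivity).trans ?_
    refine mul_le_mul_of_nonneg_right ?_ (integral_nonneg fun _ => by positivity)
    rw [← intervalIntegral_eq_timeMeasure _ hT]
    exact integral_expKer_le hθ ⟨hT, le_rfl⟩
  have hmem : MemLp (fun t => memory h t θ) 2 (timeMeasure T) :=
    (memLp_two_iff_integrable_sq_norm hc.aestronglyMeasurable).2 hint
  rw [hmem.eLpNorm_eq_integral_rpow_norm (by norm_num) (by norm_num)]
  refine ENNReal.ofReal_le_ofReal ?_
  simp only [ENNReal.toReal_ofNat, Real.rpow_two]
  rw [Real.sqrt_eq_rpow, ← one_div]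
  exact Real.rpow_le_rpow (integral_nonneg fun _ => by positivity) h2 (by norm_num)

end MemoryBounds

/-- The memory of minus the gradient is the right-hand side of the correspondence. -/
theorem opG_eq {X : Type*} [NormedAddCommGroup X] [NormedSpace ℝ X] (E : X → ℝ) (u : ℝ → X) (t θ : ℝ) :
    opG E u t θ = memory (fun s => -gradH E (u s)) t θ := by
  rw [opG, memory, volterra, ← intervalIntegral.integral_smul, ← intervalIntegral.integral_neg]
  refine intervalIntegral.integral_congr fun s _ => ?_
  rw [expKer, smul_neg, mul_smul]

section ModeSolutions

variable {X H : Type*} [NormedAddCommGroup X] [NormedSpace ℝ X]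
  [NormedAddCommGroup H] [InnerProductSpace ℝ H]
  {i : X →L[ℝ] H} {A : X →L[ℝ] StrongDual ℝ X}
  {C₁ C₂ : ℝ} {ι : Type*} [Countable ι] (e : EigenBasis i A C₁ C₂ ι) {α T K : ℝ}
  {E : X → ℝ} {u₀ : X} {f : ι → ℝ → ℝ} {c : ι → ℝ} [CompleteSpace X]

/-- The state of the fractional flow with forces `f k`. -/
def stateSeries (α : ℝ) (u₀ : X) (f : ι → ℝ → ℝ) (t : ℝ) : X :=
  opC α u₀ (memorySeries e α f t)

theorem memLp_stateSeries (hα₀ : 0 < α) (hα₁ : α < 1) (hf : IsModeFamily e α T K c f) :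
    MemLp (stateSeries e α u₀ f) 2 (timeMeasure T) := by
  have := isProbabilityMeasure_wMeasure hα₀ hα₁
  have h1 : ∀ t, u₀ + meanL (wMeasure α) X (memorySeries e α f t) = stateSeries e α u₀ f t :=
    fun t => (opC_eq hα₀ hα₁ u₀ _).symm
  have h2 : MemLp (fun t => meanL (wMeasure α) X (memorySeries e α f t)) 2 (timeMeasure T) :=
    (meanL (wMeasure α) X).comp_memLp' (memLp_memorySeries e hα₀ hα₁ hf).2
  have h3 : MemLp (fun _ : ℝ => u₀) 2 (timeMeasure T) := memLp_const _
  exact (h3.add h2).ae_eq (Eventually.of_forall h1)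

variable [CompleteSpace H]

theorem memLp_top_stateSeries (hα₀ : 0 < α) (hα₁ : α < 1) (hf : IsModeFamily e α T K c f) :
    MemLp (fun t => i (stateSeries e α u₀ f t)) ⊤ (timeMeasure T) := by
  have := isProbabilityMeasure_wMeasure hα₀ hα₁
  have h1 : ∀ t, i u₀ + meanL (wMeasure α) H (liftL2w i α (memorySeries e α f t)) =
      i (stateSeries e α u₀ f t) := fun t => by
    rw [stateSeries, opC_eq hα₀ hα₁, map_add, map_meanL, liftL2w]
  have h2 : MemLp (fun t => meanL (wMeasure α) H (liftL2w i α (memorySeries e α f t))) ⊤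
      (timeMeasure T) :=
    (meanL (wMeasure α) H).comp_memLp' (memLp_top_liftL2w_memorySeries e hα₀ hα₁ hf)
  have h3 : MemLp (fun _ : ℝ => i u₀) ⊤ (timeMeasure T) := memLp_const _
  exact (h3.add h2).ae_eq (Eventually.of_forall h1)

/-- The fractional integral of order `1 - α` of the state is the primitive of the force. -/
theorem rlIntegral_stateSeries (hα₀ : 0 < α) (hα₁ : α < 1) (hf : IsModeFamily e α T K c f) {t : ℝ}
    (ht : t ∈ Icc 0 T) :
    rlIntegral (1 - α) (fun s => i (stateSeries e α u₀ f s) - i u₀) t =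
      ∫ s in (0 : ℝ)..t, forceSeries e f s := by
  rw [rlIntegral_eq_volterra, ← integral_eq_volterra_gker hα₀ hα₁ ht (integrable_forceSeries e hf)]
  exact volterra_congr ht (fun _ _ => rfl) (opC_memorySeries_eq_volterra e hα₀ hα₁ hf u₀)

theorem continuousOn_integral {Y : Type*} [NormedAddCommGroup Y] [NormedSpace ℝ Y] {h : ℝ → Y}
    (hT : 0 ≤ T) (hh : Integrable h (timeMeasure T)) :
    ContinuousOn (fun t => ∫ s in (0 : ℝ)..t, h s) (Icc 0 T) := by
  rw [← uIcc_of_le hT]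
  exact intervalIntegral.continuousOn_primitive_interval'
    (intervalIntegrable_of_timeMeasure hh ⟨hT, le_rfl⟩) left_mem_uIcc

theorem memFracSobolev_stateSeries (hα₀ : 0 < α) (hα₁ : α < 1) (hf : IsModeFamily e α T K c f) :
    MemFracSobolev α 2 T (fun t => i (stateSeries e α u₀ f t)) (i u₀) := by
  refine ⟨i.comp_memLp' (memLp_stateSeries e hα₀ hα₁ hf), forceSeries e f,
    (memLp_forceSeries e hf).2, hasWeakDeriv_of_eq_integral (integrable_forceSeries e hf) ?_⟩
  exact (ae_timeMeasure_mem T).mono fun t ht =>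
    rlIntegral_stateSeries e hα₀ hα₁ hf (Ioo_subset_Icc_self ht)

/-- The time derivative required by the variational solution is the force, embedded into `X'`. -/
theorem isFractionalSolution_stateSeries (hT : 0 < T) (hα₀ : 0 < α) (hα₁ : α < 1)
    (hi : Function.Injective i)
    (hE : Differentiable ℝ E) (hA : ∀ u, gradH E u = gradH E 0 + A u)
    (hf : IsModeFamily e α T K (fun k => -(gradH E u₀ (e.x k))) f) :
    IsFractionalSolution i E α 2 2 T (i u₀) (stateSeries e α u₀ f) := by
  have hu := memLp_stateSeries e (u₀ := u₀) hα₀ hα₁ hf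
  have hh := memLp_forceSeries e hf
  have hhi := integrable_forceSeries e hf
  have hα : 0 < 1 - α := by linarith
  have hrl := fun t ht => rlIntegral_stateSeries e (u₀ := u₀) (t := t) hα₀ hα₁ hf ht
  have hcont := continuousOn_integral hT.le hhi
  refine ⟨?_, memLp_top_stateSeries e hα₀ hα₁ hf, ?_,
    ⟨fun t => toDual i (forceSeries e f t), ?_, ?_, ?_⟩, ?_, ?_⟩
  · rwa [ENNReal.ofReal_ofNat]
  · rw [ENNReal.ofReal_ofNat]
    exact ((toDualL i).comp i).comp_memLp' hu
  · rw [ENNReal.ofReal_ofNat]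
    exact (toDualL i).comp_memLp' hh.2
  · refine hasWeakDeriv_of_eq_integral ((toDualL i).integrable_comp hhi) ?_
    have hui : Integrable (fun s => i (stateSeries e α u₀ f s) - i u₀) (timeMeasure T) :=
      ((i.comp_memLp' hu).integrable (by norm_num)).sub (integrable_const_timeMeasure T _)
    filter_upwards [ae_integrableOn_volterra (integrable_gker hα T) hui, ae_timeMeasure_mem T]
      with t h1 ht
    have h2 := map_volterra (toDualL i) ht.1.le h1
    rw [← rlIntegral_eq_volterra, hrl t (Ioo_subset_Icc_self ht),
      ← ContinuousLinearMap.intervalIntegral_comp_comm _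
      (intervalIntegrable_of_timeMeasure hhi (Ioo_subset_Icc_self ht))] at h2
    simp only [map_sub] at h2
    exact h2.symm
  · filter_upwards [toDual_forceSeries e hα₀ hα₁ hi hA hf] with t ht v
    rw [ht, neg_apply, neg_neg]
    exact (hE _).hasFDerivAt.hasLineDerivAt v
  · exact hcont.congr fun t ht => hrl t ht
  · have h0 : Tendsto (fun t => ∫ s in (0 : ℝ)..t, forceSeries e f s) (𝓝[Icc 0 T] 0) (𝓝 0) := by
      have := hcont 0 ⟨le_rfl, hT.le⟩
      rwa [ContinuousWithinAt, intervalIntegral.integral_same] at this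
    have h1 : 𝓝[>] (0 : ℝ) ≤ 𝓝[Icc 0 T] 0 := by
      rw [← nhdsWithin_Ioc_eq_nhdsGT hT]
      exact nhdsWithin_mono 0 Ioc_subset_Icc_self
    refine (h0.mono_left h1).congr' ?_
    have h2 : ∀ᶠ t in 𝓝[>] (0 : ℝ), t ∈ Ioc 0 T := Ioc_mem_nhdsGT hT
    exact h2.mono fun t ht => (hrl t (Ioc_subset_Icc_self ht)).symm

/-- The equation of the augmented flow, tested with `w`. -/
theorem inner_rateSeries (hα₀ : 0 < α) (hα₁ : α < 1) [IsProbabilityMeasure (wMeasure α)]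
    (hf : IsModeFamily e α T K c f) :
    ∀ᵐ t ∂(timeMeasure T), ∀ w : L2w α X, inner ℝ (rateSeries e α f t) (augEmb i α w) =
      toDual i (forceSeries e f t) (meanL (wMeasure α) X w) -
        (inner ℝ (liftL2w i α (memorySeries e α f t)) (liftL2w i α w) -
          inner ℝ (augEmb i α (memorySeries e α f t)) (augEmb i α w)) := by
  filter_upwards [rateSeries_apply e hα₀ hα₁ hf] with t ht w
  set v := memorySeries e α f t
  set h := forceSeries e f t
  have h1 : inner ℝ (rateSeries e α f t) (augEmb i α w) =
      ∫ θ, (1 - θ) • inner ℝ (c₀ θ • (h - θ • i (v θ))) (liftL2w i α w θ) ∂(wMeasure α) := by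
    rw [L2.inner_def, ← integral_wMeasure₀ hα₀ hα₁]
    refine integral_congr_ae ?_
    filter_upwards [ht, coeFn_inclL2w α (liftL2w i α w)] with θ h1 h2
    rw [h1, augEmb_apply, h2]
  have hw : Integrable (fun θ => inner ℝ h (liftL2w i α w θ)) (wMeasure α) :=
    ((Lp.memLp (liftL2w i α w)).integrable (by norm_num)).const_inner h
  have hvw : Integrable (fun θ => inner ℝ (liftL2w i α v θ) (liftL2w i α w θ)) (wMeasure α) :=
    L2.integrable_inner _ _
  have hvw' : Integrable (fun θ => inner ℝ (liftL2w i α v θ) (liftL2w i α w θ) -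
      (1 - θ) * inner ℝ (liftL2w i α v θ) (liftL2w i α w θ)) (wMeasure α) :=
    hvw.sub (integrable_one_sub_mul hvw)
  have hm : i (meanL (wMeasure α) X w) = meanL (wMeasure α) H (liftL2w i α w) := map_meanL i w
  rw [h1, augEmb_apply i v, augEmb_apply i w, inner_inclL2w hα₀ hα₁, L2.inner_def, toDual_apply,
    hm, meanL_apply, ← integral_inner ((Lp.memLp _).integrable (by norm_num)),
    ← integral_sub hvw (integrable_one_sub_mul hvw)]
  rw [← integral_sub hw hvw']
  refine integral_congr_ae ?_
  filter_upwards [coeFn_liftL2w i v, ae_wMeasure_mem α] with θ h2 hθ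
  rw [h2, real_inner_smul_left, inner_sub_left, real_inner_smul_left, smul_eq_mul, ← mul_assoc,
    one_sub_mul_c₀ hθ]
  ring

theorem memSobolev_memorySeries (hα₀ : 0 < α) (hα₁ : α < 1) (hf : IsModeFamily e α T K c f) :
    MemSobolev 2 T (fun t => augEmb i α (memorySeries e α f t)) :=
  ⟨(augEmb i α).comp_memLp' (memLp_memorySeries e hα₀ hα₁ hf).2, rateSeries e α f,
    (memLp_rateSeries e hα₀ hα₁ hf).2, hasWeakDeriv_of_eq_integral
      (integrable_rateSeries e hα₀ hα₁ hf) (augEmb_memorySeries e hα₀ hα₁ hf)⟩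

/-- The time derivative required by the variational solution is the rate series, embedded into the
dual space. -/
theorem isGradientFlowSolution_memorySeries (hT : 0 < T) (hα₀ : 0 < α) (hα₁ : α < 1)
    (hi : Function.Injective i)
    (hE : Differentiable ℝ E) (hA : ∀ u, gradH E u = gradH E 0 + A u)
    (hf : IsModeFamily e α T K (fun k => -(gradH E u₀ (e.x k))) f) :
    IsGradientFlowSolution (augEmb i α) (augEnergy i E α u₀) 2 2 T 0 (memorySeries e α f) := by
  have := isProbabilityMeasure_wMeasure hα₀ hα₁
  have hv := (memLp_memorySeries e hα₀ hα₁ hf).2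
  have hD := memLp_rateSeries e hα₀ hα₁ hf
  have hDi := integrable_rateSeries e hα₀ hα₁ hf
  refine ⟨?_, ?_, ?_, ⟨fun t => toDual (augEmb i α) (rateSeries e α f t), ?_, ?_, ?_⟩,
    ⟨fun t => ∫ s in (0 : ℝ)..t, rateSeries e α f s, continuousOn_integral hT.le hDi, ?_, ?_⟩⟩
  · rwa [ENNReal.ofReal_ofNat]
  · exact (inclL2w α H).comp_memLp' (memLp_top_liftL2w_memorySeries e hα₀ hα₁ hf)
  · rw [ENNReal.ofReal_ofNat]
    exact ((toDualL (augEmb i α)).comp (augEmb i α)).comp_memLp' hv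
  · rw [ENNReal.ofReal_ofNat]
    exact (toDualL (augEmb i α)).comp_memLp' hD.2
  · refine hasWeakDeriv_of_eq_integral ((toDualL (augEmb i α)).integrable_comp hDi) ?_
    filter_upwards [augEmb_memorySeries e hα₀ hα₁ hf, ae_timeMeasure_mem T] with t h1 ht
    rw [h1, ← toDualL_apply, ← ContinuousLinearMap.intervalIntegral_comp_comm _
      (intervalIntegrable_of_timeMeasure hDi (Ioo_subset_Icc_self ht))]
    rfl
  · filter_upwards [inner_rateSeries e hα₀ hα₁ hf, toDual_forceSeries e hα₀ hα₁ hi hA hf]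
      with t h1 h2 w
    have h3 := hasLineDerivAt_augEnergy hα₀ hα₁ i hE u₀ (memorySeries e α f t) w
    rw [toDual_apply, h1, h2, neg_apply, neg_sub, sub_neg_eq_add, add_comm]
    exact h3
  · exact (augEmb_memorySeries e hα₀ hα₁ hf).mono fun t ht => ht.symm
  · simp only [intervalIntegral.integral_same]

theorem corresponds_memorySeries (hα₀ : 0 < α) (hα₁ : α < 1) (hi : Function.Injective i)
    (hA : ∀ u, gradH E u = gradH E 0 + A u)
    (hf : IsModeFamily e α T K (fun k => -(gradH E u₀ (e.x k))) f) :
    Corresponds i E α T u₀ (stateSeries e α u₀ f) (memorySeries e α f) := by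
  refine ⟨Eventually.of_forall fun t => rfl, ?_⟩
  filter_upwards [memorySeries_apply e hα₀ hα₁ hf, ae_timeMeasure_mem T] with t ht htT
  refine (ae_wMeasure_iff hα₀ hα₁).1 (ht.mono fun θ hθ => ?_)
  rw [hθ, opG_eq, ← toDualL_apply, map_memory (toDualL i) (integrable_forceSeries e hf)
    (Ioo_subset_Icc_self htT)]
  exact memory_congr (Ioo_subset_Icc_self htT) (toDual_forceSeries e hα₀ hα₁ hi hA hf) θ

theorem memLinftyLq_memorySeries (hT : 0 ≤ T) (hα₀ : 0 < α) (hα₁ : α < 1)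
    (hf : IsModeFamily e α T K c f) : MemLinftyLq i α 2 T (memorySeries e α f) := by
  -- a strongly measurable representative of the force makes its memory jointly measurable in
  -- `(t, θ)`, and gives a bound for every `θ` instead of almost every pair
  obtain ⟨g, hg, hgh⟩ := (memLp_forceSeries e hf).2.aestronglyMeasurable
  set h := (Ioo 0 T).indicator g with hh
  have hgh' : ∀ᵐ s ∂(timeMeasure T), forceSeries e f s = h s := by
    filter_upwards [hgh, ae_timeMeasure_mem T] with s h1 hs
    rw [h1, hh, indicator_of_mem hs]
  have hhm : StronglyMeasurable h := hg.indicator measurableSet_Ioo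
  have hhi : Integrable h := integrable_indicator_Ioo ((integrable_forceSeries e hf).congr hgh)
  have hhL : MemLp h 2 (timeMeasure T) := (memLp_forceSeries e hf).2.ae_eq hgh'
  refine ⟨Function.uncurry (memory h), ?_, ?_,
    √((2 + 2 * T) * ((2 + 2 * T) * ∫ s, ‖h s‖ ^ 2 ∂(timeMeasure T))), ?_⟩
  · exact (stronglyMeasurable_memory_of_intervalIntegrable hhm
      fun a b => hhi.intervalIntegrable).aestronglyMeasurable
  · filter_upwards [memorySeries_apply e hα₀ hα₁ hf, ae_timeMeasure_mem T] with t ht htT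
    refine (ae_wMeasure_iff hα₀ hα₁).1 (ht.mono fun θ hθ => ?_)
    rw [hθ]
    exact (memory_congr (Ioo_subset_Icc_self htT) hgh' θ).symm
  · filter_upwards [ae_restrict_mem measurableSet_Ioo] with θ hθ
    rw [ENNReal.ofReal_ofNat]
    exact eLpNorm_memory_le hT hhi hhL hθ

end ModeSolutions

/-! ### Uniqueness for the fractional gradient flow -/

section Primitives

variable {Y : Type*} [NormedAddCommGroup Y] [NormedSpace ℝ Y]

/-- The additive constant of a primitive is determined by the behaviour at `0+`. -/
theorem eq_zero_of_tendsto_zero {f d : ℝ → Y} {y : Y} {T : ℝ} (hT : 0 < T)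
    (hd : Integrable d (timeMeasure T))
    (h : ∀ᵐ t ∂(timeMeasure T), f t = y + ∫ s in (0 : ℝ)..t, d s)
    (hf : Tendsto f (𝓝[>] 0) (𝓝 0)) : y = 0 := by
  have h0 : Tendsto (fun t => ∫ s in (0 : ℝ)..t, d s) (𝓝[>] 0) (𝓝 0) := by
    have h1 := continuousOn_integral hT.le hd 0 ⟨le_rfl, hT.le⟩
    rw [ContinuousWithinAt, intervalIntegral.integral_same] at h1
    refine h1.mono_left ?_
    rw [← nhdsWithin_Ioc_eq_nhdsGT hT]
    exact nhdsWithin_mono 0 Ioc_subset_Icc_self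
  have h1 : Tendsto (fun t => f t - ∫ s in (0 : ℝ)..t, d s) (𝓝[>] 0) (𝓝 0) := by
    simpa using hf.sub h0
  by_contra hy
  have h2 : ∀ᶠ t in 𝓝[>] (0 : ℝ), ‖f t - ∫ s in (0 : ℝ)..t, d s‖ < ‖y‖ := by
    have := h1.norm
    rw [norm_zero] at this
    exact this.eventually_lt_const (norm_pos_iff.2 hy)
  obtain ⟨δ, hδ, h3⟩ := mem_nhdsGT_iff_exists_Ioo_subset.1 h2
  have h4 : ∀ᵐ t ∂(volume.restrict (Ioo 0 (min δ T))), False := by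
    have h5 := h.filter_mono (ae_mono (Measure.restrict_mono
      (Ioo_subset_Ioo_right (min_le_right δ T)) le_rfl))
    filter_upwards [h5, ae_restrict_mem measurableSet_Ioo] with t ht hmem
    have h6 : ‖f t - ∫ s in (0 : ℝ)..t, d s‖ < ‖y‖ := h3 ⟨hmem.1, hmem.2.trans_le (min_le_left _ _)⟩
    rw [ht, add_sub_cancel_right] at h6
    exact lt_irrefl _ h6
  rw [eventually_false_iff_eq_bot, ae_eq_bot, Measure.restrict_eq_zero, Real.volume_Ioo,
    sub_zero, ENNReal.ofReal_eq_zero] at h4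
  exact absurd h4 (not_le.2 (lt_min hδ hT))

/-- A function whose primitive vanishes is zero, being the weak derivative of the function `0`. -/
theorem ae_eq_zero_of_integral_eq_zero [CompleteSpace Y] {w : ℝ → Y} {T : ℝ}
    (hw : Integrable w (timeMeasure T))
    (h : ∀ᵐ t ∂(timeMeasure T), ∫ s in (0 : ℝ)..t, w s = 0) : ∀ᵐ t ∂(timeMeasure T), w t = 0 := by
  have h1 := hasWeakDeriv_of_eq_integral hw (h.mono fun t ht => ht.symm)
  have h2 : ∀ᵐ t, t ∈ Ioo 0 T → w t = 0 := by
    refine isOpen_Ioo.ae_eq_zero_of_integral_contDiff_smul_eq_zero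
      (IntegrableOn.locallyIntegrableOn hw) fun φ hφ hc hs => ?_
    have h3 := h1 φ hφ hc hs
    simp only [smul_zero, integral_zero] at h3
    rw [← setIntegral_eq_integral_of_forall_compl_eq_zero (s := Ioo 0 T)]
    · exact (neg_eq_zero.1 h3.symm)
    · intro t ht
      rw [image_eq_zero_of_notMem_tsupport fun h => ht (hs h), zero_smul]
  rw [timeMeasure, ae_restrict_iff' measurableSet_Ioo]
  exact h2

end Primitives

section Uniqueness

variable {X H : Type*} [NormedAddCommGroup X] [NormedSpace ℝ X]
  [NormedAddCommGroup H] [InnerProductSpace ℝ H] [CompleteSpace H]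
  {i : X →L[ℝ] H} {A : X →L[ℝ] StrongDual ℝ X} {C₁ C₂ : ℝ} {ι : Type*} [Countable ι]
  {α T : ℝ} {E : X → ℝ} {u₀ : X}

theorem integrable_of_memLp_two {Y : Type*} [NormedAddCommGroup Y] {h : ℝ → Y}
    (hh : MemLp h (ENNReal.ofReal 2) (timeMeasure T)) : Integrable h (timeMeasure T) := by
  rw [ENNReal.ofReal_ofNat] at hh
  exact hh.integrable (by norm_num)

theorem integrable_gradH {u : ℝ → X} (hA : ∀ u, gradH E u = gradH E 0 + A u)
    (hu : Integrable u (timeMeasure T)) :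
    Integrable (fun t => gradH E (u t)) (timeMeasure T) := by
  have h1 : (fun t => gradH E (u t)) = fun t => gradH E 0 + A (u t) := funext fun t => hA _
  rw [h1]
  exact (integrable_const_timeMeasure T _).add (A.integrable_comp hu)

/-- The time-integrated form of the fractional gradient flow. -/
theorem IsFractionalSolution.rlIntegral_eq {u : ℝ → X} (hT : 0 < T) (hα₁ : α < 1)
    (hE : Differentiable ℝ E) (h : IsFractionalSolution i E α 2 2 T (i u₀) u) :
    ∀ᵐ t ∂(timeMeasure T), toDual i (volterra (gker (1 - α)) (fun s => i (u s) - i u₀) t) =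
      ∫ s in (0 : ℝ)..t, -gradH E (u s) := by
  obtain ⟨d, hd, hdc, hdE⟩ := h.equation
  have hα : 0 < 1 - α := by linarith
  have hu := integrable_of_memLp_two h.memLp
  have hui : Integrable (fun s => i (u s) - i u₀) (timeMeasure T) :=
    (i.integrable_comp hu).sub (integrable_const_timeMeasure T _)
  have hg := integrable_gker hα T
  have hmap : ∀ᵐ t ∂(timeMeasure T),
      toDualL i (volterra (gker (1 - α)) (fun s => i (u s) - i u₀) t) =
        rlIntegral (1 - α) (fun s => toDual i (i (u s)) - toDual i (i u₀)) t := by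
    filter_upwards [ae_integrableOn_volterra hg hui, ae_timeMeasure_mem T] with t h1 ht
    rw [map_volterra (toDualL i) ht.1.le h1, rlIntegral_eq_volterra]
    simp only [map_sub]
    rfl
  have hri : Integrable (rlIntegral (1 - α) fun s => toDual i (i (u s)) - toDual i (i u₀))
      (timeMeasure T) :=
    ((toDualL i).integrable_comp (integrable_volterra hg hui)).congr hmap
  obtain ⟨y, hy⟩ := HasWeakDeriv.exists_eq_const_add_integral hT hri (integrable_of_memLp_two hd) hdc
  -- the initial condition removes the constant of integration
  have hy0 : y = 0 := by
    refine eq_zero_of_tendsto_zero hT (integrable_of_memLp_two hd)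
      (f := fun t => toDualL i (volterra (gker (1 - α)) (fun s => i (u s) - i u₀) t)) ?_ ?_
    · filter_upwards [hy, hmap] with t h1 h2
      rw [h2, h1]
    · have h1 := ((toDualL i).continuous.tendsto 0).comp h.initial
      rw [map_zero] at h1
      exact h1
  have hdF : ∀ᵐ t ∂(timeMeasure T), d t = -gradH E (u t) := hdE.mono fun t ht => by
    ext v
    have h1 := (ht v).unique ((hE (u t)).hasFDerivAt.hasLineDerivAt v)
    rw [neg_apply, gradH, ← h1, neg_neg]
  filter_upwards [hy, hmap, ae_timeMeasure_mem T] with t h1 h2 ht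
  rw [← toDualL_apply, h2, h1, hy0, zero_add]
  have h3 := volterra_congr (k := fun _ => 1) (k' := fun _ => 1) (Ioo_subset_Icc_self ht)
    (fun _ _ => rfl) hdF
  rwa [volterra_one, volterra_one] at h3

/-- The fractional gradient flow has at most one solution: each mode of the difference of two
solutions satisfies a homogeneous linear Volterra equation. -/
theorem IsFractionalSolution.ae_eq (e : EigenBasis i A C₁ C₂ ι) {u u' : ℝ → X} (hT : 0 < T)
    (hα₀ : 0 < α) (hα₁ : α < 1) (hi : Function.Injective i)
    (hE : Differentiable ℝ E) (hA : ∀ u, gradH E u = gradH E 0 + A u)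
    (h : IsFractionalSolution i E α 2 2 T (i u₀) u)
    (h' : IsFractionalSolution i E α 2 2 T (i u₀) u') : u =ᵐ[timeMeasure T] u' := by
  have hα : 0 < 1 - α := by linarith
  have hu := integrable_of_memLp_two h.memLp
  have hu' := integrable_of_memLp_two h'.memLp
  have hFu := integrable_gradH hA hu
  have hFu' := integrable_gradH hA hu'
  have hui : Integrable (fun s => i (u s) - i u₀) (timeMeasure T) :=
    (i.integrable_comp hu).sub (integrable_const_timeMeasure T _)
  have hui' : Integrable (fun s => i (u' s) - i u₀) (timeMeasure T) :=
    (i.integrable_comp hu').sub (integrable_const_timeMeasure T _)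
  have hg := integrable_gker hα T
  have key : ∀ k, ∀ᵐ t ∂(timeMeasure T), inner ℝ (e.b k) (i (u t) - i (u' t)) = 0 := fun k => by
    set W : ℝ → ℝ := fun t => inner ℝ (e.b k) (i (u t) - i (u' t)) with hW
    have hWi : Integrable W (timeMeasure T) :=
      ((i.integrable_comp hu).sub (i.integrable_comp hu')).const_inner _
    -- the fractional equation for the `k`-th mode of the difference
    have h1 : ∀ᵐ t ∂(timeMeasure T), volterra (gker (1 - α)) W t =
        -(e.lam k * ∫ s in (0 : ℝ)..t, W s) := by
      filter_upwards [h.rlIntegral_eq hT hα₁ hE, h'.rlIntegral_eq hT hα₁ hE,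
        ae_integrableOn_volterra hg hui, ae_integrableOn_volterra hg hui', ae_timeMeasure_mem T]
        with t h1 h2 h3 h4 ht
      have htI := Ioo_subset_Icc_self ht
      have h5 : ∀ z, toDual i z (e.x k) = innerSL ℝ (e.b k) z := fun z => by
        rw [toDual_apply, e.i_x, real_inner_comm, innerSL_apply_apply]
      have h6 := (intervalIntegrable_of_timeMeasure hFu htI)
      have h7 := (intervalIntegrable_of_timeMeasure hFu' htI)
      have h8 : (∫ s in (0 : ℝ)..t, -gradH E (u s)) - (∫ s in (0 : ℝ)..t, -gradH E (u' s)) =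
          ∫ s in (0 : ℝ)..t, (-gradH E (u s) - -gradH E (u' s)) :=
        (intervalIntegral.integral_sub h6.neg h7.neg).symm
      have h9 : (∫ s in (0 : ℝ)..t, (-gradH E (u s) - -gradH E (u' s))) (e.x k) =
          ∫ s in (0 : ℝ)..t, (-gradH E (u s) - -gradH E (u' s)) (e.x k) :=
        ContinuousLinearMap.intervalIntegral_apply (h6.neg.sub h7.neg) _
      have h10 := volterra_sub (k := gker (1 - α)) ht.1.le
        (((innerSL ℝ (e.b k)).integrable_comp h3).congr
          (Eventually.of_forall fun s => map_smul (innerSL ℝ (e.b k)) _ _))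
        (((innerSL ℝ (e.b k)).integrable_comp h4).congr
          (Eventually.of_forall fun s => map_smul (innerSL ℝ (e.b k)) _ _))
      rw [← map_volterra _ ht.1.le h3, ← map_volterra _ ht.1.le h4, ← h5, ← h5, h1, h2,
        ← sub_apply, h8, h9] at h10
      have h11 : (fun s => innerSL ℝ (e.b k) (i (u s) - i u₀) -
          innerSL ℝ (e.b k) (i (u' s) - i u₀)) = W := funext fun s => by
        rw [← map_sub, sub_sub_sub_cancel_right, innerSL_apply_apply]
      rw [h11] at h10
      rw [h10, ← intervalIntegral.integral_const_mul, ← intervalIntegral.integral_neg]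
      refine intervalIntegral.integral_congr fun s _ => ?_
      have h12 : -gradH E (u s) - -gradH E (u' s) = -(A (u s - u' s)) := by
        rw [hA (u s), hA (u' s), map_sub]; abel
      simp only [h12, hW]
      rw [neg_apply, e.A_apply_x, map_sub]
    -- convolution with `g_α` turns it into a Volterra equation for the primitive
    have h2 : ∀ᵐ t ∂(timeMeasure T), (∫ s in (0 : ℝ)..t, W s) =
        -(e.lam k * volterra (gker α) (fun t => ∫ s in (0 : ℝ)..t, W s) t) := by
      filter_upwards [ae_timeMeasure_mem T] with t ht
      have htI := Ioo_subset_Icc_self ht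
      have h3 := integral_eq_volterra_gker hα (by linarith) htI hWi
      rw [sub_sub_cancel, volterra_congr htI (fun _ _ => rfl) h1] at h3
      rw [← h3, volterra, volterra, ← intervalIntegral.integral_const_mul,
        ← intervalIntegral.integral_neg]
      refine intervalIntegral.integral_congr fun s _ => ?_
      simp only [smul_eq_mul]
      ring
    have hYi : Integrable (fun t => ∫ s in (0 : ℝ)..t, W s) (timeMeasure T) :=
      ((continuousOn_integral hT.le hWi).integrableOn_Icc).mono_set Ioo_subset_Icc_self
    exact ae_eq_zero_of_integral_eq_zero hWi (ae_eq_zero_of_volterra hα₀ hYi h2)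
  filter_upwards [ae_all_iff.2 key] with t ht
  refine hi (ext_of_coeff e.b fun k => ?_)
  rw [← sub_eq_zero, ← inner_sub_right]
  exact ht k

end Uniqueness

/-! ### Uniqueness for the augmented gradient flow -/

section Degenerate

variable {L K : Type*} [NormedAddCommGroup L] [InnerProductSpace ℝ L] [CompleteSpace L]
  [NormedAddCommGroup K] [InnerProductSpace ℝ K]

/-- A linear evolution equation `d/dt (j† j z) = - B z`, `j z (0) = 0`, integrated in time, has only
the zero solution if `B` is bounded below by a multiple of `- j† j`. No coercivity of `j† j`
is needed: the energy estimate is applied to the primitive of `∫_0^t z`, which is of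
class `C^1`. -/
theorem ae_eq_zero_of_degenerate {j : L →L[ℝ] K} (hj : Function.Injective j)
    {B : L →L[ℝ] StrongDual ℝ L} {γ : ℝ} (hB : ∀ x, 0 ≤ B x x + γ * ‖j x‖ ^ 2) {T : ℝ}
    {z : ℝ → L} (hz : Integrable z (timeMeasure T))
    (h : ∀ᵐ t ∂(timeMeasure T), ∀ y, inner ℝ (j (z t)) (j y) = -B (∫ s in (0 : ℝ)..t, z s) y) :
    ∀ᵐ t ∂(timeMeasure T), z t = 0 := by
  set z' := (Ioo 0 T).indicator z with hz'
  have hzi : Integrable z' := integrable_indicator_Ioo hz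
  set Z : ℝ → L := fun t => ∫ s in (0 : ℝ)..t, z' s with hZ
  have hZc : Continuous Z := intervalIntegral.continuous_primitive
    (fun a b => hzi.intervalIntegrable) 0
  set J : ℝ → L := fun t => ∫ s in (0 : ℝ)..t, Z s with hJ
  have hJd : ∀ t, HasDerivAt J (Z t) t := fun t => hZc.integral_hasStrictDerivAt 0 t |>.hasDerivAt
  have hzz' : ∀ᵐ s ∂(timeMeasure T), z s = z' s := (ae_timeMeasure_mem T).mono fun s hs => by
    rw [hz', indicator_of_mem hs]
  have hZz : ∀ t ∈ Icc 0 T, (∫ s in (0 : ℝ)..t, z s) = Z t := fun t ht => by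
    have := volterra_congr (k := fun _ => 1) (k' := fun _ => 1) ht (fun _ _ => rfl) hzz'
    rwa [volterra_one, volterra_one] at this
  -- the equation, integrated once more in time
  have hint : ∀ t ∈ Icc 0 T, ∀ y, inner ℝ (j (Z t)) (j y) = -B (J t) y := by
    intro t ht y
    have h1 : ∀ᵐ s ∂(timeMeasure T), toDual j (j (z s)) y = -B (Z s) y := by
      filter_upwards [h, ae_timeMeasure_mem T] with s hs hsT
      rw [toDual_apply, hs y, hZz s (Ioo_subset_Icc_self hsT)]
    have h2 := volterra_congr (k := fun _ => 1) (k' := fun _ => 1) ht (fun _ _ => rfl) h1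
    rw [volterra_one, volterra_one] at h2
    have h3 : ∀ x, toDual j (j x) y = ((innerSL ℝ (j y)).comp j) x := fun x => by
      rw [toDual_apply, real_inner_comm]; rfl
    have h4 : ∀ x, -B x y = (-(B.flip y)) x := fun x => rfl
    simp only [h3, h4] at h2
    rw [ContinuousLinearMap.intervalIntegral_comp_comm _ (intervalIntegrable_of_timeMeasure hz ht),
      ContinuousLinearMap.intervalIntegral_comp_comm _ (hZc.intervalIntegrable _ _), ← h3, ← h4,
      hZz t ht] at h2
    exact h2
  set φ : ℝ → ℝ := fun t => Real.exp (-(2 * γ) * t) * ‖j (J t)‖ ^ 2 with hφ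
  have hφd : ∀ t, HasDerivAt φ (Real.exp (-(2 * γ) * t) * (-(2 * γ)) * ‖j (J t)‖ ^ 2 +
      Real.exp (-(2 * γ) * t) * (2 * inner ℝ (j (J t)) (j (Z t)))) t := fun t => by
    have h1 : HasDerivAt (fun t => Real.exp (-(2 * γ) * t)) (Real.exp (-(2 * γ) * t) * (-(2 * γ))) t := by
      have := ((hasDerivAt_id t).const_mul (-(2 * γ))).exp
      simpa using this
    have h2 : HasDerivAt (fun t => j (J t)) (j (Z t)) t := (j.hasFDerivAt.comp_hasDerivAt t (hJd t))
    exact h1.mul h2.norm_sq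
  -- the exponential weight absorbs the possibly negative part of `B`
  have hanti : AntitoneOn φ (Icc 0 T) := by
    refine antitoneOn_of_deriv_nonpos (convex_Icc 0 T)
      (fun t _ => (hφd t).continuousAt.continuousWithinAt)
      (fun t _ => (hφd t).differentiableAt.differentiableWithinAt) fun t ht => ?_
    rw [interior_Icc] at ht
    rw [(hφd t).deriv, real_inner_comm, hint t (Ioo_subset_Icc_self ht)]
    have h1 := mul_nonneg (Real.exp_pos (-(2 * γ) * t)).le (hB (J t))
    nlinarith
  have hJ0 : ∀ t ∈ Icc 0 T, J t = 0 := fun t ht => by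
    have h1 := hanti ⟨le_rfl, ht.1.trans ht.2⟩ ht ht.1
    have h2 : J 0 = 0 := by simp only [hJ, intervalIntegral.integral_same]
    have h3 : φ 0 = 0 := by simp [hφ, h2]
    rw [h3] at h1
    have h4 : ‖j (J t)‖ ^ 2 ≤ 0 := nonpos_of_mul_nonpos_right h1 (Real.exp_pos _)
    refine hj ?_
    rw [map_zero, ← norm_eq_zero]
    exact pow_eq_zero_iff two_ne_zero |>.1 (le_antisymm h4 (by positivity))
  refine ae_eq_zero_of_integral_eq_zero hz ((ae_timeMeasure_mem T).mono fun t ht => ?_)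
  rw [hZz t (Ioo_subset_Icc_self ht)]
  have h1 : J =ᶠ[𝓝 t] fun _ => 0 := by
    filter_upwards [isOpen_Ioo.mem_nhds ht] with s hs
    exact hJ0 s (Ioo_subset_Icc_self hs)
  exact (hJd t).unique ((hasDerivAt_const t (0 : L)).congr_of_eventuallyEq h1)

end Degenerate

section Uniqueness

variable {α : ℝ}

/-- The square of the mean is controlled by the form with density `θ + γ (1 - θ)`, for `γ` large. -/
theorem exists_mean_sq_le (hα₀ : 0 < α) (hα₁ : α < 1) [IsProbabilityMeasure (wMeasure α)] (lam : ℝ) :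
    ∃ γ : ℝ, ∀ y : L2w α ℝ, 0 ≤ lam * (meanL (wMeasure α) ℝ y * meanL (wMeasure α) ℝ y) +
      (inner ℝ y y - inner ℝ (inclL2w α ℝ y) (inclL2w α ℝ y)) +
        γ * ‖inclL2w α ℝ y‖ ^ 2 := by
  have ha : ∀ (n : ℕ), ∀ θ ∈ Ioo (0 : ℝ) 1, 1 ≤ ((n : ℝ) + 1) * (1 - θ) + θ := fun n θ hθ => by
    have : 0 ≤ (n : ℝ) * (1 - θ) := mul_nonneg n.cast_nonneg (by linarith [hθ.2])
    linarith
  have hb : ∀ n : ℕ, ∀ᵐ θ ∂(wMeasure α), ‖(((n : ℝ) + 1) * (1 - θ) + θ)⁻¹‖ ≤ 1 := fun n =>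
    (ae_wMeasure_mem α).mono fun θ hθ => by
      have := ha n θ hθ
      rw [norm_inv, Real.norm_of_nonneg (by linarith)]
      exact inv_le_one_of_one_le₀ this
  have hmeas : ∀ n : ℕ, AEStronglyMeasurable (fun θ => (((n : ℝ) + 1) * (1 - θ) + θ)⁻¹)
      (wMeasure α) := fun n => by
    refine Measurable.aestronglyMeasurable ?_
    fun_prop
  have hint : ∀ n : ℕ, Integrable (fun θ => (((n : ℝ) + 1) * (1 - θ) + θ)⁻¹) (wMeasure α) :=
    fun n => Integrable.of_bound (hmeas n) 1 (hb n)
  -- the mean of `1 / (θ + γ (1 - θ))` tends to zero as `γ → ∞`, as `θ < 1` almost everywhere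
  have hlim : Tendsto (fun n : ℕ => ∫ θ, (((n : ℝ) + 1) * (1 - θ) + θ)⁻¹ ∂(wMeasure α)) atTop
      (𝓝 (∫ _, (0 : ℝ) ∂(wMeasure α))) := by
    refine tendsto_integral_of_dominated_convergence (fun _ => 1) hmeas
      (integrable_const 1) hb ((ae_wMeasure_mem α).mono fun θ hθ => ?_)
    refine Tendsto.inv_tendsto_atTop (tendsto_atTop_add_const_right _ _ ?_)
    exact (tendsto_atTop_add_const_right _ _ tendsto_natCast_atTop_atTop).atTop_mul_const
      (by linarith [hθ.2])
  rw [integral_zero] at hlim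
  obtain ⟨n, hn⟩ := (hlim.eventually_le_const
    (show (0 : ℝ) < 1 / (|lam| + 1) by positivity)).exists
  refine ⟨(n : ℝ) + 1, fun y => ?_⟩
  set ε := ∫ θ, (((n : ℝ) + 1) * (1 - θ) + θ)⁻¹ ∂(wMeasure α) with hε
  set m := meanL (wMeasure α) ℝ y with hm
  have hyy : Integrable (fun θ => inner ℝ (y θ) (y θ)) (wMeasure α) := L2.integrable_inner y y
  have hyi : Integrable (fun θ => y θ) (wMeasure α) := (Lp.memLp y).integrable (by norm_num)
  have h1y := integrable_one_sub_mul hyy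
  have e0 : ‖inclL2w α ℝ y‖ ^ 2 = ∫ θ, (1 - θ) * inner ℝ (y θ) (y θ) ∂(wMeasure α) := by
    rw [← real_inner_self_eq_norm_sq, inner_inclL2w hα₀ hα₁]
  have e1 : inner ℝ (inclL2w α ℝ y) (inclL2w α ℝ y) =
      ∫ θ, (1 - θ) * inner ℝ (y θ) (y θ) ∂(wMeasure α) := inner_inclL2w hα₀ hα₁ y y
  have e2 : inner ℝ y y = ∫ θ, inner ℝ (y θ) (y θ) ∂(wMeasure α) := L2.inner_def y y
  have hsub : Integrable (fun θ => inner ℝ (y θ) (y θ) - (1 - θ) * inner ℝ (y θ) (y θ))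
    (wMeasure α) := hyy.sub h1y
  have hQ : Integrable (fun θ => inner ℝ (y θ) (y θ) - (1 - θ) * inner ℝ (y θ) (y θ) +
    ((n : ℝ) + 1) * ((1 - θ) * inner ℝ (y θ) (y θ))) (wMeasure α) := hsub.add (h1y.const_mul _)
  have hR : Integrable (fun θ => 2 * (|lam| * m) * y θ - lam ^ 2 * m ^ 2 *
      (((n : ℝ) + 1) * (1 - θ) + θ)⁻¹) (wMeasure α) :=
    (hyi.const_mul _).sub ((hint n).const_mul _)
  -- Young's inequality with the weight `θ + γ (1 - θ)`
  have hle : ∫ θ, (2 * (|lam| * m) * y θ - lam ^ 2 * m ^ 2 *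
      (((n : ℝ) + 1) * (1 - θ) + θ)⁻¹) ∂(wMeasure α) ≤
      ∫ θ, (inner ℝ (y θ) (y θ) - (1 - θ) * inner ℝ (y θ) (y θ) +
        ((n : ℝ) + 1) * ((1 - θ) * inner ℝ (y θ) (y θ))) ∂(wMeasure α) := by
    refine integral_mono_ae hR hQ ((ae_wMeasure_mem α).mono fun θ hθ => ?_)
    have h1 := ha n θ hθ
    simp only
    set a := ((n : ℝ) + 1) * (1 - θ) + θ with haθ
    have ha0 : 0 < a := by linarith
    have h2 : inner ℝ (y θ) (y θ) = y θ * y θ := by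
      rw [real_inner_self_eq_norm_sq, Real.norm_eq_abs, sq_abs, sq]
    rw [h2]
    have h3 : 0 ≤ a⁻¹ * (a * y θ - |lam| * m) ^ 2 := by positivity
    have h4 : a⁻¹ * (a * y θ - |lam| * m) ^ 2 =
        a * (y θ * y θ) - 2 * (|lam| * m) * y θ + lam ^ 2 * m ^ 2 * a⁻¹ := by
      rw [← sq_abs lam]
      field_simp
      ring
    have h5 : a * (y θ * y θ) = y θ * y θ - (1 - θ) * (y θ * y θ) +
      ((n : ℝ) + 1) * ((1 - θ) * (y θ * y θ)) := by rw [haθ]; ring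
    linarith
  rw [integral_sub (hyi.const_mul _) ((hint n).const_mul _), integral_const_mul, integral_const_mul,
    integral_add hsub (h1y.const_mul _), integral_sub hyy h1y, integral_const_mul, ← hε] at hle
  have hmm : ∫ θ, y θ ∂(wMeasure α) = m := rfl
  rw [hmm] at hle
  rw [e0, e1, e2]
  have h6 : lam ^ 2 * m ^ 2 * ε ≤ |lam| * m ^ 2 := by
    have h7 : |lam| * ε ≤ 1 := by
      refine (mul_le_mul_of_nonneg_left hn (abs_nonneg _)).trans ?_
      rw [mul_one_div, div_le_one (by positivity)]
      linarith
    have h8 : |lam| * ε * (|lam| * m ^ 2) ≤ 1 * (|lam| * m ^ 2) :=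
      mul_le_mul_of_nonneg_right h7 (by positivity)
    rw [← sq_abs lam]
    nlinarith
  have h9 : -|lam| * m ^ 2 ≤ lam * m ^ 2 :=
    mul_le_mul_of_nonneg_right (neg_abs_le lam) (sq_nonneg m)
  nlinarith

theorem inner_smulVec {Ω H : Type*} [MeasurableSpace Ω] {ν : Measure Ω} [NormedAddCommGroup H]
    [InnerProductSpace ℝ H] (v : Lp H 2 ν) (y : H) (g : Lp ℝ 2 ν) :
    inner ℝ v (smulVec ν y g) = inner ℝ ((innerSL ℝ y).compLpL 2 ν v) g := by
  rw [L2.inner_def, L2.inner_def]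
  refine integral_congr_ae ?_
  filter_upwards [coeFn_smulVec y g, (innerSL ℝ y).coeFn_compLpL v] with a h1 h2
  rw [h1, h2, innerSL_apply_apply, inner_smul_right, real_inner_comm]
  simp

variable {X H : Type*} [NormedAddCommGroup X] [NormedSpace ℝ X]
  [NormedAddCommGroup H] [InnerProductSpace ℝ H]
  {i : X →L[ℝ] H} {A : X →L[ℝ] StrongDual ℝ X} {C₁ C₂ : ℝ} {ι : Type*}
  {T : ℝ} {E : X → ℝ} {u₀ : X}

/-- The time-integrated form of the augmented gradient flow. -/
theorem IsGradientFlowSolution.toDual_eq (hT : 0 < T) (hα₀ : 0 < α) (hα₁ : α < 1)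
    [IsProbabilityMeasure (wMeasure α)] (hE : Differentiable ℝ E) {v : ℝ → L2w α X}
    (h : IsGradientFlowSolution (augEmb i α) (augEnergy i E α u₀) 2 2 T 0 v) :
    ∃ d : ℝ → StrongDual ℝ (L2w α X), Integrable d (timeMeasure T) ∧
      (∀ᵐ t ∂(timeMeasure T), toDual (augEmb i α) (augEmb i α (v t)) = ∫ s in (0 : ℝ)..t, d s) ∧
      ∀ᵐ t ∂(timeMeasure T), ∀ w, d t w = -(gradH E (opC α u₀ (v t)) (meanL (wMeasure α) X w) +
        (inner ℝ (liftL2w i α (v t)) (liftL2w i α w) -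
          inner ℝ (augEmb i α (v t)) (augEmb i α w))) := by
  obtain ⟨d, hd, hdc, hdE⟩ := h.equation
  obtain ⟨w, hwc, hwv, hw0⟩ := h.initial
  have hdi := integrable_of_memLp_two hd
  obtain ⟨y, hy⟩ := HasWeakDeriv.exists_eq_const_add_integral hT
    (integrable_of_memLp_two h.memLp_dual) hdi hdc
  -- the initial condition removes the constant of integration
  have hy0 : y = 0 := by
    refine eq_zero_of_tendsto_zero hT hdi (f := fun t => toDualL (augEmb i α) (w t)) ?_ ?_
    · filter_upwards [hy, hwv] with t h1 h2
      rw [h2, toDualL_apply, h1]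
    · have h1 : Tendsto w (𝓝[>] 0) (𝓝 0) := by
        have h2 := hwc 0 ⟨le_rfl, hT.le⟩
        rw [ContinuousWithinAt, hw0] at h2
        refine h2.mono_left ?_
        rw [← nhdsWithin_Ioc_eq_nhdsGT hT]
        exact nhdsWithin_mono 0 Ioc_subset_Icc_self
      have h2 := ((toDualL (augEmb i α)).continuous.tendsto 0).comp h1
      rw [map_zero] at h2
      exact h2
  refine ⟨d, hdi, ?_, hdE.mono fun t ht w => ?_⟩
  · simpa only [hy0, zero_add] using hy
  · rw [← (ht w).unique (hasLineDerivAt_augEnergy hα₀ hα₁ i hE u₀ (v t) w), neg_neg]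

/-- The `k`-th mode of an augmented state. -/
def modeL (e : EigenBasis i A C₁ C₂ ι) (α : ℝ) (k : ι) : L2w α X →L[ℝ] L2w α ℝ :=
  ((innerSL ℝ (e.b k)).compLpL 2 (wMeasure α)).comp (liftL2w i α)

theorem modeL_apply (e : EigenBasis i A C₁ C₂ ι) (k : ι) (z : L2w α X) :
    modeL e α k z = (innerSL ℝ (e.b k)).compLpL 2 (wMeasure α) (liftL2w i α z) := rfl

theorem inner_liftL2w_smulVec (e : EigenBasis i A C₁ C₂ ι) (k : ι) (z : L2w α X) (y : L2w α ℝ) :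
    inner ℝ (liftL2w i α z) (liftL2w i α (smulVec (wMeasure α) (e.x k) y)) =
      inner ℝ (modeL e α k z) y := by
  rw [liftL2w_smulVec, e.i_x, inner_smulVec, modeL_apply]

theorem inner_augEmb_smulVec (e : EigenBasis i A C₁ C₂ ι) (k : ι) (z : L2w α X) (y : L2w α ℝ) :
    inner ℝ (augEmb i α z) (augEmb i α (smulVec (wMeasure α) (e.x k) y)) =
      inner ℝ (inclL2w α ℝ (modeL e α k z)) (inclL2w α ℝ y) := by
  rw [augEmb_apply, augEmb_apply, liftL2w_smulVec, e.i_x, inclL2w_smulVec, inner_smulVec,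
    ← inclL2w_compLpL, modeL_apply]

/-- The bilinear form `lam ⟨1, y⟩ ⟨1, y'⟩ + ∫ θ y y' w_α dθ`, which drives a mode with
eigenvalue `lam` of the augmented flow. -/
def modeForm (α lam : ℝ) [IsProbabilityMeasure (wMeasure α)] :
    L2w α ℝ →L[ℝ] StrongDual ℝ (L2w α ℝ) :=
  lam • (ContinuousLinearMap.toSpanSingleton ℝ (meanL (wMeasure α) ℝ)).comp
      (meanL (wMeasure α) ℝ) +
    (toDualL (ContinuousLinearMap.id ℝ (L2w α ℝ)) - (toDualL (inclL2w α ℝ)).comp (inclL2w α ℝ))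

theorem modeForm_apply (lam : ℝ) [IsProbabilityMeasure (wMeasure α)] (x y : L2w α ℝ) :
    modeForm α lam x y = lam * (meanL (wMeasure α) ℝ x * meanL (wMeasure α) ℝ y) +
      (inner ℝ x y - inner ℝ (inclL2w α ℝ x) (inclL2w α ℝ y)) := rfl

variable [CompleteSpace X] [CompleteSpace H]

/-- The difference of two augmented gradients, tested with the `k`-th mode. -/
theorem modeForm_modeL_sub (hα₀ : 0 < α) (hα₁ : α < 1) [IsProbabilityMeasure (wMeasure α)]
    (e : EigenBasis i A C₁ C₂ ι) (hA : ∀ u, gradH E u = gradH E 0 + A u) (k : ι) (v v' : L2w α X)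
    (y : L2w α ℝ) :
    modeForm α (e.lam k) (modeL e α k (v - v')) y =
      (gradH E (opC α u₀ v) (meanL (wMeasure α) X (smulVec (wMeasure α) (e.x k) y)) +
        (inner ℝ (liftL2w i α v) (liftL2w i α (smulVec (wMeasure α) (e.x k) y)) -
          inner ℝ (augEmb i α v) (augEmb i α (smulVec (wMeasure α) (e.x k) y)))) -
      (gradH E (opC α u₀ v') (meanL (wMeasure α) X (smulVec (wMeasure α) (e.x k) y)) +
        (inner ℝ (liftL2w i α v') (liftL2w i α (smulVec (wMeasure α) (e.x k) y)) -
          inner ℝ (augEmb i α v') (augEmb i α (smulVec (wMeasure α) (e.x k) y)))) := by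
  have h1 : gradH E (opC α u₀ v) - gradH E (opC α u₀ v') = A (meanL (wMeasure α) X (v - v')) := by
    rw [hA (opC α u₀ v), hA (opC α u₀ v'), opC_eq hα₀ hα₁, opC_eq hα₀ hα₁, map_add, map_add,
      map_sub, map_sub]
    abel
  have h2 : inner ℝ (e.b k) (i (meanL (wMeasure α) X (v - v'))) =
      meanL (wMeasure α) ℝ (modeL e α k (v - v')) := by
    rw [map_meanL, ← innerSL_apply_apply (𝕜 := ℝ), map_meanL, modeL_apply, liftL2w]
  have h3 : gradH E (opC α u₀ v) (meanL (wMeasure α) X (smulVec (wMeasure α) (e.x k) y)) -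
      gradH E (opC α u₀ v') (meanL (wMeasure α) X (smulVec (wMeasure α) (e.x k) y)) =
      e.lam k * (meanL (wMeasure α) ℝ (modeL e α k (v - v')) * meanL (wMeasure α) ℝ y) := by
    rw [← sub_apply, h1, meanL_smulVec, map_smul, e.A_apply_x, h2, smul_eq_mul]
    ring
  rw [inner_liftL2w_smulVec, inner_liftL2w_smulVec, inner_augEmb_smulVec, inner_augEmb_smulVec,
    modeForm_apply, ← h3, map_sub (modeL e α k), map_sub (inclL2w α ℝ), inner_sub_left,
    inner_sub_left]
  ring

/-- The modes of the difference of two solutions of the augmented flow vanish. -/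
theorem IsGradientFlowSolution.ae_modeL_sub_eq_zero
    (e : EigenBasis i A C₁ C₂ ι) {v v' : ℝ → L2w α X} (hT : 0 < T)
    (hα₀ : 0 < α) (hα₁ : α < 1) [IsProbabilityMeasure (wMeasure α)]
    (hE : Differentiable ℝ E) (hA : ∀ u, gradH E u = gradH E 0 + A u)
    (h : IsGradientFlowSolution (augEmb i α) (augEnergy i E α u₀) 2 2 T 0 v)
    (h' : IsGradientFlowSolution (augEmb i α) (augEnergy i E α u₀) 2 2 T 0 v') (k : ι) :
    ∀ᵐ t ∂(timeMeasure T), modeL e α k (v t - v' t) = 0 := by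
  have hz : Integrable (fun t => modeL e α k (v t - v' t)) (timeMeasure T) :=
    (modeL e α k).integrable_comp
    ((integrable_of_memLp_two h.memLp).sub (integrable_of_memLp_two h'.memLp))
  obtain ⟨d, hdi, hd, hdE⟩ := h.toDual_eq hT hα₀ hα₁ hE
  obtain ⟨d', hdi', hd', hdE'⟩ := h'.toDual_eq hT hα₀ hα₁ hE
  obtain ⟨γ, hγ⟩ := exists_mean_sq_le hα₀ hα₁ (e.lam k)
  refine ae_eq_zero_of_degenerate (z := fun t => modeL e α k (v t - v' t))
    (inclL2w_injective hα₀ hα₁) (B := modeForm α (e.lam k)) (γ := γ) hγ hz ?_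
  -- testing with `x k` times a scalar function gives the equation for the `k`-th mode
  have hrate : ∀ᵐ s ∂(timeMeasure T), ∀ y, (d s - d' s) (smulVec (wMeasure α) (e.x k) y) =
      -modeForm α (e.lam k) (modeL e α k (v s - v' s)) y := by
    filter_upwards [hdE, hdE'] with s h1 h2 y
    rw [sub_apply, h1, h2, modeForm_modeL_sub (u₀ := u₀) hα₀ hα₁ e hA]
    ring
  filter_upwards [hd, hd', ae_timeMeasure_mem T] with t h1 h2 ht y
  have htI := Ioo_subset_Icc_self ht
  have h3 : inner ℝ (inclL2w α ℝ (modeL e α k (v t - v' t))) (inclL2w α ℝ y) =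
      (∫ s in (0 : ℝ)..t, (d s - d' s)) (smulVec (wMeasure α) (e.x k) y) := by
    rw [intervalIntegral.integral_sub (intervalIntegrable_of_timeMeasure hdi htI)
      (intervalIntegrable_of_timeMeasure hdi' htI), ← h1, ← h2, sub_apply, toDual_apply,
      toDual_apply, inner_augEmb_smulVec, inner_augEmb_smulVec, ← inner_sub_left, ← map_sub,
      ← map_sub]
  have h5 : (∫ s in (0 : ℝ)..t, (d s - d' s)) (smulVec (wMeasure α) (e.x k) y) =
      ∫ s in (0 : ℝ)..t, (d s - d' s) (smulVec (wMeasure α) (e.x k) y) :=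
    ContinuousLinearMap.intervalIntegral_apply
      (intervalIntegrable_of_timeMeasure (hdi.sub hdi') htI) _
  have h6 := volterra_congr (k := fun _ => 1) (k' := fun _ => 1) htI (fun _ _ => rfl)
    (hrate.mono fun s hs => hs y)
  rw [volterra_one, volterra_one] at h6
  have h7 : ∀ x, -modeForm α (e.lam k) x y = (-((modeForm α (e.lam k)).flip y)) x := fun x => rfl
  simp only [h7] at h6
  rw [ContinuousLinearMap.intervalIntegral_comp_comm (-((modeForm α (e.lam k)).flip y))
    (intervalIntegrable_of_timeMeasure hz htI), ← h7] at h6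
  rw [h3, h5, h6]

/-- The augmented gradient flow has at most one solution, since an augmented state is determined by
its modes. -/
theorem IsGradientFlowSolution.ae_eq [Countable ι]
    (e : EigenBasis i A C₁ C₂ ι) {v v' : ℝ → L2w α X} (hT : 0 < T)
    (hα₀ : 0 < α) (hα₁ : α < 1) (hi : Function.Injective i)
    (hE : Differentiable ℝ E) (hA : ∀ u, gradH E u = gradH E 0 + A u)
    (h : IsGradientFlowSolution (augEmb i α) (augEnergy i E α u₀) 2 2 T 0 v)
    (h' : IsGradientFlowSolution (augEmb i α) (augEnergy i E α u₀) 2 2 T 0 v') :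
    v =ᵐ[timeMeasure T] v' := by
  have := isProbabilityMeasure_wMeasure hα₀ hα₁
  have key := fun k => IsGradientFlowSolution.ae_modeL_sub_eq_zero e hT hα₀ hα₁ hE hA h h' k
  filter_upwards [ae_all_iff.2 key] with t ht
  have h1 : liftL2w i α (v t) = liftL2w i α (v' t) := by
    refine Lp_ext_of_coeff e.b fun k => ?_
    rw [← sub_eq_zero, ← map_sub, ← map_sub]
    exact ht k
  refine Lp.ext ?_
  have h2 := coeFn_liftL2w i (v t)
  rw [h1] at h2
  filter_upwards [h2, coeFn_liftL2w i (v' t)] with θ h3 h4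
  exact hi (h3.symm.trans h4)

end Uniqueness

/-! ### Canonical solutions and transfer along equality almost everywhere -/

section Congruence

theorem HasWeakDeriv.congr {Y : Type*} [NormedAddCommGroup Y] [NormedSpace ℝ Y] {T : ℝ}
    {f f' d : ℝ → Y} (h : HasWeakDeriv T f d) (hf : f =ᵐ[timeMeasure T] f') :
    HasWeakDeriv T f' d := fun φ h1 h2 h3 => by
  rw [← h φ h1 h2 h3]
  exact integral_congr_ae (hf.mono fun t ht => by simp only [ht])

theorem MemSobolev.congr {Y : Type*} [NormedAddCommGroup Y] [NormedSpace ℝ Y] {T : ℝ} {p : ℝ≥0∞}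
    {f f' : ℝ → Y} (h : MemSobolev p T f) (hf : f =ᵐ[timeMeasure T] f') : MemSobolev p T f' := by
  obtain ⟨h1, d, h2, h3⟩ := h
  exact ⟨h1.ae_eq hf, d, h2, h3.congr hf⟩

theorem MemFracSobolev.congr {Y : Type*} [NormedAddCommGroup Y] [NormedSpace ℝ Y] {α T : ℝ}
    {p : ℝ≥0∞} {f f' : ℝ → Y} {y : Y} (h : MemFracSobolev α p T f y)
    (hf : f =ᵐ[timeMeasure T] f') : MemFracSobolev α p T f' y := by
  obtain ⟨h1, d, h2, h3⟩ := h
  refine ⟨h1.ae_eq hf, d, h2, HasWeakDeriv.congr h3 ((ae_timeMeasure_mem T).mono fun t ht => ?_)⟩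
  rw [rlIntegral_eq_volterra, rlIntegral_eq_volterra]
  exact volterra_congr (Ioo_subset_Icc_self ht) (fun _ _ => rfl) (hf.mono fun s hs => by rw [hs])

variable {X H : Type*} [NormedAddCommGroup X] [NormedSpace ℝ X]
  [NormedAddCommGroup H] [InnerProductSpace ℝ H] {i : X →L[ℝ] H} {E : X → ℝ} {α T : ℝ} {u₀ : X}

theorem Corresponds.congr {u u' : ℝ → X} {v v' : ℝ → L2w α X} (h : Corresponds i E α T u₀ u v)
    (hu : u =ᵐ[timeMeasure T] u') (hv : v =ᵐ[timeMeasure T] v') :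
    Corresponds i E α T u₀ u' v' := by
  obtain ⟨h1, h2⟩ := h
  constructor
  · filter_upwards [h1, hu, hv] with t h1 hu hv
    rw [← hu, ← hv, h1]
  · filter_upwards [h2, hv, ae_timeMeasure_mem T] with t h2 hv ht
    filter_upwards [h2] with θ h3
    rw [← hv, h3, opG_eq, opG_eq]
    exact memory_congr (Ioo_subset_Icc_self ht) (hu.mono fun s hs => by rw [hs]) θ

theorem MemLinftyLq.congr {q : ℝ} {v v' : ℝ → L2w α X} (h : MemLinftyLq i α q T v)
    (hv : v =ᵐ[timeMeasure T] v') : MemLinftyLq i α q T v' := by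
  obtain ⟨U, h1, h2, h3⟩ := h
  refine ⟨U, h1, ?_, h3⟩
  filter_upwards [h2, hv] with t h2 hv
  rwa [← hv]

end Congruence

section Canonical

/-- A pair of corresponding regular solutions `u`, `v` of the two flows, each of which is the
only solution of its flow. -/
structure IsCanonicalPair {X H : Type*} [NormedAddCommGroup X] [NormedSpace ℝ X]
    [NormedAddCommGroup H] [InnerProductSpace ℝ H] (i : X →L[ℝ] H) (E : X → ℝ) (α p q T : ℝ)
    (u₀ : X) (u : ℝ → X) (v : ℝ → L2w α X) : Prop where
  fractional : IsFractionalSolution i E α p q T (i u₀) u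
  augmented : IsGradientFlowSolution (augEmb i α) (augEnergy i E α u₀) p q T 0 v
  corresponds : Corresponds i E α T u₀ u v
  unique_fractional : ∀ u', IsFractionalSolution i E α p q T (i u₀) u' → u =ᵐ[timeMeasure T] u'
  unique_augmented : ∀ v', IsGradientFlowSolution (augEmb i α) (augEnergy i E α u₀) p q T 0 v' →
    v =ᵐ[timeMeasure T] v'
  memFracSobolev : MemFracSobolev α 2 T (fun t => i (u t)) (i u₀)
  memLp_top : MemLp (fun t => liftL2w i α (v t)) ⊤ (timeMeasure T)
  memSobolev : MemSobolev 2 T (fun t => augEmb i α (v t))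
  memLinftyLq : MemLinftyLq i α q T v

variable {X H : Type*} [NormedAddCommGroup X] [NormedSpace ℝ X]
  [NormedAddCommGroup H] [InnerProductSpace ℝ H] {i : X →L[ℝ] H} {E : X → ℝ} {α T : ℝ} {u₀ : X}

theorem memLp_of_subsingleton {Ω Y : Type*} [MeasurableSpace Ω] [NormedAddCommGroup Y]
    [Subsingleton Y] (f : Ω → Y) (p : ℝ≥0∞) (μ : Measure Ω) : MemLp f p μ := by
  rw [Subsingleton.elim f 0]
  exact MemLp.zero

theorem subsingleton_Lp {Ω Y : Type*} [MeasurableSpace Ω] [NormedAddCommGroup Y] [Subsingleton Y]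
    {p : ℝ≥0∞} {μ : Measure Ω} : Subsingleton (Lp Y p μ) :=
  ⟨fun _ _ => Lp.ext (Eventually.of_forall fun _ => Subsingleton.elim _ _)⟩

theorem hasWeakDeriv_of_subsingleton {Y : Type*} [NormedAddCommGroup Y] [NormedSpace ℝ Y]
    [Subsingleton Y] (T : ℝ) (f d : ℝ → Y) : HasWeakDeriv T f d :=
  fun _ _ _ _ => Subsingleton.elim _ _

theorem hasLineDerivAt_of_subsingleton [Subsingleton X] (Φ : X → ℝ) (l : StrongDual ℝ X)
    (x v : X) : HasLineDerivAt ℝ Φ (-(l v)) x v := by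
  rw [Subsingleton.elim v 0, map_zero, neg_zero]
  exact hasLineDerivAt_zero

/-- On the trivial space both flows are trivial. -/
theorem isCanonicalPair_of_subsingleton [Subsingleton X] (hi_dense : DenseRange i) (p q : ℝ) :
    IsCanonicalPair i E α p q T u₀ (fun _ => 0) (fun _ => 0) := by
  have hH : Subsingleton H := by
    refine subsingleton_of_forall_eq 0 fun y => ?_
    have h1 : y ∈ closure (range i) := hi_dense y
    have h2 : range i = {0} := by
      ext z
      constructor
      · rintro ⟨x, rfl⟩
        rw [Subsingleton.elim x 0, map_zero]; rfl
      · rintro rfl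
        exact ⟨0, map_zero i⟩
    rwa [h2, closure_singleton] at h1
  have h1 : Subsingleton (L2w α X) := subsingleton_Lp
  have h2 : Subsingleton (L2w α H) := subsingleton_Lp
  have h3 : Subsingleton (L2w₀ α H) := subsingleton_Lp
  have h4 : Subsingleton (StrongDual ℝ X) :=
    ⟨fun l l' => ContinuousLinearMap.ext fun x => by rw [Subsingleton.elim x 0, map_zero, map_zero]⟩
  have h5 : Subsingleton (StrongDual ℝ (L2w α X)) :=
    ⟨fun l l' => ContinuousLinearMap.ext fun x => by rw [Subsingleton.elim x 0, map_zero, map_zero]⟩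
  exact
    { fractional := ⟨memLp_of_subsingleton _ _ _, memLp_of_subsingleton _ _ _,
        memLp_of_subsingleton _ _ _, ⟨fun _ => 0, memLp_of_subsingleton _ _ _,
          hasWeakDeriv_of_subsingleton _ _ _,
          Eventually.of_forall fun t v => hasLineDerivAt_of_subsingleton E _ _ v⟩,
        continuousOn_of_forall_continuousAt fun t _ => continuous_of_const
          (fun _ _ => Subsingleton.elim _ _) |>.continuousAt,
        tendsto_const_nhds.congr fun t => Subsingleton.elim 0 _⟩
      augmented := ⟨memLp_of_subsingleton _ _ _, memLp_of_subsingleton _ _ _,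
        memLp_of_subsingleton _ _ _, ⟨fun _ => 0, memLp_of_subsingleton _ _ _,
          hasWeakDeriv_of_subsingleton _ _ _,
          Eventually.of_forall fun t v => hasLineDerivAt_of_subsingleton _ _ _ v⟩,
        fun _ => 0, continuousOn_const, Eventually.of_forall fun _ => Subsingleton.elim _ _, rfl⟩
      corresponds := ⟨Eventually.of_forall fun _ => Subsingleton.elim _ _,
        Eventually.of_forall fun _ => Eventually.of_forall fun _ => Subsingleton.elim _ _⟩
      unique_fractional := fun _ _ => Eventually.of_forall fun _ => Subsingleton.elim _ _
      unique_augmented := fun _ _ => Eventually.of_forall fun _ => Subsingleton.elim _ _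
      memFracSobolev := ⟨memLp_of_subsingleton _ _ _, fun _ => 0, memLp_of_subsingleton _ _ _,
        hasWeakDeriv_of_subsingleton _ _ _⟩
      memLp_top := memLp_of_subsingleton _ _ _
      memSobolev := ⟨memLp_of_subsingleton _ _ _, fun _ => 0, memLp_of_subsingleton _ _ _,
        hasWeakDeriv_of_subsingleton _ _ _⟩
      memLinftyLq := ⟨fun _ => 0, aestronglyMeasurable_const,
        Eventually.of_forall fun _ => Eventually.of_forall fun _ => Subsingleton.elim _ _, 0,
        Eventually.of_forall fun θ => by simp⟩ }

variable [CompleteSpace X] [CompleteSpace H]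

/-- The series of modes is the canonical pair. Its summability rests on the initial force
`- grad E (u₀)` being an element of `X'`. -/
theorem exists_isCanonicalPair_of_eigenBasis {A : X →L[ℝ] StrongDual ℝ X} {C₁ C₂ : ℝ} {ι : Type*}
    [Countable ι] (e : EigenBasis i A C₁ C₂ ι) (hC₂ : 0 ≤ C₂) (hT : 0 < T) (hα₀ : 0 < α)
    (hα₁ : α < 1) (hi : Function.Injective i) (hE : Differentiable ℝ E)
    (hA : ∀ u, gradH E u = gradH E 0 + A u) (u₀ : X) :
    ∃ u v, IsCanonicalPair i E α 2 2 T u₀ u v := by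
  obtain ⟨K, f, hf⟩ := exists_isModeFamily e hα₀ hα₁ hT.le hC₂ (e.summable_sq_div (-gradH E u₀))
  have hu := isFractionalSolution_stateSeries e hT hα₀ hα₁ hi hE hA hf
  have hv := isGradientFlowSolution_memorySeries e hT hα₀ hα₁ hi hE hA hf
  exact ⟨stateSeries e α u₀ f, memorySeries e α f,
    { fractional := hu
      augmented := hv
      corresponds := corresponds_memorySeries e hα₀ hα₁ hi hA hf
      unique_fractional := fun _ h => IsFractionalSolution.ae_eq e hT hα₀ hα₁ hi hE hA hu h
      unique_augmented := fun _ h => IsGradientFlowSolution.ae_eq e hT hα₀ hα₁ hi hE hA hv h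
      memFracSobolev := memFracSobolev_stateSeries e hα₀ hα₁ hf
      memLp_top := memLp_top_liftL2w_memorySeries e hα₀ hα₁ hf
      memSobolev := memSobolev_memorySeries e hα₀ hα₁ hf
      memLinftyLq := memLinftyLq_memorySeries e hT.le hα₀ hα₁ hf }⟩

/-- Under the hypotheses on the gradient, both flows have exactly one solution, and these correspond
to each other. -/
theorem exists_isCanonicalPair [TopologicalSpace.SeparableSpace H] (hX : IsReflexive X)
    (hi_inj : Function.Injective i) (hi_dense : DenseRange i) (hi_compact : IsCompactOperator i)
    (hE : ContDiff ℝ 1 E) {p q : ℝ} (hpq : p.HolderConjugate q)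
    {C₀ C₁ C₂ : ℝ} (hC₁ : 0 < C₁) (hC₂ : 0 < C₂)
    (hbound : ∀ u : X, ‖gradH E u‖ ≤ C₀ * ‖u‖ ^ (p - 1) + C₀)
    (hcoercive : ∀ u : X, C₁ * ‖u‖ ^ p - C₂ * ‖i u‖ ^ 2 ≤ gradH E u u)
    (hT : 0 < T) (hweak : WeakToWeakContinuous (gradH E) T p q hpq)
    (u₀ : X) (hα₀ : 0 < α) (hα₁ : α < 1) : ∃ u v, IsCanonicalPair i E α p q T u₀ u v := by
  have hEd : Differentiable ℝ E := hE.differentiable one_ne_zero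
  obtain ⟨A, hA⟩ := exists_continuousLinearMap_of_midpoint
    (F := gradH E) (hE.continuous_fderiv one_ne_zero) (hweak.map_midpoint hT)
  rcases exponent_eq_two_or_subsingleton hA hpq.lt hC₁ hbound hcoercive with rfl | hsub
  · have hq : q = 2 := by
      have h := hpq.inv_add_inv_eq_one
      have h1 : q⁻¹ = 2⁻¹ := by linarith
      exact inv_injective h1
    subst hq
    have hsymm : ∀ u v, A u v = A v u := by
      refine second_derivative_symmetric (f := E) (f' := gradH E) (x := 0)
        (fun y => (hEd y).hasFDerivAt) ?_
      have h1 : gradH E = fun u => gradH E 0 + A u := funext hA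
      rw [h1]
      exact A.hasFDerivAt.const_add _
    -- averaging over `u` and `-u` removes the affine part of the gradient
    have hcoer : ∀ u, C₁ * ‖u‖ ^ 2 ≤ A u u + C₂ * ‖i u‖ ^ 2 := fun u => by
      have h1 := hcoercive u
      have h2 := hcoercive (-u)
      rw [hA] at h1 h2
      simp only [add_apply, map_neg, neg_apply, norm_neg, Real.rpow_two] at h1 h2
      linarith
    obtain ⟨ι, _, ⟨e⟩⟩ := exists_eigenBasis hX hi_dense hi_compact hsymm hC₁ hcoer
    exact exists_isCanonicalPair_of_eigenBasis e hC₂.le hT hα₀ hα₁ hi_inj hEd hA u₀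
  · exact ⟨_, _, isCanonicalPair_of_subsingleton hi_dense p q⟩

end Canonical

end FracGF

end

theorem mainTheorem3
    {X H : Type*} [NormedAddCommGroup X] [NormedSpace ℝ X] [CompleteSpace X]
    [TopologicalSpace.SeparableSpace X] [NormedAddCommGroup H] [InnerProductSpace ℝ H] [CompleteSpace H]
    [TopologicalSpace.SeparableSpace H]
    (hX : FracGF.IsReflexive X)
    (i : X →L[ℝ] H) (hi_inj : Function.Injective i) (hi_dense : DenseRange i)
    (hi_compact : IsCompactOperator i)
    (E : X → ℝ) (hE : ContDiff ℝ 1 E)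
    (p q : ℝ) (hpq : p.HolderConjugate q)
    (C₀ C₁ C₂ : ℝ) (hC₀ : 0 < C₀) (hC₁ : 0 < C₁) (hC₂ : 0 < C₂)
    (hbound : ∀ u : X, ‖FracGF.gradH E u‖ ≤ C₀ * ‖u‖ ^ (p - 1) + C₀)
    (hcoercive : ∀ u : X, C₁ * ‖u‖ ^ p - C₂ * ‖i u‖ ^ 2 ≤ FracGF.gradH E u u)
    (T : ℝ) (hT : 0 < T)
    (hweak : FracGF.WeakToWeakContinuous (FracGF.gradH E) T p q hpq)
    (u₀ : X) (α : ℝ) (hα₀ : 0 < α) (hα₁ : α < 1) :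
    -- every solution of the fractional flow comes from a solution of the augmented flow
    (∀ u : ℝ → X, FracGF.IsFractionalSolution i E α p q T (i u₀) u →
      ∃ v : ℝ → FracGF.L2w α X,
        FracGF.IsGradientFlowSolution (FracGF.augEmb i α) (FracGF.augEnergy i E α u₀)
          p q T 0 v ∧
        FracGF.Corresponds i E α T u₀ u v) ∧
    -- and vice versa
    (∀ v : ℝ → FracGF.L2w α X,
      FracGF.IsGradientFlowSolution (FracGF.augEmb i α) (FracGF.augEnergy i E α u₀)
        p q T 0 v →
      ∃ u : ℝ → X, FracGF.IsFractionalSolution i E α p q T (i u₀) u ∧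
        FracGF.Corresponds i E α T u₀ u v) ∧
    -- the correspondence is one-to-one (functions of time are identified when equal a.e.)
    (∀ (u u' : ℝ → X) (v v' : ℝ → FracGF.L2w α X),
      FracGF.IsFractionalSolution i E α p q T (i u₀) u →
      FracGF.IsFractionalSolution i E α p q T (i u₀) u' →
      FracGF.IsGradientFlowSolution (FracGF.augEmb i α) (FracGF.augEnergy i E α u₀)
        p q T 0 v →
      FracGF.IsGradientFlowSolution (FracGF.augEmb i α) (FracGF.augEnergy i E α u₀)
        p q T 0 v' →
      FracGF.Corresponds i E α T u₀ u v → FracGF.Corresponds i E α T u₀ u' v' →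
      (u =ᵐ[FracGF.timeMeasure T] u' ↔ v =ᵐ[FracGF.timeMeasure T] v')) ∧
    -- regularity
    (∀ (u : ℝ → X) (v : ℝ → FracGF.L2w α X),
      FracGF.IsFractionalSolution i E α p q T (i u₀) u →
      FracGF.IsGradientFlowSolution (FracGF.augEmb i α) (FracGF.augEnergy i E α u₀)
        p q T 0 v →
      FracGF.Corresponds i E α T u₀ u v →
      MemLp u (ENNReal.ofReal p) (FracGF.timeMeasure T) ∧
      MemLp (fun t => i (u t)) ∞ (FracGF.timeMeasure T) ∧
      FracGF.MemFracSobolev α 2 T (fun t => i (u t)) (i u₀) ∧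
      MemLp (fun t => FracGF.liftL2w i α (v t)) ∞ (FracGF.timeMeasure T) ∧
      FracGF.MemSobolev 2 T (fun t => FracGF.augEmb i α (v t)) ∧
      FracGF.MemLinftyLq i α q T v) := by
  obtain ⟨u₁, v₁, h⟩ := FracGF.exists_isCanonicalPair (u₀ := u₀) hX hi_inj hi_dense hi_compact hE hpq
    hC₁ hC₂ hbound hcoercive hT hweak hα₀ hα₁
  refine ⟨fun u hu => ⟨v₁, h.augmented, ?_⟩, fun v hv => ⟨u₁, h.fractional, ?_⟩,
    fun u u' v v' hu hu' hv hv' _ _ => ⟨fun _ => ?_, fun _ => ?_⟩, fun u v hu hv _ => ?_⟩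
  · exact h.corresponds.congr (h.unique_fractional u hu) (EventuallyEq.refl _ _)
  · exact h.corresponds.congr (EventuallyEq.refl _ _) (h.unique_augmented v hv)
  · exact (h.unique_augmented v hv).symm.trans (h.unique_augmented v' hv')
  · exact (h.unique_fractional u hu).symm.trans (h.unique_fractional u' hu')
  · have hv1 := h.unique_augmented v hv
    exact ⟨hu.memLp, hu.memLp_top,
      h.memFracSobolev.congr ((h.unique_fractional u hu).mono fun t ht => congrArg i ht),
      h.memLp_top.ae_eq (hv1.mono fun t ht => congrArg (FracGF.liftL2w i α) ht),
      h.memSobolev.congr (hv1.mono fun t ht => congrArg (FracGF.augEmb i α) ht),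
      h.memLinftyLq.congr hv1⟩
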